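/- Let $0<q<1$ and $[a]_q=\frac{q^{a/2}-q^{-a/2}}{q^{1/2}-q^{-1/2}}$, $[k]_q!=\prod_{i=1}^k[i]_q$, $([a]_q)_k=\prod_{i=0}^{k-1}[a+i]_q$. Let $U_q=U_q(sl(2,\mathbb C))$ be generated by $e,f,h$ with $[h,e]=2e$, $[h,f]=-2f$, $[e,f]=[h]_q$ and comultiplication $\Delta(h)=h\otimes1+1\otimes h$, $\Delta(e)=e\otimes q^{h/4}+q^{-h/4}\otimes e$, $\Delta(f)=f\otimes q^{h/4}+q^{-h/4}\otimes f$, acting on tensor products through $\Delta$, and with universal $R$-matrix $$\mathcal R=q^{\frac14 h\otimes h}\sum_{k\ge0}\frac{(1-q^{-1})^kq^{-\frac14k(k-1)}}{[k]_q!}\,(q^{\frac14kh}e^k\otimes q^{-\frac14kh}f^k).$$ Let $M_{q,\lambda}$ be the Verma module with highest weight vector $x_\lambda$ of weight $\lambda\in\mathbb C$ and basis $x^\lambda_{\lambda-2k}=f^k x_\lambda$ ($k\ge0$), and for $j\in\frac12\mathbb Z_{\ge0}$ let $V^j=M'_{q,2j}$ be the irreducible quotient of $M_{q,2j}$, with basis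 $x^{2j}_{2m}=f^{j-m}x_{2j}$ and standard basis $e^j_m=\bigl(([j+m+1]_q)_{j-m}[j-m]_q!\bigr)^{-1/2}x^{2j}_{2m}$ ($m=-j,-j+1,\dots,j$). Equip $V^j$ with the (Shapovalov) symmetric bilinear form for which the $e^j_m$ are orthonormal, and tensor products with the product form; write $\|v\|$ for the positive square root of $\langle v,v\rangle$ when $\langle v,v\rangle>0$. *Exchange matrix.* For generic $\lambda$, a $U_q$-module $V$ spanned by its weight vectors, with real parts of the weights bounded from above, and a weight vector $v\in V$ of weight $\mathrm{wt}(v)$, let $\Phi^v_{q,\lambda}:M_{q,\lambda}\to M_{q,\mu}\otimes V$, $\mu=\lambda-\mathrm{wt}(v)$, be the unique intertwining operator with $\Phi^v_{q,\lambda}(x_\lambda)=\sum_{k\ge0}f^kx_\mu\otimes v_k$, $v_0=v$. The fusion matrix $J_{W,V}(\lambda)$ on $W\otimes V$ is defined by $(\Phi^w_{q,\lambda-\mathrm{wt}(v)}\otimes\mathrm{id})\circ\Phi^v_{q,\lambda}=\Phi_{q,\lambda}^{J_{W,V}(\lambda)(w\otimes v)}$, and the exchange matrix is $R_{V,W}(\lambda)=J_{V,W}(\lambda)^{-1}\mathcal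 R^{21}J^{21}_{W,V}(\lambda)$, where $\mathcal R^{21}=P\mathcal RP$, $J^{21}=PJP$ and $P$ is the flip. For integers $0\le m,n\le s$ its matrix elements are given by $$R_{M_{q,\gamma},M_{q,\delta}}(\lambda)(x^\gamma_{\gamma-2n}\otimes x^\delta_{\delta-2s+2n})=\sum_{m=0}^sR_{q,\gamma,\delta,s;m,n}(\lambda)\,x^\gamma_{\gamma-2m}\otimes x^\delta_{\delta-2s+2m}.$$ By the same normalization, let $\Phi_{q,2j}^{v}:V^j\to V^{j_1}\otimes V^{j_2}$, $v=x^{2j_2}_{2j-2j_1}$, be the intertwining operator with $\Phi_{q,2j}^{v}(x_{2j})=\sum_k f^kx_{2j_1}\otimes v_k$, $v_0=v$, whenever $V^j$ occurs in $V^{j_1}\otimes V^{j_2}$, i.e. $j\in\{|j_1-j_2|,|j_1-j_2|+1,\dots,j_1+j_2\}$. *$q$-Racah coefficients.* If $V^j$ occurs in $V^{j_1}\otimes V^{j_2}$, let $e^j_m(j_1,j_2)$ be the standard basis (the image of $(e^j_m)_m$ under an intertwining embedding of $V^j$) of the submodule $V^j$ of $V^{j_1}\otimes V^{j_2}$, orthonormal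 and with $\langle e^j_j(j_1,j_2),e^{j_1}_{j_1}\otimes e^{j_2}_{j-j_1}\rangle>0$. Using this twice, let $e_m^{j_{12},j}(j_1,j_2\mid j_3)$ and $e_m^{j_{23},j}(j_1\mid j_2,j_3)$ be the standard bases of $V^j$ within $V^{j_{12}}\otimes V^{j_3}$, respectively within $V^{j_1}\otimes V^{j_{23}}$, within $V^{j_1}\otimes V^{j_2}\otimes V^{j_3}$. The $q$-Racah coefficients are defined by $$e_m^{j_{12},j}(j_1,j_2\mid j_3)=\sum_{j_{23}}{}_qW^{j_2,j_3,j_{23}}_{j_{12}-j_1,\,j-j_{12},\,j-j_1}(j)\;e_m^{j_{23},j}(j_1\mid j_2,j_3)\qquad(m=-j,\dots,j),$$ the sum being over all $j_{23}$ such that $V^{j_{23}}$ occurs in $V^{j_2}\otimes V^{j_3}$ and $V^j$ occurs in $V^{j_1}\otimes V^{j_{23}}$. **Theorem.** Let $j_1,j_2,j_3,j,j_{12},j_{13}\in\frac12\mathbb Z_{\ge0}$ be such that $j_1+j_2+j_3-j$, $j_1+j_2-j_3+j$, $j_1-j_2+j_3+j$, $-j_1+j_2+j_3+j\in\mathbb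 Z_{\ge0}$, that $$\max(|j-j_3|,|j_1-j_2|)\le j_{12}\le\min(j+j_3,j_1+j_2),\qquad \max(|j-j_2|,|j_3-j_1|)\le j_{13}\le\min(j+j_2,j_3+j_1),$$ and that $j_1+j_2-j_{12}$ and $j_2+j_{13}-j$ are integers. Put $c_j=j(j+1)$. Then $R_{q,2j_2,2j_3,s;m,n}(\lambda)$ with $s=j_1+j_2+j_3-j$, $m=j_1+j_2-j_{12}$, $n=j_2+j_{13}-j$ has a limit for $\lambda\to2j$, denoted by $R_{q,2j_2,2j_3,s;m,n}(2j)$, and $$(-1)^{j+j_1-j_{12}-j_{13}}\,q^{\frac12(c_j+c_{j_1}-c_{j_{12}}-c_{j_{13}})}\;{}_qW^{j_1,j_2,j_{12}}_{j_{13}-j_3,\,j-j_{13},\,j-j_3}(j)$$ $$=\frac{\|\Phi_{q,2j_{12}}^{x^{2j_2}_{2j_{12}-2j_1}}(x_{2j_{12}})\|\;\|\Phi_{q,2j}^{x^{2j_3}_{2j-2j_{12}}}(x_{2j})\|}{\|\Phi_{q,2j_{13}}^{x^{2j_3}_{2j_{13}-2j_1}}(x_{2j_{13}})\|\;\|\Phi_{q,2j}^{x^{2j_2}_{2j-2j_{13}}}(x_{2j})\|}\;R_{q,\,2j_2,\,2j_3,\,j_1+j_2+j_3-j;\;j_1+j_2-j_{12},\,j_2+j_{13}-j}(2j).$$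 -/

import Mathlib

open scoped TensorProduct ComplexOrder Topology

noncomputable section

namespace QuantumSl2

/-! ### q-numbers -/

/-- The `q`-number `[a]_q = (q^{a/2} - q^{-a/2}) / (q^{1/2} - q^{-1/2})`. -/
def qNum (q : ℝ) (a : ℂ) : ℂ :=
  ((q : ℂ) ^ (a / 2) - (q : ℂ) ^ (-a / 2)) / ((q : ℂ) ^ (1 / 2 : ℂ) - (q : ℂ) ^ (-1 / 2 : ℂ))

/-- The `q`-factorial `[k]_q! = [1]_q [2]_q ⋯ [k]_q`. -/
def qFact (q : ℝ) (k : ℕ) : ℂ := ∏ i ∈ Finset.range k, qNum q (i + 1)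

/-- The `q`-Pochhammer symbol `([a]_q)_k = [a]_q [a+1]_q ⋯ [a+k-1]_q`. -/
def qPoch (q : ℝ) (a : ℂ) (k : ℕ) : ℂ := ∏ i ∈ Finset.range k, qNum q (a + i)

/-! ### Functions of a diagonalizable operator -/

section WeightFun

variable {V W : Type*} [AddCommGroup V] [Module ℂ V] [AddCommGroup W] [Module ℂ W]

open Classical in
/-- Decomposition of a space which is spanned by eigenvectors of `h`. -/
theorem bijective_eigenspace (h : Module.End ℂ V)
    (hh : Submodule.span ℂ {v : V | ∃ μ : ℂ, h v = μ • v} = ⊤) :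
    Function.Bijective
      (DirectSum.coeLinearMap (fun μ : ℂ => Module.End.eigenspace h μ)) := by
  refine DirectSum.isInternal_submodule_of_iSupIndep_of_iSup_eq_top
    (Module.End.eigenspaces_iSupIndep h) ?_
  rw [eq_top_iff, ← hh, Submodule.span_le]
  rintro v ⟨μ, hv⟩
  exact Submodule.mem_iSup_of_mem μ (Module.End.mem_eigenspace_iff.2 hv)

open Classical in
/-- The linear map which is given on the eigenspace of `h` with eigenvalue `μ` by `T μ`. -/
def eigenLift (h : Module.End ℂ V)
    (hh : Submodule.span ℂ {v : V | ∃ μ : ℂ, h v = μ • v} = ⊤) (T : ℂ → V →ₗ[ℂ] W) :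
    V →ₗ[ℂ] W :=
  DirectSum.toModule ℂ ℂ W (fun μ : ℂ => T μ ∘ₗ (Module.End.eigenspace h μ).subtype) ∘ₗ
    (LinearEquiv.ofBijective
      (DirectSum.coeLinearMap (fun μ : ℂ => Module.End.eigenspace h μ))
      (bijective_eigenspace h hh)).symm.toLinearMap

theorem eigenLift_apply (h : Module.End ℂ V)
    (hh : Submodule.span ℂ {v : V | ∃ μ : ℂ, h v = μ • v} = ⊤) (T : ℂ → V →ₗ[ℂ] W)
    {μ : ℂ} {v : V} (hv : h v = μ • v) : eigenLift h hh T v = T μ v := by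
  classical
  have key : (LinearEquiv.ofBijective
      (DirectSum.coeLinearMap (fun μ : ℂ => Module.End.eigenspace h μ))
      (bijective_eigenspace h hh)).symm v
      = DirectSum.lof ℂ ℂ (fun μ : ℂ => Module.End.eigenspace h μ) μ
          ⟨v, Module.End.mem_eigenspace_iff.2 hv⟩ := by
    rw [LinearEquiv.symm_apply_eq]
    simp [LinearEquiv.ofBijective_apply, DirectSum.coeLinearMap_lof]
  simp only [eigenLift, LinearMap.comp_apply, LinearEquiv.coe_coe]
  erw [key, DirectSum.toModule_lof]
  rfl

/-- An operator that acts by `g μ` on each vector of a spanning set of eigenvectors of `h` (with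
eigenvalue `μ`) acts so on all eigenvectors. -/
theorem apply_of_spanning (h D : Module.End ℂ V) (g : ℂ → ℂ) (S : Set V)
    (hS : Submodule.span ℂ S = ⊤) (hSD : ∀ v ∈ S, ∃ μ : ℂ, h v = μ • v ∧ D v = g μ • v)
    {μ : ℂ} {v : V} (hv : h v = μ • v) : D v = g μ • v := by
  have hh : Submodule.span ℂ {v : V | ∃ μ : ℂ, h v = μ • v} = ⊤ := by
    rw [eq_top_iff, ← hS]
    exact Submodule.span_mono fun v hv => let ⟨μ, h1, _⟩ := hSD v hv; ⟨μ, h1⟩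
  have : D = eigenLift h hh (fun μ => g μ • LinearMap.id) := by
    refine LinearMap.ext_on hS fun v hv => ?_
    obtain ⟨μ, h1, h2⟩ := hSD v hv
    rw [h2, eigenLift_apply h hh _ h1]; rfl
  rw [this, eigenLift_apply h hh _ hv]; rfl

end WeightFun

/-! ### Modules over `U_q(sl(2, ℂ))` -/

/-- A `U_q(sl(2,ℂ))`-module (for `0 < q < 1`) which is spanned by its weight vectors, with the
real parts of the weights bounded from above. The generators act by `h`, `e`, `f`, where
`[h,e] = 2e`, `[h,f] = -2f` and `[e,f] = [h]_q`; functions of `h`, such as `[h]_q` and `q^{h/4}`,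
act on vectors of weight `μ` by their value at `μ`. -/
structure UqModule (q : ℝ) (V : Type*) [AddCommGroup V] [Module ℂ V] where
  h : Module.End ℂ V
  e : Module.End ℂ V
  f : Module.End ℂ V
  spanned : ∃ B : ℝ, Submodule.span ℂ {v : V | ∃ μ : ℂ, μ.re ≤ B ∧ h v = μ • v} = ⊤
  h_e : h * e - e * h = (2 : ℂ) • e
  h_f : h * f - f * h = (-2 : ℂ) • f
  e_f : ∀ (μ : ℂ) (v : V), h v = μ • v → e (f v) - f (e v) = qNum q μ • v

namespace UqModule

section Basic

variable {q : ℝ} {V W : Type*} [AddCommGroup V] [Module ℂ V] [AddCommGroup W] [Module ℂ W]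

theorem spanned_weight (M : UqModule q V) :
    Submodule.span ℂ {v : V | ∃ μ : ℂ, M.h v = μ • v} = ⊤ := by
  obtain ⟨B, hB⟩ := M.spanned
  rw [eq_top_iff, ← hB]
  exact Submodule.span_mono fun v ⟨μ, _, h⟩ => ⟨μ, h⟩

/-- The operator `q^{c h}`. -/
def qPowH (M : UqModule q V) (c : ℂ) : Module.End ℂ V :=
  eigenLift M.h M.spanned_weight (fun μ => ((q : ℂ) ^ (c * μ)) • LinearMap.id)

theorem qPowH_apply (M : UqModule q V) (c : ℂ) {μ : ℂ} {v : V} (hv : M.h v = μ • v) :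
    M.qPowH c v = ((q : ℂ) ^ (c * μ)) • v := by
  rw [qPowH, eigenLift_apply _ _ _ hv]; rfl

theorem e_weight (M : UqModule q V) {μ : ℂ} {v : V} (hv : M.h v = μ • v) :
    M.h (M.e v) = (μ + 2) • M.e v := by
  have := congrArg (fun T : Module.End ℂ V => T v) M.h_e
  simp only [LinearMap.sub_apply, Module.End.mul_apply, LinearMap.smul_apply, hv, map_smul] at this
  rw [add_smul, ← this]; abel

theorem f_weight (M : UqModule q V) {μ : ℂ} {v : V} (hv : M.h v = μ • v) :
    M.h (M.f v) = (μ - 2) • M.f v := by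
  have := congrArg (fun T : Module.End ℂ V => T v) M.h_f
  simp only [LinearMap.sub_apply, Module.End.mul_apply, LinearMap.smul_apply, hv, map_smul] at this
  rw [sub_eq_add_neg, add_smul, ← this]; abel

theorem e_pow_weight (M : UqModule q V) {μ : ℂ} {v : V} (hv : M.h v = μ • v) (n : ℕ) :
    M.h ((M.e ^ n) v) = (μ + 2 * n) • (M.e ^ n) v := by
  induction n with
  | zero => simpa using hv
  | succ n ih =>
    rw [pow_succ', Module.End.mul_apply, M.e_weight ih]
    congr 1; push_cast; ring

/-- `e` acts locally nilpotently, since the weights are bounded from above. -/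
theorem e_locally_nilpotent (M : UqModule q V) (v : V) : ∃ n, ∀ k, n ≤ k → (M.e ^ k) v = 0 := by
  obtain ⟨B, hB⟩ := M.spanned
  have hv : v ∈ Submodule.span ℂ {v : V | ∃ μ : ℂ, μ.re ≤ B ∧ M.h v = μ • v} := by
    rw [hB]; trivial
  induction hv using Submodule.span_induction with
  | mem v hv =>
    obtain ⟨μ, hμ, hv⟩ := hv
    obtain ⟨n, hn⟩ := exists_nat_gt (B - μ.re)
    refine ⟨n, fun k hk => ?_⟩
    have hw := M.e_pow_weight hv k
    -- the zero vector is the only vector of weight above the bound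
    have h0 := apply_of_spanning M.h (0 : Module.End ℂ V)
      (fun ν => if ν.re ≤ B then 0 else 1) _ hB (by
        rintro w ⟨ν, hν, hw⟩
        exact ⟨ν, hw, by simp [hν]⟩) hw
    have hlt : ¬ (μ + 2 * (k : ℂ)).re ≤ B := by
      have : (n : ℝ) ≤ k := by exact_mod_cast hk
      have h0 : (0 : ℝ) ≤ k := by positivity
      simp only [Complex.add_re, Complex.mul_re, Complex.natCast_re, Complex.natCast_im,
        Complex.re_ofNat, Complex.im_ofNat]
      linarith
    rw [if_neg hlt, one_smul] at h0
    exact h0.symm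
  | zero => exact ⟨0, fun k _ => map_zero _⟩
  | add x y _ _ hx hy =>
    obtain ⟨n, hn⟩ := hx
    obtain ⟨m, hm⟩ := hy
    refine ⟨max n m, fun k hk => ?_⟩
    rw [map_add, hn k (le_trans (le_max_left _ _) hk), hm k (le_trans (le_max_right _ _) hk),
      add_zero]
  | smul a x _ hx =>
    obtain ⟨n, hn⟩ := hx
    exact ⟨n, fun k hk => by rw [map_smul, hn k hk, smul_zero]⟩

/-- `U_q`-intertwining linear maps. -/
def IsIntertwining (M : UqModule q V) (N : UqModule q W) (T : V →ₗ[ℂ] W) : Prop :=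
  (∀ v, T (M.h v) = N.h (T v)) ∧ (∀ v, T (M.e v) = N.e (T v)) ∧ ∀ v, T (M.f v) = N.f (T v)

end Basic

/-! ### Tensor products -/

section Tensor

variable {q : ℝ} {V W : Type*} [AddCommGroup V] [Module ℂ V] [AddCommGroup W] [Module ℂ W]

theorem span_tmul_weight (M : UqModule q V) (N : UqModule q W) {B C : ℝ}
    (hB : Submodule.span ℂ {v : V | ∃ μ : ℂ, μ.re ≤ B ∧ M.h v = μ • v} = ⊤)
    (hC : Submodule.span ℂ {v : W | ∃ μ : ℂ, μ.re ≤ C ∧ N.h v = μ • v} = ⊤) :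
    Submodule.span ℂ {x : V ⊗[ℂ] W | ∃ (v : V) (w : W) (μ ν : ℂ), μ.re ≤ B ∧ ν.re ≤ C ∧
      M.h v = μ • v ∧ N.h w = ν • w ∧ v ⊗ₜ[ℂ] w = x} = ⊤ := by
  rw [eq_top_iff, ← TensorProduct.span_tmul_eq_top, Submodule.span_le]
  rintro _ ⟨v, w, rfl⟩
  have hv : v ∈ Submodule.span ℂ {v : V | ∃ μ : ℂ, μ.re ≤ B ∧ M.h v = μ • v} := by
    rw [hB]; trivial
  have hw : w ∈ Submodule.span ℂ {v : W | ∃ μ : ℂ, μ.re ≤ C ∧ N.h v = μ • v} := by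
    rw [hC]; trivial
  have := Submodule.apply_mem_map₂ (TensorProduct.mk ℂ V W) hv hw
  rw [Submodule.map₂_span_span] at this
  refine Submodule.span_mono ?_ this
  rintro _ ⟨v, ⟨μ, hμ, hv⟩, w, ⟨ν, hν, hw⟩, rfl⟩
  exact ⟨v, w, μ, ν, hμ, hν, hv, hw, rfl⟩

/-- The tensor product of two modules, with the action given by the comultiplication
`Δ(h) = h ⊗ 1 + 1 ⊗ h`, `Δ(e) = e ⊗ q^{h/4} + q^{-h/4} ⊗ e`, `Δ(f) = f ⊗ q^{h/4} + q^{-h/4} ⊗ f`. -/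
def tensor (hq : 0 < q) (M : UqModule q V) (N : UqModule q W) : UqModule q (V ⊗[ℂ] W) where
  h := TensorProduct.map M.h LinearMap.id + TensorProduct.map LinearMap.id N.h
  e := TensorProduct.map M.e (N.qPowH (1 / 4)) + TensorProduct.map (M.qPowH (-1 / 4)) N.e
  f := TensorProduct.map M.f (N.qPowH (1 / 4)) + TensorProduct.map (M.qPowH (-1 / 4)) N.f
  spanned := by
    obtain ⟨B, hB⟩ := M.spanned
    obtain ⟨C, hC⟩ := N.spanned
    refine ⟨B + C, ?_⟩
    rw [eq_top_iff, ← span_tmul_weight M N hB hC]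
    refine Submodule.span_mono ?_
    rintro _ ⟨v, w, μ, ν, hμ, hν, hv, hw, rfl⟩
    refine ⟨μ + ν, by simpa using add_le_add hμ hν, ?_⟩
    simp [hv, hw, TensorProduct.smul_tmul', add_smul]
  h_e := by
    obtain ⟨B, hB⟩ := M.spanned
    obtain ⟨C, hC⟩ := N.spanned
    refine LinearMap.ext_on (span_tmul_weight M N hB hC) ?_
    rintro _ ⟨v, w, μ, ν, hμ, hν, hv, hw, rfl⟩
    simp only [LinearMap.sub_apply, Module.End.mul_apply, LinearMap.add_apply,
      TensorProduct.map_tmul, LinearMap.id_apply, LinearMap.smul_apply, map_add, hv, hw,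
      M.qPowH_apply _ hv, N.qPowH_apply _ hw, map_smul, M.e_weight hv, N.e_weight hw,
      TensorProduct.tmul_smul, ← TensorProduct.smul_tmul']
    module
  h_f := by
    obtain ⟨B, hB⟩ := M.spanned
    obtain ⟨C, hC⟩ := N.spanned
    refine LinearMap.ext_on (span_tmul_weight M N hB hC) ?_
    rintro _ ⟨v, w, μ, ν, hμ, hν, hv, hw, rfl⟩
    simp only [LinearMap.sub_apply, Module.End.mul_apply, LinearMap.add_apply,
      TensorProduct.map_tmul, LinearMap.id_apply, LinearMap.smul_apply, map_add, hv, hw,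
      M.qPowH_apply _ hv, N.qPowH_apply _ hw, map_smul, M.f_weight hv, N.f_weight hw,
      TensorProduct.tmul_smul, ← TensorProduct.smul_tmul']
    module
  e_f := by
    intro κ x hx
    obtain ⟨B, hB⟩ := M.spanned
    obtain ⟨C, hC⟩ := N.spanned
    have hq' : (q : ℂ) ≠ 0 := by exact_mod_cast hq.ne'
    have := apply_of_spanning _
      ((TensorProduct.map M.e (N.qPowH (1 / 4)) + TensorProduct.map (M.qPowH (-1 / 4)) N.e) *
        (TensorProduct.map M.f (N.qPowH (1 / 4)) + TensorProduct.map (M.qPowH (-1 / 4)) N.f) -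
       (TensorProduct.map M.f (N.qPowH (1 / 4)) + TensorProduct.map (M.qPowH (-1 / 4)) N.f) *
        (TensorProduct.map M.e (N.qPowH (1 / 4)) + TensorProduct.map (M.qPowH (-1 / 4)) N.e))
      (qNum q) _ (span_tmul_weight M N hB hC) ?_ hx
    · simpa using this
    rintro _ ⟨v, w, μ, ν, hμ, hν, hv, hw, rfl⟩
    refine ⟨μ + ν, by simp [hv, hw, TensorProduct.smul_tmul', add_smul], ?_⟩
    have h1 : M.e (M.f v) = M.f (M.e v) + qNum q μ • v := by
      rw [← M.e_f μ v hv]; abel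
    have h2 : N.e (N.f w) = N.f (N.e w) + qNum q ν • w := by
      rw [← N.e_f ν w hw]; abel
    have key : qNum q (μ + ν) = qNum q μ * ((q : ℂ) ^ (1 / 4 * ν) * (q : ℂ) ^ (1 / 4 * ν))
        + qNum q ν * ((q : ℂ) ^ (-1 / 4 * μ) * (q : ℂ) ^ (-1 / 4 * μ)) := by
      simp only [qNum, div_mul_eq_mul_div, ← add_div, sub_mul, ← Complex.cpow_add _ _ hq']
      congr 1
      ring_nf
    simp only [LinearMap.sub_apply, Module.End.mul_apply, LinearMap.add_apply,
      TensorProduct.map_tmul, map_add, 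
      M.qPowH_apply _ hv, N.qPowH_apply _ hw, map_smul,
      M.qPowH_apply _ (M.e_weight hv), N.qPowH_apply _ (N.e_weight hw),
      M.qPowH_apply _ (M.f_weight hv), N.qPowH_apply _ (N.f_weight hw), h1, h2,
      TensorProduct.tmul_smul, ← TensorProduct.smul_tmul', TensorProduct.add_tmul,
      TensorProduct.tmul_add, key]
    have e1 : (q : ℂ) ^ (1 / 4 * (ν - 2)) * (q : ℂ) ^ (-1 / 4 * μ)
        = (q : ℂ) ^ (-1 / 4 * (μ + 2)) * (q : ℂ) ^ (1 / 4 * ν) := by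
      rw [← Complex.cpow_add _ _ hq', ← Complex.cpow_add _ _ hq']; ring_nf
    have e2 : (q : ℂ) ^ (1 / 4 * (ν + 2)) * (q : ℂ) ^ (-1 / 4 * μ)
        = (q : ℂ) ^ (-1 / 4 * (μ - 2)) * (q : ℂ) ^ (1 / 4 * ν) := by
      rw [← Complex.cpow_add _ _ hq', ← Complex.cpow_add _ _ hq']; ring_nf
    match_scalars <;> first
      | ring1
      | linear_combination e1
      | linear_combination -e1
      | linear_combination e2
      | linear_combination -e2

/-- The operator `q^{(h ⊗ h)/4}` on a tensor product. -/
def qPowHH (M : UqModule q V) (N : UqModule q W) : Module.End ℂ (V ⊗[ℂ] W) :=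
  TensorProduct.lift (eigenLift M.h M.spanned_weight
    (fun μ => (TensorProduct.mk ℂ V W).compl₂ (N.qPowH (μ / 4))))

/-- The `k`-th term of the universal `R`-matrix, acting on a tensor product:
`q^{(h⊗h)/4} (1-q⁻¹)^k q^{-k(k-1)/4} / [k]_q! (q^{kh/4} e^k ⊗ q^{-kh/4} f^k)`. -/
def rTerm (M : UqModule q V) (N : UqModule q W) (k : ℕ) : Module.End ℂ (V ⊗[ℂ] W) :=
  ((1 - (q : ℂ)⁻¹) ^ k * (q : ℂ) ^ (-((k : ℂ) * (k - 1)) / 4) / qFact q k) •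
    (qPowHH M N ∘ₗ
      TensorProduct.map (M.qPowH (k / 4) * M.e ^ k) (N.qPowH (-(k : ℂ) / 4) * N.f ^ k))

theorem rTerm_finite (M : UqModule q V) (N : UqModule q W) (x : V ⊗[ℂ] W) :
    (Function.support fun k => rTerm M N k x).Finite := by
  suffices h : ∃ n, ∀ k, n ≤ k → rTerm M N k x = 0 by
    obtain ⟨n, hn⟩ := h
    refine (Set.finite_lt_nat n).subset fun k hk => ?_
    by_contra hc
    exact hk (hn k (not_lt.1 hc))
  induction x using TensorProduct.induction_on with
  | zero => exact ⟨0, fun k _ => map_zero _⟩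
  | tmul v w =>
    obtain ⟨n, hn⟩ := M.e_locally_nilpotent v
    exact ⟨n, fun k hk => by simp [rTerm, hn k hk]⟩
  | add x y hx hy =>
    obtain ⟨n, hn⟩ := hx
    obtain ⟨m, hm⟩ := hy
    refine ⟨max n m, fun k hk => ?_⟩
    rw [map_add, hn k (le_trans (le_max_left _ _) hk), hm k (le_trans (le_max_right _ _) hk),
      add_zero]

/-- The action of the universal `R`-matrix on a tensor product (a locally finite sum). -/
def rMatrix (M : UqModule q V) (N : UqModule q W) : Module.End ℂ (V ⊗[ℂ] W) where
  toFun x := ∑ᶠ k, rTerm M N k x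
  map_add' x y := by
    simp only [map_add]
    exact finsum_add_distrib (rTerm_finite M N x) (rTerm_finite M N y)
  map_smul' a x := by
    simp only [map_smul, RingHom.id_apply]
    exact (smul_finsum' a (rTerm_finite M N x)).symm

end Tensor

end UqModule

/-! ### Verma modules and finite dimensional irreducible modules -/

theorem qNum_commutator {q : ℝ} (hq : 0 < q) (k l : ℂ) :
    qNum q (k + 1) * qNum q (l - k) - qNum q k * qNum q (l - k + 1) = qNum q (l - 2 * k) := by
  have hq' : (q : ℂ) ≠ 0 := by exact_mod_cast hq.ne'
  unfold qNum
  set d := (q : ℂ) ^ (1 / 2 : ℂ) - (q : ℂ) ^ (-1 / 2 : ℂ) with hd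
  rcases eq_or_ne d 0 with h0 | h0
  · simp [h0]
  rw [div_mul_div_comm, div_mul_div_comm, ← sub_div, div_eq_div_iff (mul_ne_zero h0 h0) h0, hd]
  simp only [sub_mul, mul_sub, ← Complex.cpow_add _ _ hq']
  ring_nf

theorem span_single_one (ι : Type*) :
    Submodule.span ℂ (Set.range fun i : ι => (Finsupp.single i 1 : ι →₀ ℂ)) = ⊤ := by
  simpa using (Finsupp.basisSingleOne (R := ℂ) (ι := ι)).span_eq

/-- The Verma module `M_{q,l}` of highest weight `l`: it has the basis
`x^l_{l-2k} = f^k x_l` (`k ∈ ℕ`), represented by `Finsupp.single k 1`, with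
`h x_{l-2k} = (l-2k) x_{l-2k}`, `e x_{l-2k} = [k]_q [l-k+1]_q x_{l-2k+2}` and
`f x_{l-2k} = x_{l-2k-2}`. -/
def verma {q : ℝ} (hq : 0 < q) (l : ℂ) : UqModule q (ℕ →₀ ℂ) where
  h := Finsupp.linearCombination ℂ fun k : ℕ => (l - 2 * k) • Finsupp.single k (1 : ℂ)
  e := Finsupp.linearCombination ℂ fun k : ℕ =>
    (qNum q k * qNum q (l - k + 1)) • Finsupp.single (k - 1) (1 : ℂ)
  f := Finsupp.linearCombination ℂ fun k : ℕ => Finsupp.single (k + 1) (1 : ℂ)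
  spanned := by
    refine ⟨l.re, ?_⟩
    rw [eq_top_iff, ← span_single_one ℕ]
    refine Submodule.span_mono ?_
    rintro _ ⟨k, rfl⟩
    exact ⟨l - 2 * k, by simp, by rw [Finsupp.linearCombination_single, one_smul]⟩
  h_e := by
    refine LinearMap.ext_on (span_single_one ℕ) ?_
    rintro _ ⟨k, rfl⟩
    rcases k with _ | k <;>
    simp only [LinearMap.sub_apply, Module.End.mul_apply, LinearMap.smul_apply, map_smul,
      Finsupp.linearCombination_single, one_smul, Nat.add_sub_cancel, Nat.zero_sub]
    · simp [qNum]
    · push_cast; module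
  h_f := by
    refine LinearMap.ext_on (span_single_one ℕ) ?_
    rintro _ ⟨k, rfl⟩
    simp only [LinearMap.sub_apply, Module.End.mul_apply, LinearMap.smul_apply, map_smul,
      Finsupp.linearCombination_single, one_smul]
    push_cast; module
  e_f := by
    intro μ v hv
    rw [← Module.End.mul_apply, ← Module.End.mul_apply, ← LinearMap.sub_apply]
    refine apply_of_spanning _ _ (qNum q) _ (span_single_one ℕ) ?_ hv
    rintro _ ⟨k, rfl⟩
    refine ⟨l - 2 * k, by rw [Finsupp.linearCombination_single, one_smul], ?_⟩
    rw [← qNum_commutator hq k l]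
    rcases k with _ | k <;>
    simp only [LinearMap.sub_apply, Module.End.mul_apply, map_smul,
      Finsupp.linearCombination_single, one_smul, Nat.add_sub_cancel, Nat.zero_sub]
    · simp [qNum]
    · rw [← sub_smul]; congr 1; push_cast; ring_nf

/-- The highest weight vector `x_l` of a Verma module. -/
def vermaTop : ℕ →₀ ℂ := Finsupp.single 0 1

/-- The finite dimensional irreducible module `M'_{q,N}` of highest weight `N ∈ ℕ`: it has the
basis `x^N_{N-2k} = f^k x_N` (`k = 0, …, N`), represented by `Finsupp.single k 1`, with the same
action as the Verma module except that `f x_{-N} = 0`. -/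
def finMod {q : ℝ} (hq : 0 < q) (N : ℕ) : UqModule q (Fin (N + 1) →₀ ℂ) where
  h := Finsupp.linearCombination ℂ fun k : Fin (N + 1) =>
    ((N : ℂ) - 2 * (k : ℕ)) • Finsupp.single k (1 : ℂ)
  e := Finsupp.linearCombination ℂ fun k : Fin (N + 1) =>
    (qNum q (k : ℕ) * qNum q ((N : ℂ) - (k : ℕ) + 1)) •
      Finsupp.single (⟨(k : ℕ) - 1, lt_of_le_of_lt (Nat.sub_le _ _) k.2⟩ : Fin (N + 1)) (1 : ℂ)
  f := Finsupp.linearCombination ℂ fun k : Fin (N + 1) =>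
    if hk : (k : ℕ) + 1 < N + 1 then
      Finsupp.single (⟨(k : ℕ) + 1, hk⟩ : Fin (N + 1)) (1 : ℂ) else 0
  spanned := by
    refine ⟨N, ?_⟩
    rw [eq_top_iff, ← span_single_one (Fin (N + 1))]
    refine Submodule.span_mono ?_
    rintro _ ⟨k, rfl⟩
    exact ⟨N - 2 * (k : ℕ), by simp, by rw [Finsupp.linearCombination_single, one_smul]⟩
  h_e := by
    refine LinearMap.ext_on (span_single_one _) ?_
    rintro _ ⟨⟨k, hk⟩, rfl⟩
    rcases k with _ | k <;>
    simp only [LinearMap.sub_apply, Module.End.mul_apply, LinearMap.smul_apply, map_smul,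
      Finsupp.linearCombination_single, one_smul, Nat.add_sub_cancel, Nat.zero_sub]
    · simp [qNum]
    · push_cast; module
  h_f := by
    refine LinearMap.ext_on (span_single_one _) ?_
    rintro _ ⟨⟨k, hk⟩, rfl⟩
    by_cases h : k + 1 < N + 1 <;>
    simp only [LinearMap.sub_apply, Module.End.mul_apply, LinearMap.smul_apply, map_smul,
      Finsupp.linearCombination_single, one_smul, h, dite_true, dite_false, map_zero, smul_zero,
      sub_zero]
    push_cast; module
  e_f := by
    intro μ v hv
    rw [← Module.End.mul_apply, ← Module.End.mul_apply, ← LinearMap.sub_apply]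
    refine apply_of_spanning _ _ (qNum q) _ (span_single_one _) ?_ hv
    rintro _ ⟨⟨k, hk⟩, rfl⟩
    refine ⟨N - 2 * k, by rw [Finsupp.linearCombination_single, one_smul], ?_⟩
    rw [← qNum_commutator hq k N]
    have hlast : ¬ k + 1 < N + 1 → qNum q ((N : ℂ) - k) = 0 := by
      intro h
      have : N = k := by omega
      simp [this, qNum]
    by_cases h : k + 1 < N + 1 <;> rcases k with _ | k <;>
    simp only [LinearMap.sub_apply, Module.End.mul_apply, map_smul,
      Finsupp.linearCombination_single, one_smul, h, dite_true, dite_false, map_zero, smul_zero,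
      sub_zero, Nat.add_sub_cancel, Nat.zero_sub, hk]
    · simp [qNum]
    · rw [← sub_smul]; congr 1; push_cast; ring_nf
    · rw [hlast h]; simp [qNum]
    · rw [hlast h, zero_sub, mul_zero, zero_sub, neg_smul]

/-- The highest weight vector `x_N` of `M'_{q,N}`. -/
def finTop (N : ℕ) : Fin (N + 1) →₀ ℂ := Finsupp.single 0 1

/-! ### Intertwining maps, fusion matrix and exchange matrix -/

section Exchange

variable {q : ℝ} {U U' V W : Type*} [AddCommGroup U] [Module ℂ U] [AddCommGroup U'] [Module ℂ U']
  [AddCommGroup V] [Module ℂ V] [AddCommGroup W] [Module ℂ W]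

/-- Let `L` and `M` be modules generated by highest weight vectors `x` and `y`, and `v ∈ V`. This
says that `Φ : L → M ⊗ V` is the intertwining map attached to `v`, i.e. `Φ` is intertwining and
`Φ(x)` is of the form `∑_k f^k y ⊗ v_k` with `v_0 = v`. -/
def IsIntertwiningMap (hq : 0 < q) (L : UqModule q U) (x : U) (M : UqModule q U') (y : U')
    (N : UqModule q V) (v : V) (Φ : U →ₗ[ℂ] U' ⊗[ℂ] V) : Prop :=
  L.IsIntertwining (M.tensor hq N) Φ ∧
    ∃ u : ℕ →₀ V, u 0 = v ∧ Φ x = u.sum fun k w => (M.f ^ k) y ⊗ₜ[ℂ] w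

open Classical in
/-- The intertwining map `Φ_{q,l}^v : M_{q,l} → M_{q,μ} ⊗ V` of Verma modules, for a vector `v` of
weight `l - μ` (there is exactly one such map if `[μ - k]_q ≠ 0` for all `k ∈ ℕ`). -/
def vermaPhi (hq : 0 < q) (l μ : ℂ) (N : UqModule q V) (v : V) :
    (ℕ →₀ ℂ) →ₗ[ℂ] (ℕ →₀ ℂ) ⊗[ℂ] V :=
  if h : ∃ Φ, IsIntertwiningMap hq (verma hq l) vermaTop (verma hq μ) vermaTop N v Φ then
    h.choose else 0

/-- The defining property of the fusion matrix `J_{W,V}(l)`: for all weight vectors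
`w ∈ W` and `v ∈ V`, `(Φ_{q,l-wt(v)}^w ⊗ id) ∘ Φ_{q,l}^v = Φ_{q,l}^{J(w ⊗ v)}`. -/
def IsFusionMatrix (hq : 0 < q) (A : UqModule q W) (B : UqModule q V) (l : ℂ)
    (J : Module.End ℂ (W ⊗[ℂ] V)) : Prop :=
  ∀ (α β : ℂ) (w : W) (v : V), w ≠ 0 → v ≠ 0 → A.h w = α • w → B.h v = β • v →
    (TensorProduct.assoc ℂ (ℕ →₀ ℂ) W V).toLinearMap ∘ₗ
        (vermaPhi hq (l - β) (l - β - α) A w).rTensor V ∘ₗ vermaPhi hq l (l - β) B v =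
      vermaPhi hq l (l - β - α) (A.tensor hq B) (J (w ⊗ₜ[ℂ] v))

open Classical in
/-- The fusion matrix `J_{W,V}(l)` (for generic `l` there is exactly one operator with the
defining property). -/
def fusion (hq : 0 < q) (A : UqModule q W) (B : UqModule q V) (l : ℂ) :
    Module.End ℂ (W ⊗[ℂ] V) :=
  if h : ∃ J, IsFusionMatrix hq A B l J then h.choose else 0

/-- The exchange matrix `R_{V,W}(l) = J_{V,W}(l)⁻¹ R²¹ J²¹_{W,V}(l)`, where `R²¹ = P R P` and
`J²¹ = P J P` with the flip `P`. -/
def exchange (hq : 0 < q) (A : UqModule q V) (B : UqModule q W) (l : ℂ) :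
    Module.End ℂ (V ⊗[ℂ] W) :=
  Ring.inverse (fusion hq A B l) *
    ((TensorProduct.comm ℂ W V).toLinearMap ∘ₗ B.rMatrix A ∘ₗ
      (TensorProduct.comm ℂ V W).toLinearMap) *
    ((TensorProduct.comm ℂ W V).toLinearMap ∘ₗ fusion hq B A l ∘ₗ
      (TensorProduct.comm ℂ V W).toLinearMap)

/-- The matrix element `R_{q,γ,δ,s;m,n}(l)` of the exchange matrix of the Verma modules `M_{q,γ}`
and `M_{q,δ}`: the coefficient of `x^γ_{γ-2m} ⊗ x^δ_{δ-2s+2m} = f^m x_γ ⊗ f^{s-m} x_δ` in the image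
of `x^γ_{γ-2n} ⊗ x^δ_{δ-2s+2n} = f^n x_γ ⊗ f^{s-n} x_δ` (where `m, n ≤ s`). -/
def exchangeElement (hq : 0 < q) (γ δ : ℂ) (s m n : ℕ) (l : ℂ) : ℂ :=
  finsuppTensorFinsupp' ℂ ℕ ℕ
    (exchange hq (verma hq γ) (verma hq δ) l
      (Finsupp.single n (1 : ℂ) ⊗ₜ[ℂ] Finsupp.single (s - n) (1 : ℂ))) (m, s - m)

end Exchange

/-! ### Spins, Shapovalov form and standard bases -/

/-- A spin `j ∈ {0, 1/2, 1, 3/2, …}`, given by the natural number `2j`. -/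
@[ext] structure Spin where
  twice : ℕ

/-- The value `j` of a spin. -/
instance : Coe Spin ℝ := ⟨fun j => (j.twice : ℝ) / 2⟩

/-- `c_j = j (j + 1)`. -/
def casimir (j : Spin) : ℝ := (j : ℝ) * ((j : ℝ) + 1)

/-- The underlying space of `V^j = M'_{q,2j}`. -/
abbrev SpinSpace (j : Spin) : Type := Fin (j.twice + 1) →₀ ℂ

/-- The module `V^j = M'_{q,2j}`. -/
def spinMod {q : ℝ} (hq : 0 < q) (j : Spin) : UqModule q (SpinSpace j) := finMod hq j.twice

/-- The vector `x^{2j}_{2j-2k} = f^k x_{2j}` of `V^j`. -/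
def xVec {q : ℝ} (hq : 0 < q) (j : Spin) (k : ℕ) : SpinSpace j :=
  ((spinMod hq j).f ^ k) (finTop j.twice)

/-- The standard basis vector `e^j_m` with `m = j - k`, i.e.
`e^j_m = (([j+m+1]_q)_{j-m} [j-m]_q!)^{-1/2} x^{2j}_{2m}`. -/
def stdVec {q : ℝ} (hq : 0 < q) (j : Spin) (k : ℕ) : SpinSpace j :=
  (((Real.sqrt (qPoch q (j.twice - k + 1) k * qFact q k).re)⁻¹ : ℝ) : ℂ) • xVec hq j k

/-- The Shapovalov form on `V^j`: the symmetric bilinear form for which the standard basis is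
orthonormal, i.e. the `x^{2j}_{2j-2k}` are orthogonal with
`⟨x^{2j}_{2j-2k}, x^{2j}_{2j-2k}⟩ = ([2j-k+1]_q)_k [k]_q!`. -/
def shapovalov (q : ℝ) (j : Spin) : LinearMap.BilinForm ℂ (SpinSpace j) :=
  ∑ k : Fin (j.twice + 1), (qPoch q (j.twice - (k : ℕ) + 1) k * qFact q k) •
    LinearMap.BilinForm.linMulLin (Finsupp.lapply k) (Finsupp.lapply k)

/-- The Shapovalov form on `V^{j₁} ⊗ V^{j₂}`. -/
def shapovalov₂ (q : ℝ) (j₁ j₂ : Spin) :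
    LinearMap.BilinForm ℂ (SpinSpace j₁ ⊗[ℂ] SpinSpace j₂) :=
  (shapovalov q j₁).tmul (shapovalov q j₂)

/-- `V^j` occurs in `V^{j₁} ⊗ V^{j₂}`: `j ∈ {|j₁ - j₂|, |j₁ - j₂| + 1, …, j₁ + j₂}`. -/
def Occurs (j₁ j₂ j : Spin) : Prop :=
  |(j₁ : ℝ) - j₂| ≤ j ∧ (j : ℝ) ≤ j₁ + j₂ ∧ ∃ k : ℕ, (j₁ : ℝ) + j₂ - j = k

/-- The natural number `j₁ + j₂ - j`, if `V^j` occurs in `V^{j₁} ⊗ V^{j₂}`. -/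
def defect (j₁ j₂ j : Spin) : ℕ := (j₁.twice + j₂.twice - j.twice) / 2

section Phi

variable {q : ℝ}

open Classical in
/-- The intertwining map `Φ_{q,2j}^v : M'_{q,2j} → M'_{q,2j₁} ⊗ M'_{q,2j₂}` of finite dimensional
modules, where `v = x^{2j₂}_{2j-2j₁} = f^{j₁+j₂-j} x_{2j₂}`; there is exactly one if `V^j` occurs
in `V^{j₁} ⊗ V^{j₂}`. -/
def finPhi (hq : 0 < q) (j₁ j₂ j : Spin) :
    SpinSpace j →ₗ[ℂ] SpinSpace j₁ ⊗[ℂ] SpinSpace j₂ :=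
  if h : ∃ Φ, IsIntertwiningMap hq (spinMod hq j) (finTop j.twice) (spinMod hq j₁)
      (finTop j₁.twice) (spinMod hq j₂) (xVec hq j₂ (defect j₁ j₂ j)) Φ then
    h.choose else 0

/-- The norm `‖Φ_{q,2j}^v(x_{2j})‖`, `v = x^{2j₂}_{2j-2j₁}`, i.e. the positive square root of the
value of the Shapovalov form. -/
def phiNorm (hq : 0 < q) (j₁ j₂ j : Spin) : ℝ :=
  Real.sqrt (shapovalov₂ q j₁ j₂ (finPhi hq j₁ j₂ j (finTop j.twice))
    (finPhi hq j₁ j₂ j (finTop j.twice))).re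

/-- `ι` identifies `V^j` with the irreducible submodule of `V^{j₁} ⊗ V^{j₂}` such that the
vectors `e^j_m(j₁, j₂) = ι(e^j_m)` are orthonormal with respect to the Shapovalov form and such
that the inner product of `e^j_j(j₁, j₂)` and `e^{j₁}_{j₁} ⊗ e^{j₂}_{j-j₁}` is positive. -/
def IsStdEmbedding (hq : 0 < q) (j₁ j₂ j : Spin)
    (ι : SpinSpace j →ₗ[ℂ] SpinSpace j₁ ⊗[ℂ] SpinSpace j₂) : Prop :=
  (spinMod hq j).IsIntertwining ((spinMod hq j₁).tensor hq (spinMod hq j₂)) ι ∧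
    (∀ k l : ℕ, k ≤ j.twice → l ≤ j.twice →
      shapovalov₂ q j₁ j₂ (ι (stdVec hq j k)) (ι (stdVec hq j l)) = if k = l then 1 else 0) ∧
    0 < shapovalov₂ q j₁ j₂ (ι (stdVec hq j 0))
      (stdVec hq j₁ 0 ⊗ₜ[ℂ] stdVec hq j₂ (defect j₁ j₂ j))

open Classical in
/-- The embedding `e^j_m ↦ e^j_m(j₁, j₂)` of `V^j` into `V^{j₁} ⊗ V^{j₂}`; there is exactly one
if `V^j` occurs. -/
def stdEmbedding (hq : 0 < q) (j₁ j₂ j : Spin) :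
    SpinSpace j →ₗ[ℂ] SpinSpace j₁ ⊗[ℂ] SpinSpace j₂ :=
  if h : ∃ ι, IsStdEmbedding hq j₁ j₂ j ι then h.choose else 0

/-- The vector `e_m^{j₁₂,j}(j₁, j₂ | j₃)`, `m = j - k`, of the standard basis of `V^j` within
`V^{j₁₂} ⊗ V^{j₃}` within `(V^{j₁} ⊗ V^{j₂}) ⊗ V^{j₃}`. -/
def leftVec (hq : 0 < q) (j₁ j₂ j₃ j j₁₂ : Spin) (k : ℕ) :
    SpinSpace j₁ ⊗[ℂ] (SpinSpace j₂ ⊗[ℂ] SpinSpace j₃) :=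
  TensorProduct.assoc ℂ _ _ _ ((stdEmbedding hq j₁ j₂ j₁₂).rTensor (SpinSpace j₃)
    (stdEmbedding hq j₁₂ j₃ j (stdVec hq j k)))

/-- The vector `e_m^{j₂₃,j}(j₁ | j₂, j₃)`, `m = j - k`, of the standard basis of `V^j` within
`V^{j₁} ⊗ V^{j₂₃}` within `V^{j₁} ⊗ (V^{j₂} ⊗ V^{j₃})`. -/
def rightVec (hq : 0 < q) (j₁ j₂ j₃ j j₂₃ : Spin) (k : ℕ) :
    SpinSpace j₁ ⊗[ℂ] (SpinSpace j₂ ⊗[ℂ] SpinSpace j₃) :=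
  (stdEmbedding hq j₂ j₃ j₂₃).lTensor (SpinSpace j₁)
    (stdEmbedding hq j₁ j₂₃ j (stdVec hq j k))

open Classical in
/-- The defining property of the `q`-Racah coefficients as functions of `j₂₃`:
`e_m^{j₁₂,j}(j₁, j₂ | j₃) = ∑_{j₂₃} w(j₂₃) e_m^{j₂₃,j}(j₁ | j₂, j₃)` for all `m`, where the sum is
over all `j₂₃` such that `V^{j₂₃}` occurs in `V^{j₂} ⊗ V^{j₃}` and `V^j` occurs in
`V^{j₁} ⊗ V^{j₂₃}`. -/
def IsRacah (hq : 0 < q) (j₁ j₂ j₃ j j₁₂ : Spin) (w : Spin → ℂ) : Prop :=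
  ∀ k : ℕ, k ≤ j.twice → leftVec hq j₁ j₂ j₃ j j₁₂ k =
    ∑ t ∈ (Finset.range (j₂.twice + j₃.twice + 1)).filter
        (fun t => Occurs j₂ j₃ ⟨t⟩ ∧ Occurs j₁ ⟨t⟩ j),
      w ⟨t⟩ • rightVec hq j₁ j₂ j₃ j ⟨t⟩ k

open Classical in
/-- The `q`-Racah coefficient
`_qW^{j₂,j₃,j₂₃}_{j₁₂-j₁,j-j₁₂,j-j₁}(j)`. -/
def qRacah (hq : 0 < q) (j₁ j₂ j₃ j j₁₂ j₂₃ : Spin) : ℂ :=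
  if h : ∃ w, IsRacah hq j₁ j₂ j₃ j j₁₂ w then h.choose j₂₃ else 0

end Phi

end QuantumSl2

end

open scoped TensorProduct ComplexOrder Topology

noncomputable section

namespace QuantumSl2

/-! ### The q-numbers, their zeros, and the norms of the vectors f^k x. -/

section QNumbers

variable {q : ℝ}

/-! Put γ = 2j₂, δ = 2j₃ and let c = P∘R be the braiding. Composing two intertwining maps of Verma
modules and evaluating at the highest weight vector of M_λ gives singular vectors X_a in M_μ ⊗ (M_γ
⊗ M_δ), built from f^a x_γ and f^{s-a} x_δ, and Y_n in M_μ ⊗ (M_δ ⊗ M_γ), built from f^{s-n} x_δ and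
f^n x_γ; here μ = λ - γ - δ + 2s. For generic μ a singular vector is determined by its component
along x_μ, and for X_a and Y_n this component is a value of a fusion matrix. Hence the defining
relation J R = R²¹ J²¹ of the exchange matrix becomes ∑_a R_{a,n} X_a = (1 ⊗ c) Y_n
(`sum_exchangeElement`).

Each module carries a contravariant form, with e and f adjoint. The X_a factor through highest
weight vectors of different weights, so they are pairwise orthogonal, and R_{m,n} = ⟨(1 ⊗ c) Y_n,
X_m⟩ / ⟨X_m, X_m⟩ (`exchangeElement_mul`). Numerator and denominator are continuous at λ = 2j, where
μ = 2j₁, although 2j itself is not generic. There the Verma modules may be replaced by their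
irreducible quotients, since the projections preserve the forms. The images of X_m and Y_n are the
highest weight vectors of the embeddings through V^{j₁₂} and V^{j₁₃}, scaled by products of the
norms in the theorem; this gives the limit (`tendsto_exchangeElement`).

What remains is the pairing of two embeddings of V^j with one braiding inserted
(`form_braid_leftEmbedding`). The braiding is self-adjoint for the forms (`IsContravariant.braid`)
and satisfies a hexagon identity (`braid_tensor_left`), so this braiding can be exchanged for
braidings of V^{j₃} with V^{j₁} and of V^{j₁₂} with V^{j₃}. On standard embeddings these act by a
sign times q to half a difference of Casimir values (`braid_stdEmbedding`). After removing the
scalars one is left with the inner product of the two standard bases of V^{j₃} ⊗ V^{j₁} ⊗ V^{j₂},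
which is the q-Racah coefficient (`qRacah_eq`). -/

theorem ofReal_ne_zero_of_pos (hq : 0 < q) : (q : ℂ) ≠ 0 := by exact_mod_cast hq.ne'

theorem cpow_ne_zero_of_pos (hq : 0 < q) (z : ℂ) : (q : ℂ) ^ z ≠ 0 := by
  simp [Complex.cpow_eq_zero_iff, hq.ne']

theorem cpow_ofReal_pos (hq : 0 < q) (r : ℝ) : 0 < (q : ℂ) ^ (r : ℂ) := by
  rw [← Complex.ofReal_cpow hq.le]
  exact_mod_cast Real.rpow_pos_of_pos hq r

theorem qNum_denom_neg (hq : 0 < q) (hq1 : q < 1) :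
    (q : ℂ) ^ (1 / 2 : ℂ) - (q : ℂ) ^ (-1 / 2 : ℂ) < 0 := by
  have h1 : (q : ℂ) ^ (1 / 2 : ℂ) = ((q ^ (1 / 2 : ℝ) : ℝ) : ℂ) := by
    rw [Complex.ofReal_cpow hq.le]; norm_num
  have h2 : (q : ℂ) ^ (-1 / 2 : ℂ) = ((q ^ (-1 / 2 : ℝ) : ℝ) : ℂ) := by
    rw [Complex.ofReal_cpow hq.le]; norm_num
  rw [h1, h2, ← Complex.ofReal_sub]
  have : q ^ (1 / 2 : ℝ) < q ^ (-1 / 2 : ℝ) :=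
    Real.rpow_lt_rpow_of_exponent_gt hq hq1 (by norm_num)
  exact_mod_cast sub_neg.2 this

theorem qNum_denom_ne_zero (hq : 0 < q) (hq1 : q < 1) :
    (q : ℂ) ^ (1 / 2 : ℂ) - (q : ℂ) ^ (-1 / 2 : ℂ) ≠ 0 :=
  (qNum_denom_neg hq hq1).ne

@[simp] theorem qNum_zero (q : ℝ) : qNum q 0 = 0 := by simp [qNum]

theorem qNum_neg (q : ℝ) (a : ℂ) : qNum q (-a) = -qNum q a := by
  rw [qNum, qNum, neg_neg, ← neg_div, neg_sub]

theorem qNum_natCast_pos (hq : 0 < q) (hq1 : q < 1) {n : ℕ} (hn : 0 < n) :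
    0 < qNum q (n : ℂ) := by
  have h1 : (q : ℂ) ^ ((n : ℂ) / 2) = ((q ^ ((n : ℝ) / 2) : ℝ) : ℂ) := by
    rw [Complex.ofReal_cpow hq.le]; norm_num
  have h2 : (q : ℂ) ^ (-(n : ℂ) / 2) = ((q ^ (-(n : ℝ) / 2) : ℝ) : ℂ) := by
    rw [Complex.ofReal_cpow hq.le]; norm_num
  have : q ^ ((n : ℝ) / 2) < q ^ (-(n : ℝ) / 2) :=
    Real.rpow_lt_rpow_of_exponent_gt hq hq1 (by
      have : (0 : ℝ) < n := by exact_mod_cast hn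
      linarith)
  have h3 : (q : ℂ) ^ ((n : ℂ) / 2) - (q : ℂ) ^ (-(n : ℂ) / 2) < 0 := by
    rw [h1, h2, ← Complex.ofReal_sub]
    exact_mod_cast sub_neg.2 this
  rw [qNum]
  exact div_pos_of_neg_of_neg h3 (qNum_denom_neg hq hq1)

theorem qNum_add_one_mul (hq : 0 < q) (a b : ℂ) :
    qNum q (a + 1) * qNum q (b + 1) - qNum q a * qNum q b = qNum q (a + b + 1) := by
  have hq' := ofReal_ne_zero_of_pos hq
  unfold qNum
  set d := (q : ℂ) ^ (1 / 2 : ℂ) - (q : ℂ) ^ (-1 / 2 : ℂ) with hd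
  rcases eq_or_ne d 0 with h0 | h0
  · simp [h0]
  rw [div_mul_div_comm, div_mul_div_comm, ← sub_div, div_eq_div_iff (mul_ne_zero h0 h0) h0, hd]
  simp only [sub_mul, mul_sub, ← Complex.cpow_add _ _ hq']
  ring_nf

/-- This is the q-Pascal rule behind the expansion of Δ(e)^k. -/
theorem qNum_add (hq : 0 < q) (a b : ℂ) :
    qNum q (a + b) = qNum q a * (q : ℂ) ^ (b / 2) + qNum q b * (q : ℂ) ^ (-a / 2) := by
  have hq' := ofReal_ne_zero_of_pos hq
  simp only [qNum, div_mul_eq_mul_div, ← add_div, sub_mul, ← Complex.cpow_add _ _ hq']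
  congr 1
  ring_nf

/-- A zero of the numerator means q^{z/2} = q^{-z/2}. Such z need not be 0: q^z has imaginary
periods, so genericity near an integer takes a local argument. -/
theorem cpow_eq_one_of_qNum_eq_zero (hq : 0 < q) (hq1 : q < 1) {z : ℂ} (hz : qNum q z = 0) :
    (q : ℂ) ^ z = 1 := by
  have hq' := ofReal_ne_zero_of_pos hq
  rw [qNum, div_eq_zero_iff, or_iff_left (qNum_denom_ne_zero hq hq1), sub_eq_zero] at hz
  have : (q : ℂ) ^ z = (q : ℂ) ^ (z / 2) * (q : ℂ) ^ (z / 2) := by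
    rw [← Complex.cpow_add _ _ hq']; ring_nf
  rw [this]
  nth_rewrite 1 [hz]
  rw [← Complex.cpow_add _ _ hq']
  ring_nf
  simp

/-- Near an integer `m`, the only numbers `l` for which some `[l + k]_q` with integral `k`
vanishes is `m` itself. -/
theorem eventually_qNum_ne_zero (hq : 0 < q) (hq1 : q < 1) (m : ℤ) :
    ∀ᶠ l in 𝓝[≠] (m : ℂ), ∀ k : ℤ, qNum q (l + k) ≠ 0 := by
  have hq' := ofReal_ne_zero_of_pos hq
  -- The derivative log q of q^{z-m} at m is nonzero, so in a punctured neighbourhood of m this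
  -- function avoids the value 1 that it takes at m.
  have hd : HasDerivAt (fun z : ℂ => (q : ℂ) ^ (z - m)) (Real.log q) (m : ℂ) := by
    have := ((hasDerivAt_id (m : ℂ)).sub_const (m : ℂ)).const_cpow (c := (q : ℂ)) (Or.inl hq')
    simpa [Complex.ofReal_log hq.le] using this
  have hlog : (Real.log q : ℂ) ≠ 0 := by
    exact_mod_cast (Real.log_neg hq hq1).ne
  have h1 := hd.eventually_ne hlog (c := 1)
  have h2 : ∀ᶠ l : ℂ in 𝓝[≠] (m : ℂ), |l.re - m| < 1 := by
    refine Filter.Eventually.filter_mono nhdsWithin_le_nhds ?_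
    have : ContinuousAt (fun l : ℂ => |l.re - m|) (m : ℂ) := by fun_prop
    exact this.eventually_lt continuousAt_const (by simp)
  filter_upwards [h1, h2] with l h1 h2 k hk
  have h3 := cpow_eq_one_of_qNum_eq_zero hq hq1 hk
  have h4 : ‖(q : ℂ) ^ (l + k)‖ = q ^ (l.re + k) := by
    rw [Complex.norm_cpow_eq_rpow_re_of_pos hq]; simp
  rw [h3, norm_one] at h4
  -- Comparing absolute values in q^{l+k} = 1 confines l to the line Re l = -k. Within distance 1 of
  -- m only k = -m is left, and that case was excluded by the derivative.
  have h5 : l.re + k = 0 := by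
    by_contra hne
    rcases lt_or_gt_of_ne hne with h | h
    · exact absurd h4.symm (Real.one_lt_rpow_of_pos_of_lt_one_of_neg hq hq1 h).ne'
    · exact absurd h4.symm (Real.rpow_lt_one hq.le hq1 h).ne
  have h6 : l.re = -k := by linarith
  rw [h6, abs_lt] at h2
  have h7 : m = -k := by
    have a1 : (-1 : ℤ) < -k - m := by exact_mod_cast h2.1
    have a2 : -k - m < (1 : ℤ) := by exact_mod_cast h2.2
    omega
  apply h1
  rw [← h3, h7]
  push_cast; ring_nf

/-- The value `⟨f^k x, f^k x⟩` of the contravariant form for a highest weight vector `x` of weight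
`a` with `⟨x, x⟩ = 1`. -/
def shap (q : ℝ) (a : ℂ) (k : ℕ) : ℂ :=
  ∏ i ∈ Finset.range k, (qNum q (i + 1) * qNum q (a - i))

@[simp] theorem shap_zero (a : ℂ) : shap q a 0 = 1 := by simp [shap]

theorem shap_succ (a : ℂ) (k : ℕ) :
    shap q a (k + 1) = shap q a k * (qNum q (k + 1) * qNum q (a - k)) := by
  simp [shap, Finset.prod_range_succ]

/-- Reversing the order of the factors of the Pochhammer symbol identifies the normalisation of the
standard basis with the contravariant norm of f^k x. -/
theorem qPoch_mul_qFact (a : ℂ) (k : ℕ) : qPoch q (a - k + 1) k * qFact q k = shap q a k := by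
  rw [shap, Finset.prod_mul_distrib, mul_comm, qFact, qPoch]
  congr 1
  rw [← Finset.prod_range_reflect]
  refine Finset.prod_congr rfl fun i hi => ?_
  have : i + 1 ≤ k := Finset.mem_range.1 hi
  rw [Nat.sub_sub, Nat.cast_sub (by omega)]
  push_cast; ring_nf

theorem shap_natCast_pos (hq : 0 < q) (hq1 : q < 1) {a k : ℕ} (hk : k ≤ a) :
    0 < shap q (a : ℂ) k := by
  refine Finset.prod_pos fun i hi => ?_
  have hi : i < k := Finset.mem_range.1 hi
  have h1 := qNum_natCast_pos hq hq1 (n := i + 1) (by omega)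
  have h2 := qNum_natCast_pos hq hq1 (n := a - i) (by omega)
  rw [Nat.cast_sub (by omega)] at h2
  push_cast at h1
  exact mul_pos h1 h2

/-- The factor [a - a]_q occurs. This is why the form of a Verma module of weight a descends to the
irreducible quotient. -/
theorem shap_natCast_eq_zero {a k : ℕ} (hk : a < k) : shap q (a : ℂ) k = 0 :=
  Finset.prod_eq_zero (Finset.mem_range.2 hk) (by simp)

theorem shap_ne_zero (hq : 0 < q) (hq1 : q < 1) {a : ℂ} {k : ℕ}
    (h : ∀ i < k, qNum q (a - i) ≠ 0) : shap q a k ≠ 0 := by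
  refine Finset.prod_ne_zero_iff.2 fun i hi => mul_ne_zero ?_ (h i (Finset.mem_range.1 hi))
  have := (qNum_natCast_pos hq hq1 (n := i + 1) (by omega)).ne'
  exact_mod_cast this

theorem shap_ne_zero_of_le {a : ℂ} {k n : ℕ} (hkn : k ≤ n) (h : shap q a n ≠ 0) :
    shap q a k ≠ 0 := by
  rw [shap, Finset.prod_ne_zero_iff] at h ⊢
  exact fun i hi => h i (Finset.mem_range.2 ((Finset.mem_range.1 hi).trans_le hkn))

theorem qFact_succ (k : ℕ) : qFact q (k + 1) = qFact q k * qNum q (k + 1) := by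
  simp [qFact, Finset.prod_range_succ]

theorem qFact_ne_zero (hq : 0 < q) (hq1 : q < 1) (k : ℕ) : qFact q k ≠ 0 := by
  refine Finset.prod_ne_zero_iff.2 fun i _ => ?_
  have := (qNum_natCast_pos hq hq1 (n := i + 1) (by omega)).ne'
  exact_mod_cast this

theorem continuous_cpow_const (hq : 0 < q) : Continuous fun z : ℂ => (q : ℂ) ^ z :=
  continuous_id.const_cpow (Or.inl (ofReal_ne_zero_of_pos hq))

theorem continuous_qNum (hq : 0 < q) : Continuous (qNum q) := by
  have := continuous_cpow_const hq
  unfold qNum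
  fun_prop

theorem continuous_shap (hq : 0 < q) (k : ℕ) : Continuous fun a => shap q a k := by
  have := continuous_qNum hq
  unfold shap
  fun_prop

end QNumbers

namespace UqModule

/-! ### Commutators of powers of e and f, and intertwining maps. -/

section Commutators

variable {q : ℝ} {V W : Type*} [AddCommGroup V] [Module ℂ V] [AddCommGroup W] [Module ℂ W]

theorem f_pow_weight (M : UqModule q V) {μ : ℂ} {v : V} (hv : M.h v = μ • v) (n : ℕ) :
    M.h ((M.f ^ n) v) = (μ - 2 * n) • (M.f ^ n) v := by
  induction n with
  | zero => simpa using hv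
  | succ n ih =>
    rw [pow_succ', Module.End.mul_apply, M.f_weight ih]
    congr 1; push_cast; ring

/-- Moving e past each f produces one [μ - 2i]_q, and by `qNum_commutator` the sum of these
collapses to a product. -/
theorem e_f_pow_succ (hq : 0 < q) (M : UqModule q V) {μ : ℂ} {v : V} (hv : M.h v = μ • v)
    (k : ℕ) : M.e ((M.f ^ (k + 1)) v) =
      (M.f ^ (k + 1)) (M.e v) + (qNum q (k + 1) * qNum q (μ - k)) • (M.f ^ k) v := by
  induction k with
  | zero =>
    have h1 : qNum q 1 * qNum q μ = qNum q μ := by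
      have := qNum_commutator hq 0 μ
      simpa using this
    have := M.e_f μ v hv
    simp only [zero_add, pow_one, pow_zero, Module.End.one_apply, Nat.cast_zero, sub_zero, h1,
      ← this]
    abel
  | succ k ih =>
    have h1 := M.e_f _ _ (M.f_pow_weight hv (k + 1))
    rw [pow_succ', Module.End.mul_apply, sub_eq_iff_eq_add.1 h1, ih, map_add, map_smul,
      ← Module.End.mul_apply, ← pow_succ', ← Module.End.mul_apply M.f, ← pow_succ',
      ← qNum_commutator hq]
    push_cast
    ring_nf
    module

/-- The mirror image of `e_f_pow_succ`, needed to commute f through the powers of e in the R-matrix.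
-/
theorem e_pow_succ_f (hq : 0 < q) (M : UqModule q V) {μ : ℂ} {v : V} (hv : M.h v = μ • v)
    (k : ℕ) : (M.e ^ (k + 1)) (M.f v) =
      M.f ((M.e ^ (k + 1)) v) + (qNum q (k + 1) * qNum q (μ + k)) • (M.e ^ k) v := by
  induction k with
  | zero =>
    have h1 : qNum q 1 * qNum q μ = qNum q μ := by
      have := qNum_commutator hq 0 μ
      simpa using this
    have := M.e_f μ v hv
    simp only [zero_add, pow_one, pow_zero, Module.End.one_apply, Nat.cast_zero, add_zero, h1,
      ← this]
    abel
  | succ k ih =>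
    have h1 := M.e_f _ _ (M.e_pow_weight hv (k + 1))
    have h2 := qNum_add_one_mul hq ((k : ℂ) + 1) (μ + k)
    have h3 : qNum q (μ + 2 * ((k + 1 : ℕ) : ℂ)) = qNum q (k + 1 + (μ + k) + 1) := by
      congr 1; push_cast; ring
    have h4 : μ + ((k + 1 : ℕ) : ℂ) = μ + k + 1 := by push_cast; ring
    rw [pow_succ', Module.End.mul_apply, ih, map_add, map_smul, sub_eq_iff_eq_add.1 h1, h3, ← h2,
      h4, ← Module.End.mul_apply M.e, ← pow_succ', ← Module.End.mul_apply M.e, ← pow_succ']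
    push_cast
    module

theorem qPowH_neg_qPowH (hq : 0 < q) (M : UqModule q V) (c : ℂ) (v : V) :
    M.qPowH (-c) (M.qPowH c v) = v := by
  suffices h : M.qPowH (-c) ∘ₗ M.qPowH c = LinearMap.id from LinearMap.congr_fun h v
  refine LinearMap.ext_on M.spanned_weight ?_
  rintro v ⟨μ, hv⟩
  rw [LinearMap.comp_apply, M.qPowH_apply _ hv, map_smul, M.qPowH_apply _ hv, smul_smul,
    ← Complex.cpow_add _ _ (ofReal_ne_zero_of_pos hq)]
  ring_nf
  simp

theorem qPowH_injective (hq : 0 < q) (M : UqModule q V) (c : ℂ) :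
    Function.Injective (M.qPowH c) :=
  Function.LeftInverse.injective (M.qPowH_neg_qPowH hq c)

/-- Commuting with h already forces commuting with functions of h, because h-eigenvectors go to
h-eigenvectors. The comultiplication involves q^{±h/4}, so tensoring intertwining maps depends on
this. -/
theorem IsIntertwining.qPowH {M : UqModule q V} {N : UqModule q W} {T : V →ₗ[ℂ] W}
    (hT : M.IsIntertwining N T) (c : ℂ) (v : V) : T (M.qPowH c v) = N.qPowH c (T v) := by
  suffices h : T ∘ₗ M.qPowH c = N.qPowH c ∘ₗ T from LinearMap.congr_fun h v
  refine LinearMap.ext_on M.spanned_weight ?_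
  rintro v ⟨μ, hv⟩
  have : N.h (T v) = μ • T v := by rw [← hT.1, hv, map_smul]
  simp [M.qPowH_apply _ hv, N.qPowH_apply _ this]

theorem IsIntertwining.weight {M : UqModule q V} {N : UqModule q W} {T : V →ₗ[ℂ] W}
    (hT : M.IsIntertwining N T) {μ : ℂ} {v : V} (hv : M.h v = μ • v) :
    N.h (T v) = μ • T v := by rw [← hT.1, hv, map_smul]

theorem IsIntertwining.e_pow {M : UqModule q V} {N : UqModule q W} {T : V →ₗ[ℂ] W}
    (hT : M.IsIntertwining N T) (k : ℕ) (v : V) : T ((M.e ^ k) v) = (N.e ^ k) (T v) := by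
  induction k with
  | zero => simp
  | succ k ih => rw [pow_succ', pow_succ', Module.End.mul_apply, Module.End.mul_apply, hT.2.1, ih]

theorem IsIntertwining.f_pow {M : UqModule q V} {N : UqModule q W} {T : V →ₗ[ℂ] W}
    (hT : M.IsIntertwining N T) (k : ℕ) (v : V) : T ((M.f ^ k) v) = (N.f ^ k) (T v) := by
  induction k with
  | zero => simp
  | succ k ih => rw [pow_succ', pow_succ', Module.End.mul_apply, Module.End.mul_apply, hT.2.2, ih]

theorem IsIntertwining.comp {X : Type*} [AddCommGroup X] [Module ℂ X] {M : UqModule q V}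
    {N : UqModule q W} {L : UqModule q X} {S : W →ₗ[ℂ] X} {T : V →ₗ[ℂ] W}
    (hS : N.IsIntertwining L S) (hT : M.IsIntertwining N T) : M.IsIntertwining L (S ∘ₗ T) :=
  ⟨fun v => by simp [hS.1, hT.1], fun v => by simp [hS.2.1, hT.2.1],
    fun v => by simp [hS.2.2, hT.2.2]⟩

theorem isIntertwining_id (M : UqModule q V) : M.IsIntertwining M LinearMap.id :=
  ⟨fun _ => rfl, fun _ => rfl, fun _ => rfl⟩

end Commutators

/-! ### The action on tensor products, and tensor products of intertwining maps. -/

section TensorWeight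

variable {q : ℝ} {V W V' W' X : Type*} [AddCommGroup V] [Module ℂ V] [AddCommGroup W]
  [Module ℂ W] [AddCommGroup V'] [Module ℂ V'] [AddCommGroup W'] [Module ℂ W']
  [AddCommGroup X] [Module ℂ X]

/-- Linear maps on a tensor product agree if they agree on tensors of weight vectors. -/
theorem tensor_ext_weight (M : UqModule q V) (N : UqModule q W) {S T : V ⊗[ℂ] W →ₗ[ℂ] X}
    (h : ∀ (μ ν : ℂ) (v : V) (w : W), M.h v = μ • v → N.h w = ν • w →
      S (v ⊗ₜ w) = T (v ⊗ₜ w)) : S = T := by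
  obtain ⟨B, hB⟩ := M.spanned
  obtain ⟨C, hC⟩ := N.spanned
  refine LinearMap.ext_on (span_tmul_weight M N hB hC) ?_
  rintro _ ⟨v, w, μ, ν, -, -, hv, hw, rfl⟩
  exact h μ ν v w hv hw

theorem tensor_h_tmul (hq : 0 < q) (M : UqModule q V) (N : UqModule q W) (v : V) (w : W) :
    (M.tensor hq N).h (v ⊗ₜ w) = M.h v ⊗ₜ w + v ⊗ₜ N.h w := by
  simp [tensor]

theorem tensor_weight (hq : 0 < q) (M : UqModule q V) (N : UqModule q W) {μ ν : ℂ} {v : V}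
    {w : W} (hv : M.h v = μ • v) (hw : N.h w = ν • w) :
    (M.tensor hq N).h (v ⊗ₜ w) = (μ + ν) • v ⊗ₜ[ℂ] w := by
  rw [tensor_h_tmul, hv, hw, TensorProduct.tmul_smul, ← TensorProduct.smul_tmul', add_smul]

theorem tensor_e_tmul (hq : 0 < q) (M : UqModule q V) (N : UqModule q W) (v : V) (w : W) :
    (M.tensor hq N).e (v ⊗ₜ w) =
      M.e v ⊗ₜ N.qPowH (1 / 4) w + M.qPowH (-1 / 4) v ⊗ₜ N.e w := by
  simp [tensor]

theorem tensor_f_tmul (hq : 0 < q) (M : UqModule q V) (N : UqModule q W) (v : V) (w : W) :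
    (M.tensor hq N).f (v ⊗ₜ w) =
      M.f v ⊗ₜ N.qPowH (1 / 4) w + M.qPowH (-1 / 4) v ⊗ₜ N.f w := by
  simp [tensor]

theorem tensor_e_weight (hq : 0 < q) (M : UqModule q V) (N : UqModule q W) {μ ν : ℂ} {v : V}
    {w : W} (hv : M.h v = μ • v) (hw : N.h w = ν • w) :
    (M.tensor hq N).e (v ⊗ₜ w) = (q : ℂ) ^ (1 / 4 * ν) • (M.e v ⊗ₜ w) +
      (q : ℂ) ^ (-1 / 4 * μ) • (v ⊗ₜ N.e w) := by
  rw [tensor_e_tmul, M.qPowH_apply _ hv, N.qPowH_apply _ hw, TensorProduct.tmul_smul,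
    ← TensorProduct.smul_tmul']

theorem tensor_f_weight (hq : 0 < q) (M : UqModule q V) (N : UqModule q W) {μ ν : ℂ} {v : V}
    {w : W} (hv : M.h v = μ • v) (hw : N.h w = ν • w) :
    (M.tensor hq N).f (v ⊗ₜ w) = (q : ℂ) ^ (1 / 4 * ν) • (M.f v ⊗ₜ w) +
      (q : ℂ) ^ (-1 / 4 * μ) • (v ⊗ₜ N.f w) := by
  rw [tensor_f_tmul, M.qPowH_apply _ hv, N.qPowH_apply _ hw, TensorProduct.tmul_smul,
    ← TensorProduct.smul_tmul']

theorem IsIntertwining.map (hq : 0 < q) {M : UqModule q V} {N : UqModule q W}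
    {M' : UqModule q V'} {N' : UqModule q W'} {S : V →ₗ[ℂ] V'} {T : W →ₗ[ℂ] W'}
    (hS : M.IsIntertwining M' S) (hT : N.IsIntertwining N' T) :
    (M.tensor hq N).IsIntertwining (M'.tensor hq N') (TensorProduct.map S T) := by
  refine ⟨fun z => ?_, fun z => ?_, fun z => ?_⟩ <;>
  induction z using TensorProduct.induction_on with
  | zero => simp
  | add x y hx hy => simp only [map_add, hx, hy]
  | tmul v w => simp [tensor_h_tmul, tensor_e_tmul, tensor_f_tmul, hS.1, hT.1, hS.2.1, hT.2.1,
      hS.2.2, hT.2.2, hS.qPowH, hT.qPowH]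

theorem IsIntertwining.lTensor (hq : 0 < q) (L : UqModule q X) {N : UqModule q W}
    {N' : UqModule q W'} {T : W →ₗ[ℂ] W'} (hT : N.IsIntertwining N' T) :
    (L.tensor hq N).IsIntertwining (L.tensor hq N') (T.lTensor X) :=
  L.isIntertwining_id.map hq hT

theorem IsIntertwining.rTensor (hq : 0 < q) (L : UqModule q X) {N : UqModule q W}
    {N' : UqModule q W'} {T : W →ₗ[ℂ] W'} (hT : N.IsIntertwining N' T) :
    (N.tensor hq L).IsIntertwining (N'.tensor hq L) (T.rTensor X) :=
  hT.map hq L.isIntertwining_id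

/-- The element q^{ch} is group-like, since weights add in tensor products. -/
theorem qPowH_tensor_tmul (hq : 0 < q) (M : UqModule q V) (N : UqModule q W) (c : ℂ) (v : V)
    (w : W) : (M.tensor hq N).qPowH c (v ⊗ₜ w) = M.qPowH c v ⊗ₜ N.qPowH c w := by
  suffices h : (M.tensor hq N).qPowH c = TensorProduct.map (M.qPowH c) (N.qPowH c) by
    rw [h, TensorProduct.map_tmul]
  refine tensor_ext_weight M N fun μ ν v w hv hw => ?_
  rw [qPowH_apply _ _ (tensor_weight hq M N hv hw), TensorProduct.map_tmul, qPowH_apply _ _ hv,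
    qPowH_apply _ _ hw, TensorProduct.tmul_smul, ← TensorProduct.smul_tmul', smul_smul,
    ← Complex.cpow_add _ _ (ofReal_ne_zero_of_pos hq)]
  congr 2; ring

/-- This is coassociativity of Δ; for e and f it rests on q^{±h/4} being group-like. -/
theorem isIntertwining_assoc (hq : 0 < q) (L : UqModule q X) (M : UqModule q V)
    (N : UqModule q W) : ((L.tensor hq M).tensor hq N).IsIntertwining
      (L.tensor hq (M.tensor hq N)) (TensorProduct.assoc ℂ X V W).toLinearMap := by
  refine ⟨fun z => ?_, fun z => ?_, fun z => ?_⟩ <;>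
  induction z using TensorProduct.induction_on with
  | zero => simp
  | add x y hx hy => simp only [map_add, hx, hy]
  | tmul z w =>
    induction z using TensorProduct.induction_on with
    | zero => simp
    | add x y hx hy => simp only [TensorProduct.add_tmul, map_add, hx, hy]
    | tmul u v =>
      simp only [tensor_h_tmul, tensor_e_tmul, tensor_f_tmul, qPowH_tensor_tmul,
        TensorProduct.add_tmul, TensorProduct.tmul_add, map_add, LinearEquiv.coe_coe,
        TensorProduct.assoc_tmul, add_assoc]

end TensorWeight

end UqModule

namespace UqModule

/-! ### The braiding P∘R and its compatibility with the action. -/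

section Braid

variable {q : ℝ} {V W V' W' : Type*} [AddCommGroup V] [Module ℂ V] [AddCommGroup W]
  [Module ℂ W] [AddCommGroup V'] [Module ℂ V'] [AddCommGroup W'] [Module ℂ W']

/-- The scalar prefactor of the `k`-th term of the universal `R`-matrix. -/
def rScalar (q : ℝ) (k : ℕ) : ℂ :=
  (1 - (q : ℂ)⁻¹) ^ k * (q : ℂ) ^ (-((k : ℂ) * (k - 1)) / 4) / qFact q k

/-- The coefficient of `e^k v ⊗ f^k w` in `R (v ⊗ w)`, for vectors of weights `μ` and `ν`. -/
def rCoeff (q : ℝ) (μ ν : ℂ) (k : ℕ) : ℂ :=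
  rScalar q k * (q : ℂ) ^ ((μ * ν - k * μ + k * ν) / 4)

theorem rScalar_zero : rScalar q 0 = 1 := by simp [rScalar, qFact]

/-- The recursion in k from which neighbouring terms of the R-matrix cancel against commutators. -/
theorem rScalar_succ (hq : 0 < q) (hq1 : q < 1) (k : ℕ) :
    rScalar q (k + 1) * qNum q (k + 1) =
      rScalar q k * ((1 - (q : ℂ)⁻¹) * (q : ℂ) ^ (-(k : ℂ) / 2)) := by
  have h1 := qFact_ne_zero hq hq1 k
  have h2 := qFact_ne_zero hq hq1 (k + 1)
  rw [qFact_succ, mul_ne_zero_iff] at h2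
  have h3 : (q : ℂ) ^ (-(((k + 1 : ℕ) : ℂ) * (((k + 1 : ℕ) : ℂ) - 1)) / 4) =
      (q : ℂ) ^ (-((k : ℂ) * (k - 1)) / 4) * (q : ℂ) ^ (-(k : ℂ) / 2) := by
    rw [← Complex.cpow_add _ _ (ofReal_ne_zero_of_pos hq)]
    congr 1; push_cast; ring
  simp only [rScalar, h3, qFact_succ]
  have h4 := h2.2
  generalize 1 - (q : ℂ)⁻¹ = c
  field_simp
  ring

/-- The factor 1 - q⁻¹ contains the denominator of the q-number, so the product is a difference of
two pure powers of q. -/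
theorem one_sub_inv_mul_qNum (hq : 0 < q) (hq1 : q < 1) (a : ℂ) :
    (1 - (q : ℂ)⁻¹) * qNum q a = (q : ℂ) ^ ((a - 1) / 2) - (q : ℂ) ^ ((-a - 1) / 2) := by
  have hq' := ofReal_ne_zero_of_pos hq
  have h1 : (1 - (q : ℂ)⁻¹) = (q : ℂ) ^ (-1 / 2 : ℂ) *
      ((q : ℂ) ^ (1 / 2 : ℂ) - (q : ℂ) ^ (-1 / 2 : ℂ)) := by
    rw [mul_sub, ← Complex.cpow_add _ _ hq', ← Complex.cpow_add _ _ hq', ← Complex.cpow_neg_one]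
    norm_num
  rw [h1, qNum, mul_assoc, mul_div_cancel₀ _ (qNum_denom_ne_zero hq hq1), mul_sub,
    ← Complex.cpow_add _ _ hq', ← Complex.cpow_add _ _ hq']
  congr 2 <;> ring

/-- The Cartan factors act on e^k v and f^k w, whose weights are μ + 2k and ν - 2k. The exponents
quadratic in k coming from them cancel. -/
theorem rTerm_weight (hq : 0 < q) (M : UqModule q V) (N : UqModule q W) {μ ν : ℂ} {v : V}
    {w : W} (hv : M.h v = μ • v) (hw : N.h w = ν • w) (k : ℕ) :
    rTerm M N k (v ⊗ₜ w) = rCoeff q μ ν k • ((M.e ^ k) v ⊗ₜ (N.f ^ k) w) := by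
  have he := M.e_pow_weight hv k
  have hf := N.f_pow_weight hw k
  have he' : M.h ((q : ℂ) ^ ((k : ℂ) / 4 * (μ + 2 * k)) • (M.e ^ k) v) =
      (μ + 2 * k) • ((q : ℂ) ^ ((k : ℂ) / 4 * (μ + 2 * k)) • (M.e ^ k) v) := by
    rw [map_smul, he, smul_comm]
  rw [rTerm, LinearMap.smul_apply, LinearMap.comp_apply, TensorProduct.map_tmul,
    Module.End.mul_apply, Module.End.mul_apply, M.qPowH_apply _ he, N.qPowH_apply _ hf,
    qPowHH, TensorProduct.lift.tmul, eigenLift_apply _ _ _ he']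
  simp only [LinearMap.compl₂_apply, TensorProduct.mk_apply, map_smul, N.qPowH_apply _ hf,
    smul_smul, LinearMap.smul_apply]
  congr 1
  rw [rCoeff, rScalar]
  simp only [← Complex.cpow_add _ _ (ofReal_ne_zero_of_pos hq)]
  congr 3
  ring

/-- The `R`-matrix on a tensor of weight vectors. -/
theorem rMatrix_weight (hq : 0 < q) (M : UqModule q V) (N : UqModule q W) {μ ν : ℂ} {v : V}
    {w : W} (hv : M.h v = μ • v) (hw : N.h w = ν • w) {K : ℕ} (hK : (M.e ^ K) v = 0) :
    rMatrix M N (v ⊗ₜ w) =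
      ∑ k ∈ Finset.range K, rCoeff q μ ν k • ((M.e ^ k) v ⊗ₜ[ℂ] (N.f ^ k) w) := by
  have : rMatrix M N (v ⊗ₜ w) = ∑ᶠ k, rTerm M N k (v ⊗ₜ w) := rfl
  rw [this, finsum_eq_sum_of_support_subset (s := Finset.range K)]
  · exact Finset.sum_congr rfl fun k _ => rTerm_weight hq M N hv hw k
  · intro k hk
    by_contra h
    simp only [Finset.coe_range, Set.mem_Iio, not_lt] at h
    apply hk
    show rTerm M N k (v ⊗ₜ w) = 0
    rw [rTerm_weight hq M N hv hw, ← Nat.sub_add_cancel h, pow_add, Module.End.mul_apply, hK]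
    simp

/-- The braiding `P R : V ⊗ W → W ⊗ V`. -/
def braid (M : UqModule q V) (N : UqModule q W) : V ⊗[ℂ] W →ₗ[ℂ] W ⊗[ℂ] V :=
  (TensorProduct.comm ℂ V W).toLinearMap ∘ₗ rMatrix M N

theorem braid_weight (hq : 0 < q) (M : UqModule q V) (N : UqModule q W) {μ ν : ℂ} {v : V}
    {w : W} (hv : M.h v = μ • v) (hw : N.h w = ν • w) {K : ℕ} (hK : (M.e ^ K) v = 0) :
    braid M N (v ⊗ₜ w) =
      ∑ k ∈ Finset.range K, rCoeff q μ ν k • ((N.f ^ k) w ⊗ₜ[ℂ] (M.e ^ k) v) := by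
  simp [braid, rMatrix_weight hq M N hv hw hK]

/-- The terms of R are powers of e and f with coefficients depending on the weights only, and
intertwining maps respect all of these. -/
theorem braid_natural (hq : 0 < q) {M : UqModule q V} {N : UqModule q W}
    {M' : UqModule q V'} {N' : UqModule q W'} {S : V →ₗ[ℂ] V'} {T : W →ₗ[ℂ] W'}
    (hS : M.IsIntertwining M' S) (hT : N.IsIntertwining N' T) (z : V ⊗[ℂ] W) :
    braid M' N' (TensorProduct.map S T z) = TensorProduct.map T S (braid M N z) := by
  suffices h : braid M' N' ∘ₗ TensorProduct.map S T = TensorProduct.map T S ∘ₗ braid M N from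
    LinearMap.congr_fun h z
  refine tensor_ext_weight M N fun μ ν v w hv hw => ?_
  obtain ⟨K, hK⟩ := M.e_locally_nilpotent v
  have h1 : (M'.e ^ K) (S v) = 0 := by rw [← hS.e_pow, hK K le_rfl, map_zero]
  rw [LinearMap.comp_apply, LinearMap.comp_apply, TensorProduct.map_tmul,
    braid_weight hq _ _ (hS.weight hv) (hT.weight hw) h1, braid_weight hq _ _ hv hw (hK K le_rfl)]
  simp [hS.e_pow, hT.f_pow]

/-- This identity, `rCoeff_f_left`, `rCoeff_e_left` and `rCoeff_f_right` are the coefficient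
comparisons that make R intertwine Δ with the opposite comultiplication, on weight vectors. -/
theorem rCoeff_e_right (hq : 0 < q) (μ ν : ℂ) (k : ℕ) :
    rCoeff q μ ν k * (q : ℂ) ^ (1 / 4 * (μ + 2 * k)) =
      rCoeff q μ (ν + 2) k * (q : ℂ) ^ (-1 / 4 * μ) := by
  simp only [rCoeff, mul_assoc, ← Complex.cpow_add _ _ (ofReal_ne_zero_of_pos hq)]
  congr 2; ring

theorem rCoeff_f_left (hq : 0 < q) (μ ν : ℂ) (k : ℕ) :
    rCoeff q μ ν k * (q : ℂ) ^ (-1 / 4 * (ν - 2 * k)) =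
      rCoeff q (μ - 2) ν k * (q : ℂ) ^ (1 / 4 * ν) := by
  simp only [rCoeff, mul_assoc, ← Complex.cpow_add _ _ (ofReal_ne_zero_of_pos hq)]
  congr 2; ring

/-- Ratio of consecutive coefficients of R, with the factor [k+1]_q [a]_q of the commutator of e
with f^{k+1}, or of e^{k+1} with f, already attached. -/
theorem rCoeff_succ (hq : 0 < q) (hq1 : q < 1) (μ ν : ℂ) (k : ℕ) (a : ℂ) :
    rCoeff q μ ν (k + 1) * (qNum q (k + 1) * qNum q a) =
      rCoeff q μ ν k * ((q : ℂ) ^ ((ν - μ) / 4 - k / 2) *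
        ((q : ℂ) ^ ((a - 1) / 2) - (q : ℂ) ^ ((-a - 1) / 2))) := by
  rw [← one_sub_inv_mul_qNum hq hq1]
  have h1 : (q : ℂ) ^ ((μ * ν - ((k + 1 : ℕ) : ℂ) * μ + ((k + 1 : ℕ) : ℂ) * ν) / 4) *
      (q : ℂ) ^ (-(k : ℂ) / 2) =
      (q : ℂ) ^ ((μ * ν - k * μ + k * ν) / 4) * (q : ℂ) ^ ((ν - μ) / 4 - k / 2) := by
    simp only [← Complex.cpow_add _ _ (ofReal_ne_zero_of_pos hq)]
    congr 1; push_cast; ring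
  have h2 := rScalar_succ hq hq1 k
  simp only [rCoeff]
  linear_combination ((q : ℂ) ^ ((μ * ν - ((k + 1 : ℕ) : ℂ) * μ + ((k + 1 : ℕ) : ℂ) * ν) / 4) *
    qNum q a) * h2 + (rScalar q k * (1 - (q : ℂ)⁻¹) * qNum q a) * h1

theorem rCoeff_e_left (hq : 0 < q) (hq1 : q < 1) (μ ν : ℂ) (k : ℕ) :
    rCoeff q μ ν k * (q : ℂ) ^ (-1 / 4 * (ν - 2 * k)) +
      rCoeff q μ ν (k + 1) * (q : ℂ) ^ (1 / 4 * (μ + 2 * (k + 1))) *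
        (qNum q (k + 1) * qNum q (ν - k)) =
      rCoeff q (μ + 2) ν k * (q : ℂ) ^ (1 / 4 * ν) := by
  have h := rCoeff_succ hq hq1 μ ν k (ν - k)
  have : rCoeff q μ ν (k + 1) * (q : ℂ) ^ (1 / 4 * (μ + 2 * (k + 1))) *
        (qNum q (k + 1) * qNum q (ν - k)) = (rCoeff q μ ν (k + 1) *
        (qNum q (k + 1) * qNum q (ν - k))) * (q : ℂ) ^ (1 / 4 * (μ + 2 * (k + 1))) := by ring
  rw [this, h]
  simp only [rCoeff, mul_assoc, mul_sub, sub_mul,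
    ← Complex.cpow_add _ _ (ofReal_ne_zero_of_pos hq)]
  ring_nf

theorem rCoeff_f_right (hq : 0 < q) (hq1 : q < 1) (μ ν : ℂ) (k : ℕ) :
    rCoeff q μ ν k * (q : ℂ) ^ (1 / 4 * (μ + 2 * k)) =
      rCoeff q (μ - 2) ν (k + 1) * (q : ℂ) ^ (1 / 4 * ν) * (qNum q (k + 1) * qNum q (μ + k)) +
      rCoeff q μ (ν - 2) k * (q : ℂ) ^ (-1 / 4 * μ) := by
  have h := rCoeff_succ hq hq1 (μ - 2) ν k (μ + k)
  have : rCoeff q (μ - 2) ν (k + 1) * (q : ℂ) ^ (1 / 4 * ν) *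
      (qNum q (k + 1) * qNum q (μ + k)) = (rCoeff q (μ - 2) ν (k + 1) *
      (qNum q (k + 1) * qNum q (μ + k))) * (q : ℂ) ^ (1 / 4 * ν) := by ring
  rw [this, h]
  simp only [rCoeff, mul_assoc, mul_sub, sub_mul,
    ← Complex.cpow_add _ _ (ofReal_ne_zero_of_pos hq)]
  ring_nf

/-- Commutators lower the degree by one; since the terms at both ends vanish, the sum can be
reindexed without boundary contributions. -/
theorem sum_range_shift {X : Type*} [AddCommMonoid X] (g : ℕ → X) (K : ℕ) (h0 : g 0 = 0)
    (hK : g K = 0) : ∑ k ∈ Finset.range K, g (k + 1) = ∑ k ∈ Finset.range K, g k := by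
  have h1 := Finset.sum_range_succ g K
  have h2 := Finset.sum_range_succ' g K
  rw [h0, add_zero] at h2
  rw [hK, add_zero] at h1
  rw [← h1, ← h2]

/-- In Δ(e) applied to the braided vector, write e f^k = f^k e + commutator. The part f^k e matches
Δ(e) acting on w. The commutator of degree k+1 joins the term with e^{k+1} v and gives the part
where e acts on v. -/
theorem braid_e_weight (hq : 0 < q) (hq1 : q < 1) (M : UqModule q V) (N : UqModule q W)
    {μ ν : ℂ} {v : V} {w : W} (hv : M.h v = μ • v) (hw : N.h w = ν • w) :
    braid M N ((M.tensor hq N).e (v ⊗ₜ w)) = (N.tensor hq M).e (braid M N (v ⊗ₜ w)) := by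
  obtain ⟨K, hK⟩ := M.e_locally_nilpotent v
  have hK1 : (M.e ^ K) (M.e v) = 0 := by
    rw [← Module.End.mul_apply, ← pow_succ]; exact hK _ (by omega)
  rw [tensor_e_weight hq M N hv hw, map_add, map_smul, map_smul,
    braid_weight hq M N (M.e_weight hv) hw hK1, braid_weight hq M N hv (N.e_weight hw) (hK K le_rfl),
    braid_weight hq M N hv hw (hK K le_rfl), map_sum, Finset.smul_sum, Finset.smul_sum]
  have step : ∀ k ∈ Finset.range K, (N.tensor hq M).e
      (rCoeff q μ ν k • ((N.f ^ k) w ⊗ₜ[ℂ] (M.e ^ k) v)) =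
      (rCoeff q μ ν k * (q : ℂ) ^ (1 / 4 * (μ + 2 * k))) • (N.e ((N.f ^ k) w) ⊗ₜ[ℂ] (M.e ^ k) v) +
      (rCoeff q μ ν k * (q : ℂ) ^ (-1 / 4 * (ν - 2 * k))) •
        ((N.f ^ k) w ⊗ₜ[ℂ] (M.e ^ (k + 1)) v) := by
    intro k _
    rw [map_smul, tensor_e_weight hq N M (N.f_pow_weight hw k) (M.e_pow_weight hv k), smul_add,
      smul_smul, smul_smul, ← Module.End.mul_apply M.e, ← pow_succ']
  rw [Finset.sum_congr rfl step, Finset.sum_add_distrib]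
  -- The commutator terms. They vanish at 0 (no f to pass) and at K (where e^K v = 0), so they may
  -- be shifted by one index.
  set g : ℕ → W ⊗[ℂ] V := fun k => (rCoeff q μ ν k * (q : ℂ) ^ (1 / 4 * (μ + 2 * k))) •
    ((N.e ((N.f ^ k) w) - (N.f ^ k) (N.e w)) ⊗ₜ[ℂ] (M.e ^ k) v) with hg
  have hg0 : g 0 = 0 := by simp [hg]
  have hgK : g K = 0 := by simp [hg, hK K le_rfl]
  have e1 : ∀ k ∈ Finset.range K, (rCoeff q μ ν k * (q : ℂ) ^ (1 / 4 * (μ + 2 * k))) •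
      (N.e ((N.f ^ k) w) ⊗ₜ[ℂ] (M.e ^ k) v) =
      g k + (q : ℂ) ^ (-1 / 4 * μ) • rCoeff q μ (ν + 2) k • ((N.f ^ k) (N.e w) ⊗ₜ[ℂ] (M.e ^ k) v) := by
    intro k _
    rw [smul_smul, mul_comm ((q : ℂ) ^ (-1 / 4 * μ)), ← rCoeff_e_right hq, hg, ← smul_add,
      ← TensorProduct.add_tmul, sub_add_cancel]
  rw [Finset.sum_congr rfl e1, Finset.sum_add_distrib, ← sum_range_shift g K hg0 hgK, add_right_comm]
  conv_rhs => rw [← Finset.sum_add_distrib]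
  congr 1
  refine Finset.sum_congr rfl fun k _ => ?_
  simp only [hg]
  rw [N.e_f_pow_succ hq hw, add_sub_cancel_left, smul_smul, mul_comm ((q : ℂ) ^ (1 / 4 * ν)),
    ← rCoeff_e_left hq hq1, ← TensorProduct.smul_tmul', smul_smul, ← add_smul,
    ← Module.End.mul_apply _ M.e, ← pow_succ, add_comm]
  push_cast
  rfl

theorem braid_f_weight (hq : 0 < q) (hq1 : q < 1) (M : UqModule q V) (N : UqModule q W)
    {μ ν : ℂ} {v : V} {w : W} (hv : M.h v = μ • v) (hw : N.h w = ν • w) :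
    braid M N ((M.tensor hq N).f (v ⊗ₜ w)) = (N.tensor hq M).f (braid M N (v ⊗ₜ w)) := by
  -- A bound for v does not serve for f v, hence the maximum of the two.
  obtain ⟨K, hK⟩ : ∃ K, (M.e ^ K) v = 0 ∧ (M.e ^ K) (M.f v) = 0 := by
    obtain ⟨K₁, hK₁⟩ := M.e_locally_nilpotent v
    obtain ⟨K₂, hK₂⟩ := M.e_locally_nilpotent (M.f v)
    exact ⟨max K₁ K₂, hK₁ _ (le_max_left _ _), hK₂ _ (le_max_right _ _)⟩
  rw [tensor_f_weight hq M N hv hw, map_add, map_smul, map_smul,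
    braid_weight hq M N (M.f_weight hv) hw hK.2, braid_weight hq M N hv (N.f_weight hw) hK.1,
    braid_weight hq M N hv hw hK.1, map_sum, Finset.smul_sum, Finset.smul_sum]
  have step : ∀ k ∈ Finset.range K, (N.tensor hq M).f
      (rCoeff q μ ν k • ((N.f ^ k) w ⊗ₜ[ℂ] (M.e ^ k) v)) =
      (rCoeff q μ ν k * (q : ℂ) ^ (1 / 4 * (μ + 2 * k))) • ((N.f ^ (k + 1)) w ⊗ₜ[ℂ] (M.e ^ k) v) +
      (rCoeff q μ ν k * (q : ℂ) ^ (-1 / 4 * (ν - 2 * k))) •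
        ((N.f ^ k) w ⊗ₜ[ℂ] M.f ((M.e ^ k) v)) := by
    intro k _
    rw [map_smul, tensor_f_weight hq N M (N.f_pow_weight hw k) (M.e_pow_weight hv k), smul_add,
      smul_smul, smul_smul, ← Module.End.mul_apply N.f, ← pow_succ']
  rw [Finset.sum_congr rfl step, Finset.sum_add_distrib]
  -- As for e, but now the commutators of e^k with f on the second factor are to be shifted.
  set g : ℕ → W ⊗[ℂ] V := fun k => (rCoeff q (μ - 2) ν k * (q : ℂ) ^ (1 / 4 * ν)) •
    ((N.f ^ k) w ⊗ₜ[ℂ] ((M.e ^ k) (M.f v) - M.f ((M.e ^ k) v))) with hg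
  have hg0 : g 0 = 0 := by simp [hg]
  have hgK : g K = 0 := by simp [hg, hK]
  have e1 : ∀ k ∈ Finset.range K, (q : ℂ) ^ (1 / 4 * ν) • rCoeff q (μ - 2) ν k •
      ((N.f ^ k) w ⊗ₜ[ℂ] (M.e ^ k) (M.f v)) =
      g k + (rCoeff q μ ν k * (q : ℂ) ^ (-1 / 4 * (ν - 2 * k))) •
        ((N.f ^ k) w ⊗ₜ[ℂ] M.f ((M.e ^ k) v)) := by
    intro k _
    rw [rCoeff_f_left hq, hg, ← smul_add, ← TensorProduct.tmul_add, sub_add_cancel, smul_smul,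
      mul_comm]
  rw [Finset.sum_congr rfl e1, Finset.sum_add_distrib, ← sum_range_shift g K hg0 hgK, add_right_comm,
    ← Finset.sum_add_distrib]
  congr 1
  refine Finset.sum_congr rfl fun k _ => ?_
  simp only [hg]
  rw [M.e_pow_succ_f hq hv, add_sub_cancel_left, rCoeff_f_right hq hq1, smul_smul, add_smul,
    TensorProduct.tmul_smul, smul_smul, mul_comm ((q : ℂ) ^ (-1 / 4 * μ)),
    ← Module.End.mul_apply _ N.f, ← pow_succ]

/-- The braiding is an intertwining map. -/
theorem isIntertwining_braid (hq : 0 < q) (hq1 : q < 1) (M : UqModule q V) (N : UqModule q W) :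
    (M.tensor hq N).IsIntertwining (N.tensor hq M) (braid M N) := by
  refine ⟨fun z => ?_, fun z => ?_, fun z => ?_⟩
  · suffices h : braid M N ∘ₗ (M.tensor hq N).h = (N.tensor hq M).h ∘ₗ braid M N from
      LinearMap.congr_fun h z
    refine tensor_ext_weight M N fun μ ν v w hv hw => ?_
    obtain ⟨K, hK⟩ := M.e_locally_nilpotent v
    rw [LinearMap.comp_apply, LinearMap.comp_apply, tensor_weight hq M N hv hw, map_smul,
      braid_weight hq M N hv hw (hK K le_rfl), map_sum, Finset.smul_sum]
    refine Finset.sum_congr rfl fun k _ => ?_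
    rw [map_smul, tensor_weight hq N M (N.f_pow_weight hw k) (M.e_pow_weight hv k), smul_comm]
    congr 2; ring
  · suffices h : braid M N ∘ₗ (M.tensor hq N).e = (N.tensor hq M).e ∘ₗ braid M N from
      LinearMap.congr_fun h z
    exact tensor_ext_weight M N fun μ ν v w hv hw => braid_e_weight hq hq1 M N hv hw
  · suffices h : braid M N ∘ₗ (M.tensor hq N).f = (N.tensor hq M).f ∘ₗ braid M N from
      LinearMap.congr_fun h z
    exact tensor_ext_weight M N fun μ ν v w hv hw => braid_f_weight hq hq1 M N hv hw

end Braid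

end UqModule

namespace UqModule

/-! ### The q-binomial expansion of Δ(e)^k and the hexagon identity. -/

section Hexagon

variable {q : ℝ} {V W X : Type*} [AddCommGroup V] [Module ℂ V] [AddCommGroup W]
  [Module ℂ W] [AddCommGroup X] [Module ℂ X]

/-- The normalized terms of the `q`-binomial expansion of `Δ(e)^k (v ⊗ w)`. -/
def eBinomTerm (M : UqModule q V) (N : UqModule q W) (μ ν : ℂ) (v : V) (w : W) (i l : ℕ) :
    V ⊗[ℂ] W :=
  ((q : ℂ) ^ ((i * ν - l * μ) / 4) / (qFact q i * qFact q l)) • ((M.e ^ i) v ⊗ₜ (N.e ^ l) w)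

/-- Division by the two q-factorials is chosen so that the coefficients no longer involve the
weights; those meeting in one term of the next degree add up by `qNum_add`. -/
theorem tensor_e_eBinomTerm (hq : 0 < q) (hq1 : q < 1) (M : UqModule q V) (N : UqModule q W)
    {μ ν : ℂ} {v : V} {w : W} (hv : M.h v = μ • v) (hw : N.h w = ν • w) (i l : ℕ) :
    (M.tensor hq N).e (eBinomTerm M N μ ν v w i l) =
      (qNum q ((i + 1 : ℕ) : ℂ) * (q : ℂ) ^ ((l : ℂ) / 2)) • eBinomTerm M N μ ν v w (i + 1) l +
      (qNum q ((l + 1 : ℕ) : ℂ) * (q : ℂ) ^ (-(i : ℂ) / 2)) •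
        eBinomTerm M N μ ν v w i (l + 1) := by
  have hq' := ofReal_ne_zero_of_pos hq
  have hi := qFact_ne_zero hq hq1 i
  have hl := qFact_ne_zero hq hq1 l
  have hi1 := (qNum_natCast_pos hq hq1 (n := i + 1) (by omega)).ne'
  have hl1 := (qNum_natCast_pos hq hq1 (n := l + 1) (by omega)).ne'
  push_cast at hi1 hl1
  simp only [eBinomTerm, map_smul,
    tensor_e_weight hq M N (M.e_pow_weight hv i) (N.e_pow_weight hw l), smul_add, smul_smul,
    qFact_succ, ← Module.End.mul_apply M.e, ← Module.End.mul_apply N.e, ← pow_succ']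
  push_cast
  have h1 : (q : ℂ) ^ ((i * ν - l * μ) / 4) * (q : ℂ) ^ (1 / 4 * (ν + 2 * l)) =
      (q : ℂ) ^ ((l : ℂ) / 2) * (q : ℂ) ^ (((i + 1) * ν - l * μ) / 4) := by
    simp only [← Complex.cpow_add _ _ hq']; congr 1; ring
  have h2 : (q : ℂ) ^ ((i * ν - l * μ) / 4) * (q : ℂ) ^ (-1 / 4 * (μ + 2 * i)) =
      (q : ℂ) ^ (-(i : ℂ) / 2) * (q : ℂ) ^ ((i * ν - (l + 1) * μ) / 4) := by
    simp only [← Complex.cpow_add _ _ hq']; congr 1; ring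
  congr 2
  · rw [div_mul_eq_mul_div, h1]
    field_simp
  · rw [div_mul_eq_mul_div, h2]
    field_simp

/-- The `q`-binomial expansion of `Δ(e)^k (v ⊗ w)`. -/
theorem tensor_e_pow_weight (hq : 0 < q) (hq1 : q < 1) (M : UqModule q V) (N : UqModule q W)
    {μ ν : ℂ} {v : V} {w : W} (hv : M.h v = μ • v) (hw : N.h w = ν • w) (k : ℕ) :
    ((M.tensor hq N).e ^ k) (v ⊗ₜ w) =
      qFact q k • ∑ p ∈ Finset.HasAntidiagonal.antidiagonal k, eBinomTerm M N μ ν v w p.1 p.2 := by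
  induction k with
  | zero => simp [eBinomTerm, qFact]
  | succ k ih =>
    rw [pow_succ', Module.End.mul_apply, ih, map_smul, map_sum, qFact_succ, mul_smul]
    congr 1
    rw [Finset.sum_congr rfl fun p _ => tensor_e_eBinomTerm hq hq1 M N hv hw p.1 p.2,
      Finset.sum_add_distrib, Finset.smul_sum]
    -- Both sums, taken over the antidiagonal of k, extend to that of k + 1, since the extra term
    -- carries the factor [0]_q = 0.
    have h1 := Finset.Nat.sum_antidiagonal_succ (n := k) (f := fun p : ℕ × ℕ =>
      (qNum q (p.1 : ℂ) * (q : ℂ) ^ ((p.2 : ℂ) / 2)) • eBinomTerm M N μ ν v w p.1 p.2)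
    have h2 := Finset.Nat.sum_antidiagonal_succ' (n := k) (f := fun p : ℕ × ℕ =>
      (qNum q (p.2 : ℂ) * (q : ℂ) ^ (-(p.1 : ℂ) / 2)) • eBinomTerm M N μ ν v w p.1 p.2)
    simp only [Nat.cast_zero, qNum_zero, zero_mul, zero_smul, zero_add] at h1 h2
    rw [← h1, ← h2, ← Finset.sum_add_distrib]
    refine Finset.sum_congr rfl fun p hp => ?_
    rw [← add_smul]
    congr 1
    have h3 : ((k : ℂ) + 1) = p.1 + p.2 := by
      rw [Finset.HasAntidiagonal.mem_antidiagonal] at hp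
      exact_mod_cast hp.symm
    rw [h3, qNum_add hq]

/-- The factorisation (Δ ⊗ 1)R = R₁₃ R₂₃ on weight vectors. The weight ν - 2l appears because f^l
has already acted on the last factor when it meets the first. -/
theorem rCoeff_add (hq : 0 < q) (hq1 : q < 1) (μ₁ μ₂ ν : ℂ) (i l : ℕ) :
    rCoeff q (μ₁ + μ₂) ν (i + l) *
      (qFact q (i + l) * ((q : ℂ) ^ ((i * μ₂ - l * μ₁) / 4) / (qFact q i * qFact q l))) =
      rCoeff q μ₂ ν l * rCoeff q μ₁ (ν - 2 * l) i := by
  have hi := qFact_ne_zero hq hq1 i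
  have hl := qFact_ne_zero hq hq1 l
  have hil := qFact_ne_zero hq hq1 (i + l)
  have h : (q : ℂ) ^ (-(((i + l : ℕ) : ℂ) * ((i + l : ℕ) - 1)) / 4) *
      (q : ℂ) ^ (((μ₁ + μ₂) * ν - (i + l : ℕ) * (μ₁ + μ₂) + (i + l : ℕ) * ν) / 4) *
      (q : ℂ) ^ ((i * μ₂ - l * μ₁) / 4) =
      (q : ℂ) ^ (-((l : ℂ) * (l - 1)) / 4) * (q : ℂ) ^ ((μ₂ * ν - l * μ₂ + l * ν) / 4) *
      ((q : ℂ) ^ (-((i : ℂ) * (i - 1)) / 4) *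
        (q : ℂ) ^ ((μ₁ * (ν - 2 * l) - i * μ₁ + i * (ν - 2 * l)) / 4)) := by
    simp only [← Complex.cpow_add _ _ (ofReal_ne_zero_of_pos hq)]
    congr 1; push_cast; ring
  simp only [rCoeff, rScalar]
  generalize 1 - (q : ℂ)⁻¹ = c
  calc _ = c ^ (i + l) * ((q : ℂ) ^ (-(((i + l : ℕ) : ℂ) * ((i + l : ℕ) - 1)) / 4) *
      (q : ℂ) ^ (((μ₁ + μ₂) * ν - (i + l : ℕ) * (μ₁ + μ₂) + (i + l : ℕ) * ν) / 4) *
      (q : ℂ) ^ ((i * μ₂ - l * μ₁) / 4)) / (qFact q i * qFact q l) *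
        (qFact q (i + l) / qFact q (i + l)) := by ring
    _ = _ := by rw [h, div_self hil]; ring

/-- The hexagon identity `c_{V ⊗ W, X} = (c_{V, X} ⊗ 1) (1 ⊗ c_{W, X})`. -/
theorem braid_tensor_left (hq : 0 < q) (hq1 : q < 1) (M : UqModule q V) (N : UqModule q W)
    (L : UqModule q X) :
    braid (M.tensor hq N) L = (TensorProduct.assoc ℂ X V W).toLinearMap ∘ₗ
      (braid M L).rTensor W ∘ₗ (TensorProduct.assoc ℂ V X W).symm.toLinearMap ∘ₗ
      (braid N L).lTensor V ∘ₗ (TensorProduct.assoc ℂ V W X).toLinearMap := by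
  rw [← sub_eq_zero]
  apply TensorProduct.ext
  refine tensor_ext_weight M N fun μ₁ μ₂ v w hv hw => ?_
  refine LinearMap.ext_on L.spanned_weight ?_
  rintro x ⟨ν, hx⟩
  simp only [TensorProduct.mk_apply, LinearMap.zero_apply,
    LinearMap.sub_apply, LinearMap.comp_apply, LinearEquiv.coe_coe, TensorProduct.assoc_tmul,
    LinearMap.lTensor_tmul, LinearMap.compr₂ₛₗ_apply]
  rw [sub_eq_zero]
  obtain ⟨K₁, hK₁⟩ := M.e_locally_nilpotent v
  obtain ⟨K₂, hK₂⟩ := N.e_locally_nilpotent w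
  -- The common terms of both sides: on the left they are grouped by i + l, on the right they form
  -- an iterated sum.
  set T : ℕ → ℕ → X ⊗[ℂ] (V ⊗[ℂ] W) := fun i l =>
    (rCoeff q μ₂ ν l * rCoeff q μ₁ (ν - 2 * l) i) •
      ((L.f ^ (i + l)) x ⊗ₜ[ℂ] ((M.e ^ i) v ⊗ₜ[ℂ] (N.e ^ l) w)) with hT
  have hT0 : ∀ i l, K₁ + K₂ ≤ i + l → T i l = 0 := by
    intro i l h
    rcases le_or_gt K₁ i with h1 | h1
    · simp [hT, hK₁ i h1]
    · simp [hT, hK₂ l (by omega)]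
  have term : ∀ k, rCoeff q (μ₁ + μ₂) ν k • ((L.f ^ k) x ⊗ₜ[ℂ]
      ((M.tensor hq N).e ^ k) (v ⊗ₜ[ℂ] w)) = ∑ i ∈ Finset.range (k + 1), T i (k - i) := by
    intro k
    rw [tensor_e_pow_weight hq hq1 M N hv hw, TensorProduct.tmul_smul, TensorProduct.tmul_sum,
      smul_smul, Finset.smul_sum, Finset.Nat.sum_antidiagonal_eq_sum_range_succ
        (fun i l => (rCoeff q (μ₁ + μ₂) ν k * qFact q k) •
          (L.f ^ k) x ⊗ₜ[ℂ] eBinomTerm M N μ₁ μ₂ v w i l)]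
    refine Finset.sum_congr rfl fun i hi => ?_
    obtain ⟨l, rfl⟩ : ∃ l, k = i + l := ⟨k - i, by
      have := Finset.mem_range.1 hi; omega⟩
    rw [Nat.add_sub_cancel_left, hT, eBinomTerm, TensorProduct.tmul_smul, smul_smul, mul_assoc,
      rCoeff_add hq hq1]
  have hEK : ((M.tensor hq N).e ^ (K₁ + K₂)) (v ⊗ₜ[ℂ] w) = 0 := by
    rw [tensor_e_pow_weight hq hq1 M N hv hw, Finset.sum_eq_zero, smul_zero]
    intro p hp
    rw [Finset.HasAntidiagonal.mem_antidiagonal] at hp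
    rcases le_or_gt K₁ p.1 with h1 | h1
    · simp [eBinomTerm, hK₁ _ h1]
    · simp [eBinomTerm, hK₂ p.2 (by omega)]
  rw [braid_weight hq _ L (tensor_weight hq M N hv hw) hx hEK,
    Finset.sum_congr rfl fun k _ => term k, Finset.sum_range_diag_flip]
  -- The triangle i + l < K₁ + K₂ can be completed to a square, because all terms outside the
  -- triangle are zero.
  have ext : ∀ i ∈ Finset.range (K₁ + K₂), ∑ l ∈ Finset.range (K₁ + K₂ - i), T i l =
      ∑ l ∈ Finset.range (K₁ + K₂), T i l := by
    intro i _
    refine Finset.sum_subset (Finset.range_mono (Nat.sub_le _ _)) fun l _ hl => hT0 i l ?_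
    rw [Finset.mem_range, not_lt] at hl
    omega
  rw [Finset.sum_congr rfl ext, braid_weight hq N L hw hx (hK₂ (K₁ + K₂) (by omega)),
    TensorProduct.tmul_sum, map_sum, map_sum, map_sum, Finset.sum_comm]
  refine Finset.sum_congr rfl fun l _ => ?_
  rw [TensorProduct.tmul_smul, map_smul, map_smul, map_smul, TensorProduct.assoc_symm_tmul,
    LinearMap.rTensor_tmul, braid_weight hq M L hv (L.f_pow_weight hx l) (hK₁ (K₁ + K₂) (by omega)),
    TensorProduct.sum_tmul, map_sum, Finset.smul_sum]
  refine Finset.sum_congr rfl fun i _ => ?_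
  rw [← TensorProduct.smul_tmul', map_smul, smul_smul, TensorProduct.assoc_tmul, hT,
    ← Module.End.mul_apply, ← pow_add]

end Hexagon

end UqModule

namespace UqModule

/-! ### Contravariant forms and contraction of the first tensor factor. -/

section Forms

variable {q : ℝ} {V W X : Type*} [AddCommGroup V] [Module ℂ V] [AddCommGroup W]
  [Module ℂ W] [AddCommGroup X] [Module ℂ X]

/-- Symmetric bilinear forms for which `h` is self-adjoint and `e`, `f` are adjoint. -/
structure IsContravariant (M : UqModule q V) (B : LinearMap.BilinForm ℂ V) : Prop where
  symm : ∀ x y, B x y = B y x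
  h : ∀ x y, B (M.h x) y = B x (M.h y)
  e : ∀ x y, B (M.e x) y = B x (M.f y)

variable {M : UqModule q V} {N : UqModule q W} {B : LinearMap.BilinForm ℂ V}
  {C : LinearMap.BilinForm ℂ W}

theorem IsContravariant.f (hB : M.IsContravariant B) (x y : V) : B (M.f x) y = B x (M.e y) := by
  rw [hB.symm, ← hB.e, hB.symm]

theorem IsContravariant.e_pow (hB : M.IsContravariant B) (k : ℕ) (x y : V) :
    B ((M.e ^ k) x) y = B x ((M.f ^ k) y) := by
  induction k generalizing x with
  | zero => simp
  | succ k ih => rw [pow_succ, pow_succ', Module.End.mul_apply, Module.End.mul_apply, ih, hB.e]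

theorem IsContravariant.f_pow (hB : M.IsContravariant B) (k : ℕ) (x y : V) :
    B ((M.f ^ k) x) y = B x ((M.e ^ k) y) := by
  rw [hB.symm, ← hB.e_pow, hB.symm]

theorem IsContravariant.eq_zero_of_ne (hB : M.IsContravariant B) {μ ν : ℂ} {x y : V}
    (hx : M.h x = μ • x) (hy : M.h y = ν • y) (h : μ ≠ ν) : B x y = 0 := by
  have := hB.h x y
  rw [hx, hy, map_smul, map_smul, LinearMap.smul_apply, smul_eq_mul, smul_eq_mul,
    ← sub_eq_zero, ← sub_mul] at this
  exact (mul_eq_zero.1 this).resolve_left (sub_ne_zero.2 h)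

theorem IsContravariant.qPowH (hB : M.IsContravariant B) (c : ℂ) (x y : V) :
    B (M.qPowH c x) y = B x (M.qPowH c y) := by
  suffices h : B ∘ₗ M.qPowH c = B.compl₂ (M.qPowH c) by
    simpa using LinearMap.congr_fun (LinearMap.congr_fun h x) y
  refine LinearMap.ext_on M.spanned_weight ?_
  rintro x ⟨μ, hx⟩
  refine LinearMap.ext_on M.spanned_weight ?_
  rintro y ⟨ν, hy⟩
  simp only [LinearMap.comp_apply, LinearMap.compl₂_apply, M.qPowH_apply _ hx,
    M.qPowH_apply _ hy, map_smul, LinearMap.smul_apply, smul_eq_mul]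
  rcases eq_or_ne μ ν with rfl | h
  · rfl
  · simp [hB.eq_zero_of_ne hx hy h]

theorem tmul_form_apply (B : LinearMap.BilinForm ℂ V) (C : LinearMap.BilinForm ℂ W) (v v' : V)
    (w w' : W) : B.tmul C (v ⊗ₜ w) (v' ⊗ₜ w') = B v v' * C w w' := by
  rw [LinearMap.BilinForm.tensorDistrib_tmul, smul_eq_mul, mul_comm]

/-- Δ(e) and Δ(f) differ only by interchanging e and f, and q^{±h/4} is self-adjoint; so taking
adjoints factor by factor turns one into the other. -/
theorem IsContravariant.tmul (hq : 0 < q) (hB : M.IsContravariant B) (hC : N.IsContravariant C) :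
    (M.tensor hq N).IsContravariant (B.tmul C) where
  symm z z' := by
    induction z using TensorProduct.induction_on with
    | zero => simp
    | add x y hx hy => simp only [map_add, LinearMap.add_apply, hx, hy]
    | tmul v w =>
      induction z' using TensorProduct.induction_on with
      | zero => simp
      | add x y hx hy => simp only [map_add, LinearMap.add_apply, hx, hy]
      | tmul v' w' => rw [tmul_form_apply, tmul_form_apply, hB.symm, hC.symm]
  h z z' := by
    induction z using TensorProduct.induction_on with
    | zero => simp
    | add x y hx hy => simp only [map_add, LinearMap.add_apply, hx, hy]
    | tmul v w =>
      induction z' using TensorProduct.induction_on with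
      | zero => simp
      | add x y hx hy => simp only [map_add, hx, hy]
      | tmul v' w' =>
        simp only [tensor_h_tmul, map_add, LinearMap.add_apply, tmul_form_apply, hB.h, hC.h]
  e z z' := by
    induction z using TensorProduct.induction_on with
    | zero => simp
    | add x y hx hy => simp only [map_add, LinearMap.add_apply, hx, hy]
    | tmul v w =>
      induction z' using TensorProduct.induction_on with
      | zero => simp
      | add x y hx hy => simp only [map_add, hx, hy]
      | tmul v' w' =>
        simp only [tensor_e_tmul, tensor_f_tmul, map_add, LinearMap.add_apply, tmul_form_apply,
          hB.e, hC.e, hB.qPowH, hC.qPowH]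

/-- The pairing of the submodules generated by two highest weight vectors. -/
theorem IsContravariant.f_pow_f_pow (hq : 0 < q) (hB : M.IsContravariant B) {b : ℂ} {x y : V}
    (hx : M.e x = 0) (hy : M.e y = 0) (hyb : M.h y = b • y) (k l : ℕ) :
    B ((M.f ^ k) x) ((M.f ^ l) y) = if k = l then shap q b k * B x y else 0 := by
  induction k generalizing l with
  | zero =>
    rcases l with _ | l
    · simp
    · rw [if_neg (by omega), pow_succ', Module.End.mul_apply, ← hB.e, pow_zero,
        Module.End.one_apply, hx, map_zero, LinearMap.zero_apply]
  | succ k ih =>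
    rcases l with _ | l
    · rw [if_neg (by omega), pow_succ', Module.End.mul_apply, hB.f, pow_zero,
        Module.End.one_apply, hy, map_zero]
    · rw [pow_succ' M.f k, Module.End.mul_apply, hB.f, M.e_f_pow_succ hq hyb, hy, map_zero, zero_add,
        map_smul, ih, smul_eq_mul]
      rcases eq_or_ne k l with rfl | h
      · rw [if_pos rfl, if_pos rfl, shap_succ]; ring
      · rw [if_neg h, if_neg (by omega), mul_zero]

/-- The transpose of e^k ⊗ f^k is f^k ⊗ e^k, so P∘R goes over into the P∘R of the interchanged
factors once the coefficients are seen to agree. -/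
theorem IsContravariant.braid (hq : 0 < q) (hB : M.IsContravariant B) (hC : N.IsContravariant C)
    (z : V ⊗[ℂ] W) (z' : W ⊗[ℂ] V) :
    C.tmul B (braid M N z) z' = B.tmul C z (braid N M z') := by
  suffices h : (C.tmul B) ∘ₗ UqModule.braid M N = (B.tmul C).compl₂ (UqModule.braid N M) by
    simpa using LinearMap.congr_fun (LinearMap.congr_fun h z) z'
  refine tensor_ext_weight M N fun μ ν v w hv hw => ?_
  refine tensor_ext_weight N M fun ν' μ' w' v' hw' hv' => ?_
  obtain ⟨K₁, hK₁⟩ := M.e_locally_nilpotent v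
  obtain ⟨K₂, hK₂⟩ := N.e_locally_nilpotent w'
  rw [LinearMap.comp_apply, LinearMap.compl₂_apply,
    braid_weight hq M N hv hw (hK₁ (max K₁ K₂) (le_max_left _ _)),
    braid_weight hq N M hw' hv' (hK₂ (max K₁ K₂) (le_max_right _ _)), map_sum, map_sum,
    LinearMap.sum_apply]
  refine Finset.sum_congr rfl fun k _ => ?_
  rw [map_smul, map_smul, LinearMap.smul_apply, tmul_form_apply, tmul_form_apply, hC.f_pow,
    hB.e_pow, smul_eq_mul, smul_eq_mul, mul_comm (C w _)]
  -- Both sides vanish unless the weights are matched by the shift 2k. For matched weights the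
  -- exponents in the two coefficients are equal.
  by_cases h1 : μ = μ' - 2 * k
  · by_cases h2 : ν = ν' + 2 * k
    · congr 1
      rw [rCoeff, rCoeff, h1, h2]
      congr 2; ring
    · rw [hC.eq_zero_of_ne hw (N.e_pow_weight hw' k) h2, mul_zero, mul_zero, mul_zero]
  · rw [hB.eq_zero_of_ne hv (M.f_pow_weight hv' k) h1, zero_mul, mul_zero, mul_zero]

/-- Contraction of the first tensor factor with a linear form. -/
def slice (W : Type*) [AddCommGroup W] [Module ℂ W] (φ : V →ₗ[ℂ] ℂ) : V ⊗[ℂ] W →ₗ[ℂ] W :=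
  (TensorProduct.lid ℂ W).toLinearMap ∘ₗ φ.rTensor W

@[simp] theorem slice_tmul (φ : V →ₗ[ℂ] ℂ) (v : V) (w : W) : slice W φ (v ⊗ₜ w) = φ v • w := by
  simp [slice]

theorem slice_lTensor (φ : V →ₗ[ℂ] ℂ) (T : W →ₗ[ℂ] X) (z : V ⊗[ℂ] W) :
    slice X φ (T.lTensor V z) = T (slice W φ z) := by
  induction z using TensorProduct.induction_on with
  | zero => simp
  | add x y hx hy => simp only [map_add, hx, hy]
  | tmul v w => simp

theorem slice_assoc (φ : V →ₗ[ℂ] ℂ) (z : (V ⊗[ℂ] W) ⊗[ℂ] X) :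
    slice (W ⊗[ℂ] X) φ (TensorProduct.assoc ℂ V W X z) = (slice W φ).rTensor X z := by
  induction z using TensorProduct.induction_on with
  | zero => simp
  | add x y hx hy => simp only [map_add, hx, hy]
  | tmul z w =>
    induction z using TensorProduct.induction_on with
    | zero => simp
    | add x y hx hy => simp only [TensorProduct.add_tmul, map_add, hx, hy]
    | tmul u v => simp [TensorProduct.smul_tmul']

theorem slice_h (hq : 0 < q) (hB : M.IsContravariant B) {a : ℂ} {x : V} (hx : M.h x = a • x)
    (z : V ⊗[ℂ] W) :
    slice W (B x) ((M.tensor hq N).h z) = N.h (slice W (B x) z) + a • slice W (B x) z := by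
  induction z using TensorProduct.induction_on with
  | zero => simp
  | add x y hx hy => simp only [map_add, hx, hy, smul_add]; abel
  | tmul v w =>
    rw [tensor_h_tmul, map_add, slice_tmul, slice_tmul, slice_tmul, ← hB.h, hx, map_smul, map_smul,
      LinearMap.smul_apply, smul_assoc, add_comm]

theorem slice_weight (hq : 0 < q) (hB : M.IsContravariant B) {a b : ℂ} {x : V}
    (hx : M.h x = a • x) {z : V ⊗[ℂ] W} (hz : (M.tensor hq N).h z = b • z) :
    N.h (slice W (B x) z) = (b - a) • slice W (B x) z := by
  have := slice_h (N := N) hq hB hx z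
  rw [hz, map_smul] at this
  rw [sub_smul, this, add_sub_cancel_right]

/-- On the first factor, e moves to the vector x as f. For singular z this expresses the contraction
with f x through the contraction with x, so all contractions along the submodule generated by x
follow from the first. -/
theorem slice_e (hq : 0 < q) (hB : M.IsContravariant B) {a : ℂ} {x : V} (hx : M.h x = a • x)
    (z : V ⊗[ℂ] W) :
    slice W (B x) ((M.tensor hq N).e z) = N.qPowH (1 / 4) (slice W (B (M.f x)) z) +
      (q : ℂ) ^ (-1 / 4 * a) • N.e (slice W (B x) z) := by
  induction z using TensorProduct.induction_on with
  | zero => simp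
  | add x y hx hy => simp only [map_add, hx, hy, smul_add]; abel
  | tmul v w =>
    rw [tensor_e_tmul, map_add, slice_tmul, slice_tmul, slice_tmul, slice_tmul, ← hB.f,
      ← hB.qPowH, M.qPowH_apply _ hx, map_smul, map_smul, map_smul, LinearMap.smul_apply,
      smul_assoc]

/-- The summand of Δ(f) that acts by f on the first factor is invisible to x, because its adjoint
kills x. -/
theorem slice_f (hq : 0 < q) (hB : M.IsContravariant B) {a : ℂ} {x : V} (hx : M.h x = a • x)
    (hex : M.e x = 0) (z : V ⊗[ℂ] W) :
    slice W (B x) ((M.tensor hq N).f z) = (q : ℂ) ^ (-1 / 4 * a) • N.f (slice W (B x) z) := by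
  induction z using TensorProduct.induction_on with
  | zero => simp
  | add x y hx hy => simp only [map_add, hx, hy, smul_add]
  | tmul v w =>
    rw [tensor_f_tmul, map_add, slice_tmul, slice_tmul, slice_tmul, ← hB.e,
      ← hB.qPowH, M.qPowH_apply _ hx, map_smul, map_smul, LinearMap.smul_apply,
      smul_assoc, hex, map_zero, LinearMap.zero_apply, zero_smul, zero_add]

theorem slice_f_pow (hq : 0 < q) (hB : M.IsContravariant B) {a : ℂ} {x : V} (hx : M.h x = a • x)
    (hex : M.e x = 0) (k : ℕ) (z : V ⊗[ℂ] W) :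
    slice W (B x) (((M.tensor hq N).f ^ k) z) =
      (q : ℂ) ^ (-(k * a) / 4) • (N.f ^ k) (slice W (B x) z) := by
  induction k with
  | zero => simp
  | succ k ih =>
    rw [pow_succ', Module.End.mul_apply, slice_f hq hB hx hex, ih, map_smul, smul_smul,
      ← Complex.cpow_add _ _ (ofReal_ne_zero_of_pos hq), pow_succ', Module.End.mul_apply]
    congr 2; push_cast; ring

/-- A vector killed by `e` in `V ⊗ W` whose contraction with `x` vanishes is orthogonal to the
submodule generated by `x`. -/
theorem slice_f_pow_eq_zero (hq : 0 < q) (hB : M.IsContravariant B) {a : ℂ} {x : V}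
    (hx : M.h x = a • x) {z : V ⊗[ℂ] W} (hz : (M.tensor hq N).e z = 0)
    (h0 : slice W (B x) z = 0) (k : ℕ) : slice W (B ((M.f ^ k) x)) z = 0 := by
  induction k with
  | zero => simpa using h0
  | succ k ih =>
    have := slice_e (N := N) hq hB (M.f_pow_weight hx k) z
    rw [hz, map_zero, ih, map_zero, smul_zero, add_zero] at this
    rw [pow_succ', Module.End.mul_apply]
    -- `slice_e` has shown the contraction only after applying q^{h/4}, which is invertible.
    exact N.qPowH_injective hq _ (by rw [← this, map_zero])

end Forms

/-! ### Explicit singular vectors ∑ c_k f^k x ⊗ e^k v. -/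

section PhiTop

variable {q : ℝ} {V W V' W' : Type*} [AddCommGroup V] [Module ℂ V] [AddCommGroup W]
  [Module ℂ W] [AddCommGroup V'] [Module ℂ V'] [AddCommGroup W'] [Module ℂ W']

/-- The coefficients of the singular vector `∑_k c_k f^k x ⊗ e^k v`. -/
def phiCoeff (q : ℝ) (a ν : ℂ) (k : ℕ) : ℂ :=
  (-1) ^ k * (q : ℂ) ^ (-(k * (a + ν + 2)) / 4) / shap q a k

@[simp] theorem phiCoeff_zero (a ν : ℂ) : phiCoeff q a ν 0 = 1 := by simp [phiCoeff]

/-- The vector `∑_{k ≤ n} c_k f^k x ⊗ e^k v` attached to a highest weight vector `x` of weight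
`a` and a vector `v` of weight `ν` with `e^{n+1} v = 0`. -/
def phiTop (M : UqModule q V) (x : V) (a : ℂ) (N : UqModule q W) (v : W) (ν : ℂ) (n : ℕ) :
    V ⊗[ℂ] W :=
  ∑ k ∈ Finset.range (n + 1), phiCoeff q a ν k • ((M.f ^ k) x ⊗ₜ (N.e ^ k) v)

variable {M : UqModule q V} {N : UqModule q W} {a ν : ℂ} {x : V} {v : W}

theorem phiTop_weight (hq : 0 < q) (hx : M.h x = a • x) (hv : N.h v = ν • v) (n : ℕ) :
    (M.tensor hq N).h (phiTop M x a N v ν n) = (a + ν) • phiTop M x a N v ν n := by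
  rw [phiTop, map_sum, Finset.smul_sum]
  refine Finset.sum_congr rfl fun k _ => ?_
  rw [map_smul, tensor_weight hq M N (M.f_pow_weight hx k) (N.e_pow_weight hv k), smul_comm]
  congr 1; ring_nf

/-- Δ(e) sends the k-th summand to multiples of f^{k-1} x ⊗ e^k v and f^k x ⊗ e^{k+1} v, and
neighbouring summands cancel. The new factor of `shap` in the denominator absorbs the commutator of
e with f^{k+1}; the last summand ends the chain because e^{n+1} v = 0. -/
theorem phiTop_e (hq : 0 < q) (hx : M.h x = a • x) (hex : M.e x = 0) (hv : N.h v = ν • v)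
    {n : ℕ} (hn : (N.e ^ (n + 1)) v = 0) (ha : shap q a n ≠ 0) :
    (M.tensor hq N).e (phiTop M x a N v ν n) = 0 := by
  rw [phiTop, map_sum]
  have step : ∀ k ∈ Finset.range (n + 1), (M.tensor hq N).e
      (phiCoeff q a ν k • ((M.f ^ k) x ⊗ₜ[ℂ] (N.e ^ k) v)) =
      (phiCoeff q a ν k * (q : ℂ) ^ (1 / 4 * (ν + 2 * k))) •
        (M.e ((M.f ^ k) x) ⊗ₜ[ℂ] (N.e ^ k) v) +
      (phiCoeff q a ν k * (q : ℂ) ^ (-1 / 4 * (a - 2 * k))) •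
        ((M.f ^ k) x ⊗ₜ[ℂ] (N.e ^ (k + 1)) v) := by
    intro k _
    rw [map_smul, tensor_e_weight hq M N (M.f_pow_weight hx k) (N.e_pow_weight hv k), smul_add,
      smul_smul, smul_smul, ← Module.End.mul_apply N.e, ← pow_succ']
  rw [Finset.sum_congr rfl step, Finset.sum_add_distrib, Finset.sum_range_succ', Finset.sum_range_succ,
    hn, pow_zero, Module.End.one_apply, hex, TensorProduct.zero_tmul, TensorProduct.tmul_zero,
    smul_zero, smul_zero, add_zero, add_zero, ← Finset.sum_add_distrib]
  refine Finset.sum_eq_zero fun k hk => ?_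
  have hk : k + 1 ≤ n := Finset.mem_range.1 hk
  rw [M.e_f_pow_succ hq hx, hex, map_zero, zero_add, ← TensorProduct.smul_tmul', smul_smul,
    ← add_smul]
  convert zero_smul ℂ _
  have h1 := shap_ne_zero_of_le hk ha
  rw [shap_succ] at h1
  have h2 := left_ne_zero_of_mul h1
  have h3 := right_ne_zero_of_mul h1
  -- This balance of the q^{±h/4} factors of consecutive terms dictates the exponent a + ν + 2 in
  -- `phiCoeff`.
  have h4 : (q : ℂ) ^ (-(((k + 1 : ℕ) : ℂ) * (a + ν + 2)) / 4) *
      (q : ℂ) ^ (1 / 4 * (ν + 2 * ((k + 1 : ℕ) : ℂ))) =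
      (q : ℂ) ^ (-((k : ℂ) * (a + ν + 2)) / 4) * (q : ℂ) ^ (-1 / 4 * (a - 2 * k)) := by
    rw [← Complex.cpow_add _ _ (ofReal_ne_zero_of_pos hq),
      ← Complex.cpow_add _ _ (ofReal_ne_zero_of_pos hq)]
    congr 1; push_cast; ring
  calc _ = (-1) ^ (k + 1) * ((q : ℂ) ^ (-(((k + 1 : ℕ) : ℂ) * (a + ν + 2)) / 4) *
      (q : ℂ) ^ (1 / 4 * (ν + 2 * ((k + 1 : ℕ) : ℂ)))) / shap q a k *
        ((qNum q (k + 1) * qNum q (a - k)) / (qNum q (k + 1) * qNum q (a - k))) +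
      phiCoeff q a ν k * (q : ℂ) ^ (-1 / 4 * (a - 2 * k)) := by
        rw [phiCoeff, shap_succ, mul_div_mul_comm]; ring
    _ = 0 := by
      rw [div_self h3, h4, phiCoeff]; ring

theorem phiTop_natural {M' : UqModule q V'} {N' : UqModule q W'} {S : V →ₗ[ℂ] V'}
    {T : W →ₗ[ℂ] W'} (hS : M.IsIntertwining M' S) (hT : N.IsIntertwining N' T) (n : ℕ) :
    TensorProduct.map S T (phiTop M x a N v ν n) = phiTop M' (S x) a N' (T v) ν n := by
  simp [phiTop, hS.f_pow, hT.e_pow]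

theorem slice_phiTop (φ : V →ₗ[ℂ] ℂ) (n : ℕ) : slice W φ (phiTop M x a N v ν n) =
    ∑ k ∈ Finset.range (n + 1), (phiCoeff q a ν k * φ ((M.f ^ k) x)) • (N.e ^ k) v := by
  simp [phiTop, smul_smul]

/-- A highest weight vector x is orthogonal to f^{k+1} x, so only the leading term is seen. -/
theorem slice_phiTop_self {B : LinearMap.BilinForm ℂ V} (hB : M.IsContravariant B)
    (hex : M.e x = 0) (hxx : B x x = 1) (n : ℕ) :
    slice W (B x) (phiTop M x a N v ν n) = v := by
  rw [slice_phiTop, Finset.sum_range_succ', Finset.sum_eq_zero]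
  · simp [hxx]
  · intro k _
    rw [pow_succ', Module.End.mul_apply, ← hB.e, hex]
    simp

end PhiTop

end UqModule

open UqModule

/-! ### Verma modules: contravariant form, singular vectors, universal property. -/

section VermaFacts

variable {q : ℝ} (hq : 0 < q) (l : ℂ)

theorem verma_h_single (k : ℕ) : (verma hq l).h (Finsupp.single k (1 : ℂ)) =
    (l - 2 * k) • Finsupp.single k (1 : ℂ) := by
  simp [verma]

theorem verma_e_single (k : ℕ) : (verma hq l).e (Finsupp.single k (1 : ℂ)) =
    (qNum q k * qNum q (l - k + 1)) • Finsupp.single (k - 1) (1 : ℂ) := by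
  simp [verma]

theorem verma_f_single (k : ℕ) (c : ℂ) : (verma hq l).f (Finsupp.single k c) =
    Finsupp.single (k + 1) c := by
  simp [verma]

theorem verma_f_pow_single (k n : ℕ) (c : ℂ) : ((verma hq l).f ^ k) (Finsupp.single n c) =
    Finsupp.single (n + k) c := by
  induction k with
  | zero => simp
  | succ k ih => rw [pow_succ', Module.End.mul_apply, ih, verma_f_single, add_assoc]

theorem verma_f_pow_top (k : ℕ) : ((verma hq l).f ^ k) vermaTop = Finsupp.single k 1 := by
  rw [vermaTop, verma_f_pow_single, zero_add]

theorem verma_h_top : (verma hq l).h vermaTop = l • vermaTop := by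
  rw [vermaTop, verma_h_single]; simp

theorem verma_e_top : (verma hq l).e vermaTop = 0 := by
  rw [vermaTop, verma_e_single]; simp

theorem verma_e_pow_single (n : ℕ) (c : ℂ) :
    ((verma hq l).e ^ (n + 1)) (Finsupp.single n c) = 0 := by
  induction n generalizing c with
  | zero => rw [zero_add, pow_one, ← mul_one c, ← smul_eq_mul, ← Finsupp.smul_single, map_smul,
      verma_e_single]; simp
  | succ n ih =>
    have : (verma hq l).e (Finsupp.single (n + 1) c) =
        Finsupp.single n (c * (qNum q (n + 1 : ℕ) * qNum q (l - (n + 1 : ℕ) + 1))) := by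
      have h1 := verma_e_single hq l (n + 1)
      rw [Nat.add_sub_cancel, Finsupp.smul_single, smul_eq_mul, mul_one] at h1
      rw [← smul_eq_mul c, ← Finsupp.smul_single, ← h1, ← map_smul, Finsupp.smul_single,
        smul_eq_mul, mul_one]
    rw [pow_succ, Module.End.mul_apply, this, ih]

/-- The contravariant form of a Verma module. -/
def vermaForm (q : ℝ) (l : ℂ) : LinearMap.BilinForm ℂ (ℕ →₀ ℂ) :=
  Finsupp.linearCombination ℂ fun k : ℕ => shap q l k • Finsupp.lapply (R := ℂ) (M := ℂ) k

variable {l}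

theorem vermaForm_single (k : ℕ) (y : ℕ →₀ ℂ) :
    vermaForm q l (Finsupp.single k 1) y = shap q l k * y k := by
  simp [vermaForm]

theorem vermaForm_top_top : vermaForm q l vermaTop vermaTop = 1 := by
  rw [vermaTop, vermaForm_single]; simp

theorem vermaForm_single_single (k n : ℕ) :
    vermaForm q l (Finsupp.single k 1) (Finsupp.single n 1) = if k = n then shap q l k else 0 := by
  rw [vermaForm_single, Finsupp.single_apply]
  rcases eq_or_ne k n with rfl | h
  · simp
  · rw [if_neg h, if_neg h.symm, mul_zero]

theorem verma_bilin_ext {B C : LinearMap.BilinForm ℂ (ℕ →₀ ℂ)}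
    (h : ∀ k n, B (Finsupp.single k 1) (Finsupp.single n 1) =
      C (Finsupp.single k 1) (Finsupp.single n 1)) (x y : ℕ →₀ ℂ) : B x y = C x y := by
  suffices B = C by rw [this]
  refine LinearMap.ext_on (span_single_one ℕ) ?_
  rintro _ ⟨k, rfl⟩
  refine LinearMap.ext_on (span_single_one ℕ) ?_
  rintro _ ⟨n, rfl⟩
  exact h k n

theorem isContravariant_vermaForm : (verma hq l).IsContravariant (vermaForm q l) where
  symm x y := by
    refine verma_bilin_ext (C := (vermaForm q l).flip) (fun k n => ?_) x y
    rw [LinearMap.BilinForm.flip_apply, vermaForm_single_single, vermaForm_single_single]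
    rcases eq_or_ne k n with rfl | h
    · rfl
    · rw [if_neg h, if_neg h.symm]
  h x y := by
    refine verma_bilin_ext (B := vermaForm q l ∘ₗ (verma hq l).h)
      (C := (vermaForm q l).compl₂ (verma hq l).h) (fun k n => ?_) x y
    rw [LinearMap.comp_apply, LinearMap.compl₂_apply, verma_h_single, verma_h_single, map_smul,
      map_smul, LinearMap.smul_apply, vermaForm_single_single]
    rcases eq_or_ne k n with rfl | h
    · rfl
    · rw [if_neg h]; simp
  e x y := by
    refine verma_bilin_ext (B := vermaForm q l ∘ₗ (verma hq l).e)
      (C := (vermaForm q l).compl₂ (verma hq l).f) (fun k n => ?_) x y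
    rw [LinearMap.comp_apply, LinearMap.compl₂_apply, verma_e_single, verma_f_single, map_smul,
      LinearMap.smul_apply, vermaForm_single_single, vermaForm_single_single]
    rcases k with _ | k
    · simp
    · rcases eq_or_ne k n with rfl | h
      · rw [if_pos (by omega), if_pos rfl, shap_succ, smul_eq_mul]
        push_cast
        ring_nf
      · rw [if_neg (by omega), if_neg (by omega), smul_zero]

theorem eq_zero_of_slice_lapply {ι W : Type*} [AddCommGroup W] [Module ℂ W]
    {z : (ι →₀ ℂ) ⊗[ℂ] W} (h : ∀ k, slice W (Finsupp.lapply k) z = 0) : z = 0 := by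
  classical
  refine (TensorProduct.finsuppScalarLeft ℂ W ι).injective (Finsupp.ext fun k => ?_)
  rw [TensorProduct.finsuppScalarLeft_apply, map_zero, Finsupp.zero_apply]
  exact h k

theorem slice_smul {V W : Type*} [AddCommGroup V] [Module ℂ V] [AddCommGroup W] [Module ℂ W]
    (c : ℂ) (φ : V →ₗ[ℂ] ℂ) (z : V ⊗[ℂ] W) : slice W (c • φ) z = c • slice W φ z := by
  simp [slice, LinearMap.rTensor_smul]

theorem slice_vermaForm {W : Type*} [AddCommGroup W] [Module ℂ W] (k : ℕ)
    (z : (ℕ →₀ ℂ) ⊗[ℂ] W) : slice W (vermaForm q l (Finsupp.single k 1)) z =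
      shap q l k • slice W (Finsupp.lapply k) z := by
  rw [← slice_smul]
  congr 1
  ext; simp [vermaForm]

/-- The contractions with all f^k x vanish with the first one, and when no `shap` vanishes they are
the coordinates up to nonzero factors. This is the uniqueness of Φ^v for generic weights. -/
theorem eq_zero_of_slice_vermaTop {W : Type*} [AddCommGroup W] [Module ℂ W] {N : UqModule q W}
    (hl : ∀ k, shap q l k ≠ 0) {z : (ℕ →₀ ℂ) ⊗[ℂ] W} (hz : ((verma hq l).tensor hq N).e z = 0)
    (h0 : slice W (vermaForm q l vermaTop) z = 0) : z = 0 := by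
  refine eq_zero_of_slice_lapply fun k => ?_
  have := slice_f_pow_eq_zero hq (isContravariant_vermaForm hq) (verma_h_top hq l) hz h0 k
  rw [verma_f_pow_top, slice_vermaForm] at this
  exact (smul_eq_zero.1 this).resolve_left (hl k)

/-- The intertwining map of a Verma module attached to a highest weight vector. -/
def vermaHom {V : Type*} [AddCommGroup V] [Module ℂ V] (N : UqModule q V) (z : V) :
    (ℕ →₀ ℂ) →ₗ[ℂ] V :=
  Finsupp.linearCombination ℂ fun k : ℕ => (N.f ^ k) z

theorem vermaHom_single {V : Type*} [AddCommGroup V] [Module ℂ V] (N : UqModule q V) (z : V)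
    (k : ℕ) : vermaHom N z (Finsupp.single k 1) = (N.f ^ k) z := by
  simp [vermaHom]

theorem vermaHom_top {V : Type*} [AddCommGroup V] [Module ℂ V] (N : UqModule q V) (z : V) :
    vermaHom N z vermaTop = z := by
  rw [vermaTop, vermaHom_single, pow_zero, Module.End.one_apply]

theorem isIntertwining_vermaHom {V : Type*} [AddCommGroup V] [Module ℂ V] {N : UqModule q V}
    {z : V} (hz : N.h z = l • z) (hez : N.e z = 0) :
    (verma hq l).IsIntertwining N (vermaHom N z) := by
  refine ⟨fun v => ?_, fun v => ?_, fun v => ?_⟩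
  · suffices h : vermaHom N z ∘ₗ (verma hq l).h = N.h ∘ₗ vermaHom N z from LinearMap.congr_fun h v
    refine LinearMap.ext_on (span_single_one ℕ) ?_
    rintro _ ⟨k, rfl⟩
    simp only [LinearMap.comp_apply, verma_h_single, map_smul, vermaHom_single,
      N.f_pow_weight hz]
  · suffices h : vermaHom N z ∘ₗ (verma hq l).e = N.e ∘ₗ vermaHom N z from LinearMap.congr_fun h v
    refine LinearMap.ext_on (span_single_one ℕ) ?_
    rintro _ ⟨k, rfl⟩
    simp only [LinearMap.comp_apply, verma_e_single, map_smul, vermaHom_single]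
    rcases k with _ | k
    · simp [hez]
    · rw [N.e_f_pow_succ hq hz, hez, map_zero, zero_add, Nat.add_sub_cancel]
      push_cast; ring_nf
  · suffices h : vermaHom N z ∘ₗ (verma hq l).f = N.f ∘ₗ vermaHom N z from LinearMap.congr_fun h v
    refine LinearMap.ext_on (span_single_one ℕ) ?_
    rintro _ ⟨k, rfl⟩
    simp only [LinearMap.comp_apply, verma_f_single, vermaHom_single, pow_succ',
      Module.End.mul_apply]

theorem verma_hom_ext {V : Type*} [AddCommGroup V] [Module ℂ V] {N : UqModule q V}
    {S T : (ℕ →₀ ℂ) →ₗ[ℂ] V} (hS : (verma hq l).IsIntertwining N S)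
    (hT : (verma hq l).IsIntertwining N T) (h : S vermaTop = T vermaTop) : S = T := by
  refine LinearMap.ext_on (span_single_one ℕ) ?_
  rintro _ ⟨k, rfl⟩
  simp only [← verma_f_pow_top hq l, hS.f_pow, hT.f_pow, h]

end VermaFacts

/-! ### The irreducible modules V^j. -/

section SpinFacts

variable {q : ℝ} (hq : 0 < q) (j : Spin)

theorem spin_h_single (k : Fin (j.twice + 1)) : (spinMod hq j).h (Finsupp.single k (1 : ℂ)) =
    ((j.twice : ℂ) - 2 * (k : ℕ)) • Finsupp.single k (1 : ℂ) := by
  simp [spinMod, finMod]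

theorem spin_e_single (k : Fin (j.twice + 1)) : (spinMod hq j).e (Finsupp.single k (1 : ℂ)) =
    (qNum q (k : ℕ) * qNum q ((j.twice : ℂ) - (k : ℕ) + 1)) •
      Finsupp.single (⟨(k : ℕ) - 1, lt_of_le_of_lt (Nat.sub_le _ _) k.2⟩ : Fin (j.twice + 1))
        (1 : ℂ) := by
  simp [spinMod, finMod]

theorem spin_f_single (k : Fin (j.twice + 1)) : (spinMod hq j).f (Finsupp.single k (1 : ℂ)) =
    if hk : (k : ℕ) + 1 < j.twice + 1 then
      Finsupp.single (⟨(k : ℕ) + 1, hk⟩ : Fin (j.twice + 1)) (1 : ℂ) else 0 := by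
  simp [spinMod, finMod]

theorem xVec_eq_single {k : ℕ} (hk : k < j.twice + 1) :
    xVec hq j k = Finsupp.single ⟨k, hk⟩ 1 := by
  induction k with
  | zero => rfl
  | succ k ih =>
    have h1 := ih (by omega)
    rw [xVec] at h1 ⊢
    rw [pow_succ', Module.End.mul_apply, h1, spin_f_single, dif_pos]

theorem xVec_eq_zero {k : ℕ} (hk : j.twice < k) : xVec hq j k = 0 := by
  obtain ⟨n, rfl⟩ : ∃ n, k = n + (j.twice + 1) := ⟨k - (j.twice + 1), by omega⟩
  have h1 := xVec_eq_single hq j (lt_add_one j.twice)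
  rw [xVec] at h1 ⊢
  rw [pow_add, Module.End.mul_apply, pow_succ', Module.End.mul_apply, h1, spin_f_single,
    dif_neg (lt_irrefl _), map_zero]

theorem spin_h_top : (spinMod hq j).h (finTop j.twice) = (j.twice : ℂ) • finTop j.twice := by
  rw [finTop, spin_h_single]; simp

theorem spin_e_top : (spinMod hq j).e (finTop j.twice) = 0 := by
  rw [finTop, spin_e_single]; simp

theorem xVec_zero : xVec hq j 0 = finTop j.twice := rfl

theorem xVec_weight (k : ℕ) :
    (spinMod hq j).h (xVec hq j k) = ((j.twice : ℂ) - 2 * k) • xVec hq j k :=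
  (spinMod hq j).f_pow_weight (spin_h_top hq j) k

theorem spin_e_xVec_succ (k : ℕ) : (spinMod hq j).e (xVec hq j (k + 1)) =
    (qNum q (k + 1) * qNum q (j.twice - k)) • xVec hq j k := by
  rw [xVec, (spinMod hq j).e_f_pow_succ hq (spin_h_top hq j), spin_e_top, map_zero, zero_add]
  rfl

/-- Written without division, it holds also beyond the lowest weight, where `shap` may vanish. -/
theorem spin_e_pow_xVec (k n : ℕ) : shap q j.twice n • ((spinMod hq j).e ^ k) (xVec hq j (n + k)) =
    shap q j.twice (n + k) • xVec hq j n := by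
  induction k with
  | zero => simp
  | succ k ih =>
    rw [pow_succ, Module.End.mul_apply, ← add_assoc, spin_e_xVec_succ, map_smul, smul_comm, ih,
      smul_smul, shap_succ]
    congr 1
    rw [mul_comm]

theorem spin_e_pow_xVec_eq_zero (n : ℕ) : ((spinMod hq j).e ^ (n + 1)) (xVec hq j n) = 0 := by
  induction n with
  | zero => simp [xVec_zero, spin_e_top]
  | succ n ih =>
    rw [pow_succ, Module.End.mul_apply, spin_e_xVec_succ, map_smul, ih, smul_zero]

theorem span_xVec : Submodule.span ℂ (Set.range (xVec hq j)) = ⊤ := by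
  rw [eq_top_iff, ← span_single_one (Fin (j.twice + 1))]
  refine Submodule.span_mono ?_
  rintro _ ⟨k, rfl⟩
  exact ⟨k, xVec_eq_single hq j k.2⟩

theorem shapovalov_apply (x y : SpinSpace j) :
    shapovalov q j x y = ∑ k : Fin (j.twice + 1), shap q j.twice k * (x k * y k) := by
  simp [shapovalov, qPoch_mul_qFact]

theorem shapovalov_xVec_left {k : ℕ} (hk : k < j.twice + 1) (y : SpinSpace j) :
    shapovalov q j (xVec hq j k) y = shap q j.twice k * y ⟨k, hk⟩ := by
  rw [shapovalov_apply, xVec_eq_single hq j hk, Finset.sum_eq_single ⟨k, hk⟩]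
  · simp
  · intro i _ hi
    simp [hi.symm]
  · simp

theorem shapovalov_xVec (k n : ℕ) : shapovalov q j (xVec hq j k) (xVec hq j n) =
    if k = n then shap q j.twice k else 0 := by
  rcases lt_or_ge k (j.twice + 1) with hk | hk
  · rw [shapovalov_xVec_left hq j hk]
    rcases lt_or_ge n (j.twice + 1) with hn | hn
    · rw [xVec_eq_single hq j hn, Finsupp.single_apply]
      simp only [Fin.mk.injEq, mul_ite, mul_one, mul_zero]
      rcases eq_or_ne k n with rfl | h
      · simp
      · rw [if_neg h, if_neg h.symm]
    · rw [xVec_eq_zero hq j hn, if_neg (by omega)]; simp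
  · rw [xVec_eq_zero hq j hk, map_zero, LinearMap.zero_apply]
    split_ifs
    · rw [shap_natCast_eq_zero hk]
    · rfl

theorem shapovalov_top_top : shapovalov q j (finTop j.twice) (finTop j.twice) = 1 := by
  rw [shapovalov_apply, Finset.sum_eq_single 0]
  · simp [finTop]
  · intro i _ hi
    simp [finTop, hi.symm]
  · simp

variable {j}

theorem spin_bilin_ext {B C : LinearMap.BilinForm ℂ (SpinSpace j)}
    (h : ∀ k n, B (xVec hq j k) (xVec hq j n) = C (xVec hq j k) (xVec hq j n))
    (x y : SpinSpace j) : B x y = C x y := by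
  suffices B = C by rw [this]
  refine LinearMap.ext_on (span_xVec hq j) ?_
  rintro _ ⟨k, rfl⟩
  refine LinearMap.ext_on (span_xVec hq j) ?_
  rintro _ ⟨n, rfl⟩
  exact h k n

theorem spin_f_xVec (k : ℕ) : (spinMod hq j).f (xVec hq j k) = xVec hq j (k + 1) := by
  rw [xVec, xVec, pow_succ', Module.End.mul_apply]

theorem isContravariant_shapovalov : (spinMod hq j).IsContravariant (shapovalov q j) where
  symm x y := by
    rw [shapovalov_apply, shapovalov_apply]
    exact Finset.sum_congr rfl fun k _ => by ring
  h x y := by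
    refine spin_bilin_ext hq (B := shapovalov q j ∘ₗ (spinMod hq j).h)
      (C := (shapovalov q j).compl₂ (spinMod hq j).h) (fun k n => ?_) x y
    rw [LinearMap.comp_apply, LinearMap.compl₂_apply, xVec_weight, xVec_weight, map_smul,
      map_smul, LinearMap.smul_apply, shapovalov_xVec]
    rcases eq_or_ne k n with rfl | h
    · rfl
    · rw [if_neg h]; simp
  e x y := by
    refine spin_bilin_ext hq (B := shapovalov q j ∘ₗ (spinMod hq j).e)
      (C := (shapovalov q j).compl₂ (spinMod hq j).f) (fun k n => ?_) x y
    rw [LinearMap.comp_apply, LinearMap.compl₂_apply, spin_f_xVec, shapovalov_xVec]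
    rcases k with _ | k
    · rw [xVec_zero, spin_e_top]; simp
    · rw [spin_e_xVec_succ, map_smul, LinearMap.smul_apply, shapovalov_xVec]
      rcases eq_or_ne k n with rfl | h
      · rw [if_pos rfl, if_pos rfl, shap_succ, smul_eq_mul]
        ring
      · rw [if_neg h, if_neg (by omega), smul_zero]

/-- The argument for generic Verma modules works in V^j at any spin, since only k ≤ 2j occurs and
there `shap` is positive. -/
theorem eq_zero_of_slice_finTop (hq1 : q < 1) {W : Type*} [AddCommGroup W] [Module ℂ W]
    {N : UqModule q W} {z : SpinSpace j ⊗[ℂ] W} (hz : ((spinMod hq j).tensor hq N).e z = 0)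
    (h0 : slice W (shapovalov q j (finTop j.twice)) z = 0) : z = 0 := by
  refine eq_zero_of_slice_lapply fun k => ?_
  have := slice_f_pow_eq_zero hq (isContravariant_shapovalov hq) (spin_h_top hq j) hz h0 k
  have h1 : shapovalov q j (((spinMod hq j).f ^ (k : ℕ)) (finTop j.twice)) =
      shap q j.twice k • Finsupp.lapply (R := ℂ) (M := ℂ) k := by
    refine LinearMap.ext fun y => ?_
    have := shapovalov_xVec_left hq j k.2 y
    simpa [xVec] using this
  rw [h1, slice_smul] at this
  exact (smul_eq_zero.1 this).resolve_left (shap_natCast_pos hq hq1 (Nat.lt_succ_iff.1 k.2)).ne'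

theorem exists_smul_xVec {u : SpinSpace j} {i : ℕ}
    (hu : (spinMod hq j).h u = ((j.twice : ℂ) - 2 * i) • u) : ∃ c : ℂ, u = c • xVec hq j i := by
  have key : ∀ k : Fin (j.twice + 1), (k : ℕ) ≠ i → u k = 0 := by
    intro k hk
    have h1 : ∀ w : SpinSpace j, (spinMod hq j).h w k = ((j.twice : ℂ) - 2 * (k : ℕ)) * w k := by
      intro w
      suffices h : Finsupp.lapply k ∘ₗ (spinMod hq j).h =
          ((j.twice : ℂ) - 2 * (k : ℕ)) • Finsupp.lapply (R := ℂ) (M := ℂ) k by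
        simpa using LinearMap.congr_fun h w
      refine LinearMap.ext_on (span_single_one _) ?_
      rintro _ ⟨n, rfl⟩
      simp only [LinearMap.comp_apply, spin_h_single, map_smul, Finsupp.lapply_apply,
        LinearMap.smul_apply, smul_eq_mul]
      rcases eq_or_ne n k with rfl | h
      · rfl
      · simp [h]
    have h2 := h1 u
    rw [hu, Finsupp.smul_apply, smul_eq_mul, ← sub_eq_zero, ← sub_mul] at h2
    refine (mul_eq_zero.1 h2).resolve_left fun h3 => hk ?_
    have : (i : ℂ) = (k : ℕ) := by linear_combination (-1 / 2 : ℂ) * h3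
    exact_mod_cast this.symm
  rcases lt_or_ge i (j.twice + 1) with hi | hi
  · refine ⟨u ⟨i, hi⟩, ?_⟩
    rw [xVec_eq_single hq j hi]
    ext k
    rcases eq_or_ne k ⟨i, hi⟩ with rfl | h
    · simp
    · rw [key k (fun h' => h (Fin.ext h'))]
      simp [h.symm]
  -- The index lies below the lowest weight, so the weight space is zero.
  · refine ⟨0, ?_⟩
    rw [zero_smul]
    ext k
    exact key k (by omega)

/-- In a finite dimensional module, `f^{n+1}` kills a highest weight vector of weight `n`. -/
theorem f_pow_succ_eq_zero (hq : 0 < q) (hq1 : q < 1) {V : Type*} [AddCommGroup V] [Module ℂ V]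
    [FiniteDimensional ℂ V] {N : UqModule q V} {n : ℕ} {z : V} (hz : N.h z = (n : ℂ) • z)
    (hez : N.e z = 0) : (N.f ^ (n + 1)) z = 0 := by
  classical
  have hnil : ∃ k, (N.f ^ k) z = 0 := by
    by_contra! hne
    -- If no power of f killed z, the f^k z would be eigenvectors of h for infinitely many
    -- eigenvalues.
    have := Module.End.eigenvectors_linearIndependent' N.h (fun k : ℕ => (n : ℂ) - 2 * k)
      (fun a b hab => by simpa using hab) (fun k => (N.f ^ k) z)
      (fun k => ⟨Module.End.mem_eigenspace_iff.2 (N.f_pow_weight hz k), hne k⟩)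
    have := this.finite
    exact not_finite ℕ
  rcases hm : Nat.find hnil with _ | m
  · have h := Nat.find_spec hnil
    rw [hm, pow_zero, Module.End.one_apply] at h
    rw [h, map_zero]
  · have h := Nat.find_spec hnil
    rw [hm] at h
    have h0 : (N.f ^ m) z ≠ 0 := Nat.find_min hnil (by omega)
    -- Applying e to the first vanishing power gives [m+1]_q [n-m]_q = 0, which forces m = n.
    have h1 := N.e_f_pow_succ hq hz m
    rw [h, map_zero, hez, map_zero, zero_add, eq_comm, smul_eq_zero, or_iff_left h0,
      mul_eq_zero] at h1
    have h2 := h1.resolve_left (by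
      have := (qNum_natCast_pos hq hq1 (n := m + 1) (by omega)).ne'
      exact_mod_cast this)
    rcases lt_trichotomy m n with hlt | rfl | hlt
    · have h3 := (qNum_natCast_pos hq hq1 (n := n - m) (by omega)).ne'
      rw [Nat.cast_sub hlt.le] at h3
      exact absurd h2 h3
    · exact h
    · have h3 := (qNum_natCast_pos hq hq1 (n := m - n) (by omega)).ne'
      rw [Nat.cast_sub hlt.le, ← neg_sub, qNum_neg, neg_ne_zero] at h3
      exact absurd h2 h3

theorem spin_hom_ext {V : Type*} [AddCommGroup V] [Module ℂ V] {N : UqModule q V}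
    {S T : SpinSpace j →ₗ[ℂ] V} (hS : (spinMod hq j).IsIntertwining N S)
    (hT : (spinMod hq j).IsIntertwining N T) (h : S (finTop j.twice) = T (finTop j.twice)) :
    S = T := by
  refine LinearMap.ext_on (span_xVec hq j) ?_
  rintro _ ⟨k, rfl⟩
  simp only [xVec, hS.f_pow, hT.f_pow, h]

/-- V^j is M_{2j} modulo f^{2j+1} x, so a singular vector defines a map as soon as `hfz` holds. -/
theorem exists_spin_hom {V : Type*} [AddCommGroup V] [Module ℂ V]
    {N : UqModule q V} {z : V} (hz : N.h z = (j.twice : ℂ) • z)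
    (hez : N.e z = 0) (hfz : (N.f ^ (j.twice + 1)) z = 0) :
    ∃ T, (spinMod hq j).IsIntertwining N T ∧ T (finTop j.twice) = z := by
  set T : SpinSpace j →ₗ[ℂ] V :=
    Finsupp.linearCombination ℂ fun k : Fin (j.twice + 1) => (N.f ^ (k : ℕ)) z with hT
  have hTx : ∀ k, T (xVec hq j k) = (N.f ^ k) z := by
    intro k
    rcases lt_or_ge k (j.twice + 1) with hk | hk
    · rw [xVec_eq_single hq j hk, hT, Finsupp.linearCombination_single, one_smul]
    · rw [xVec_eq_zero hq j hk, map_zero]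
      obtain ⟨n, rfl⟩ : ∃ n, k = n + (j.twice + 1) := ⟨k - (j.twice + 1), by omega⟩
      rw [pow_add, Module.End.mul_apply, hfz, map_zero]
  refine ⟨T, ⟨fun v => ?_, fun v => ?_, fun v => ?_⟩, ?_⟩
  · suffices h : T ∘ₗ (spinMod hq j).h = N.h ∘ₗ T from LinearMap.congr_fun h v
    refine LinearMap.ext_on (span_xVec hq j) ?_
    rintro _ ⟨k, rfl⟩
    rw [LinearMap.comp_apply, LinearMap.comp_apply, xVec_weight, map_smul, hTx, N.f_pow_weight hz]
  · suffices h : T ∘ₗ (spinMod hq j).e = N.e ∘ₗ T from LinearMap.congr_fun h v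
    refine LinearMap.ext_on (span_xVec hq j) ?_
    rintro _ ⟨k, rfl⟩
    rw [LinearMap.comp_apply, LinearMap.comp_apply, hTx]
    rcases k with _ | k
    · rw [xVec_zero, spin_e_top, map_zero, pow_zero, Module.End.one_apply, hez]
    · rw [spin_e_xVec_succ, map_smul, hTx, N.e_f_pow_succ hq hz, hez, map_zero, zero_add]
  · suffices h : T ∘ₗ (spinMod hq j).f = N.f ∘ₗ T from LinearMap.congr_fun h v
    refine LinearMap.ext_on (span_xVec hq j) ?_
    rintro _ ⟨k, rfl⟩
    rw [LinearMap.comp_apply, LinearMap.comp_apply, spin_f_xVec, hTx, hTx, pow_succ',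
      Module.End.mul_apply]
  · rw [← xVec_zero hq, hTx, pow_zero, Module.End.one_apply]

/-- The pull-back of a contravariant form under intertwining maps from irreducible modules. -/
theorem form_spin_hom {V : Type*} [AddCommGroup V] [Module ℂ V]
    {N : UqModule q V} {B : LinearMap.BilinForm ℂ V} (hB : N.IsContravariant B) {S T}
    (hS : (spinMod hq j).IsIntertwining N S) (hT : (spinMod hq j).IsIntertwining N T)
    (x y : SpinSpace j) :
    B (S x) (T y) = B (S (finTop j.twice)) (T (finTop j.twice)) * shapovalov q j x y := by
  refine spin_bilin_ext hq (B := (B ∘ₗ S).compl₂ T)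
    (C := B (S (finTop j.twice)) (T (finTop j.twice)) • shapovalov q j) (fun k n => ?_) x y
  have e1 : N.e (S (finTop j.twice)) = 0 := by rw [← hS.2.1, spin_e_top, map_zero]
  have e2 : N.e (T (finTop j.twice)) = 0 := by rw [← hT.2.1, spin_e_top, map_zero]
  rw [LinearMap.compl₂_apply, LinearMap.comp_apply, LinearMap.smul_apply, LinearMap.smul_apply,
    shapovalov_xVec, xVec, xVec, hS.f_pow, hT.f_pow,
    hB.f_pow_f_pow hq e1 e2 (hT.weight (spin_h_top hq j))]
  split_ifs
  · rw [smul_eq_mul, mul_comm]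
  · simp

/-- The highest weights differ, so the two highest weight vectors are orthogonal, and contravariance
extends this to the submodules they generate. -/
theorem form_spin_hom_ne {V : Type*} [AddCommGroup V] [Module ℂ V]
    {N : UqModule q V} {B : LinearMap.BilinForm ℂ V} (hB : N.IsContravariant B) {j' : Spin}
    {S : SpinSpace j →ₗ[ℂ] V} {T : SpinSpace j' →ₗ[ℂ] V}
    (hS : (spinMod hq j).IsIntertwining N S) (hT : (spinMod hq j').IsIntertwining N T)
    (hjj : j ≠ j') (x : SpinSpace j) (y : SpinSpace j') : B (S x) (T y) = 0 := by
  suffices h : (B ∘ₗ S).compl₂ T = 0 by simpa using LinearMap.congr_fun (LinearMap.congr_fun h x) y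
  refine LinearMap.ext_on (span_xVec hq j) ?_
  rintro _ ⟨k, rfl⟩
  refine LinearMap.ext_on (span_xVec hq j') ?_
  rintro _ ⟨n, rfl⟩
  have e1 : N.e (S (finTop j.twice)) = 0 := by rw [← hS.2.1, spin_e_top, map_zero]
  have e2 : N.e (T (finTop j'.twice)) = 0 := by rw [← hT.2.1, spin_e_top, map_zero]
  rw [LinearMap.compl₂_apply, LinearMap.comp_apply, xVec, xVec, hS.f_pow, hT.f_pow,
    hB.f_pow_f_pow hq e1 e2 (hT.weight (spin_h_top hq j')),
    hB.eq_zero_of_ne (hS.weight (spin_h_top hq j)) (hT.weight (spin_h_top hq j'))]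
  · simp
  · intro h
    exact hjj (Spin.ext (by exact_mod_cast h))

end SpinFacts

/-! ### The Clebsch–Gordan condition in doubled spins. -/

section Occurs

/-- In doubled spins the condition is integer arithmetic. The bound j ≤ j₁ + j₂ is contained in the
parity equation, as its k is a natural number. -/
theorem occurs_iff {j₁ j₂ j : Spin} : Occurs j₁ j₂ j ↔ j₁.twice ≤ j₂.twice + j.twice ∧
    j₂.twice ≤ j₁.twice + j.twice ∧
    ∃ k : ℕ, j₁.twice + j₂.twice = j.twice + 2 * k := by
  unfold Occurs
  constructor
  · rintro ⟨h1, -, k, hk⟩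
    rw [abs_le] at h1
    refine ⟨?_, ?_, k, ?_⟩
    · have : (j₁.twice : ℝ) ≤ j₂.twice + j.twice := by linarith [h1.2]
      exact_mod_cast this
    · have : (j₂.twice : ℝ) ≤ j₁.twice + j.twice := by linarith [h1.1]
      exact_mod_cast this
    · have : (j₁.twice : ℝ) + j₂.twice = j.twice + 2 * k := by linarith
      exact_mod_cast this
  · rintro ⟨h1, h2, k, hk⟩
    have h1' : (j₁.twice : ℝ) ≤ j₂.twice + j.twice := by exact_mod_cast h1
    have h2' : (j₂.twice : ℝ) ≤ j₁.twice + j.twice := by exact_mod_cast h2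
    have h3' : (j₁.twice : ℝ) + j₂.twice = j.twice + 2 * k := by exact_mod_cast hk
    have h4 : (0 : ℝ) ≤ k := Nat.cast_nonneg k
    exact ⟨abs_le.2 ⟨by linarith, by linarith⟩, by linarith, k, by linarith⟩

variable {j₁ j₂ j : Spin}

theorem Occurs.symm (h : Occurs j₁ j₂ j) : Occurs j₂ j₁ j := by
  rw [occurs_iff] at h ⊢
  obtain ⟨h1, h2, k, hk⟩ := h
  exact ⟨h2, h1, k, by omega⟩

/-- The truncated subtraction and the division in `defect` are exact when V^j occurs. -/
theorem Occurs.add_eq (h : Occurs j₁ j₂ j) :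
    j₁.twice + j₂.twice = j.twice + 2 * defect j₁ j₂ j := by
  obtain ⟨h1, h2, k, hk⟩ := occurs_iff.1 h
  unfold defect
  omega

theorem Occurs.defect_le_left (h : Occurs j₁ j₂ j) : defect j₁ j₂ j ≤ j₁.twice := by
  have := h.add_eq
  obtain ⟨h1, h2, -⟩ := occurs_iff.1 h
  omega

theorem Occurs.defect_le_right (h : Occurs j₁ j₂ j) : defect j₁ j₂ j ≤ j₂.twice := by
  have := h.add_eq
  obtain ⟨h1, h2, -⟩ := occurs_iff.1 h
  omega

theorem defect_comm (j₁ j₂ j : Spin) : defect j₂ j₁ j = defect j₁ j₂ j := by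
  rw [defect, defect, add_comm]

end Occurs

/-! ### Singular vectors in V^{j₁} ⊗ V^{j₂}. -/

section Singular

variable {q : ℝ} (hq : 0 < q) (j₁ j₂ j : Spin)

/-- The singular vector of weight `2j` in `V^{j₁} ⊗ V^{j₂}`. -/
def singVec : SpinSpace j₁ ⊗[ℂ] SpinSpace j₂ :=
  phiTop (spinMod hq j₁) (finTop j₁.twice) j₁.twice (spinMod hq j₂)
    (xVec hq j₂ (defect j₁ j₂ j)) (j₂.twice - 2 * (defect j₁ j₂ j : ℕ)) (defect j₁ j₂ j)

variable {j₁ j₂ j}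

theorem Occurs.weight_eq (h : Occurs j₁ j₂ j) :
    (j₁.twice : ℂ) + (j₂.twice - 2 * (defect j₁ j₂ j : ℕ)) = j.twice := by
  have : (j₁.twice : ℂ) + j₂.twice = j.twice + 2 * (defect j₁ j₂ j : ℕ) := by
    exact_mod_cast h.add_eq
  linear_combination this

theorem singVec_weight (h : Occurs j₁ j₂ j) :
    ((spinMod hq j₁).tensor hq (spinMod hq j₂)).h (singVec hq j₁ j₂ j) =
      (j.twice : ℂ) • singVec hq j₁ j₂ j := by
  have := phiTop_weight (M := spinMod hq j₁) (N := spinMod hq j₂) hq (spin_h_top hq j₁)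
    (xVec_weight hq j₂ (defect j₁ j₂ j)) (defect j₁ j₂ j)
  rw [h.weight_eq] at this
  exact this

theorem singVec_e (hq1 : q < 1) (h : Occurs j₁ j₂ j) :
    ((spinMod hq j₁).tensor hq (spinMod hq j₂)).e (singVec hq j₁ j₂ j) = 0 :=
  phiTop_e hq (spin_h_top hq j₁) (spin_e_top hq j₁) (xVec_weight hq j₂ _)
    (spin_e_pow_xVec_eq_zero hq j₂ _) (shap_natCast_pos hq hq1 h.defect_le_left).ne'

theorem slice_singVec : slice (SpinSpace j₂) (shapovalov q j₁ (finTop j₁.twice))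
    (singVec hq j₁ j₂ j) = xVec hq j₂ (defect j₁ j₂ j) :=
  slice_phiTop_self (isContravariant_shapovalov hq) (spin_e_top hq j₁) (shapovalov_top_top j₁) _

theorem isContravariant_shapovalov₂ :
    ((spinMod hq j₁).tensor hq (spinMod hq j₂)).IsContravariant (shapovalov₂ q j₁ j₂) :=
  (isContravariant_shapovalov hq).tmul hq (isContravariant_shapovalov hq)

/-- Singular vectors are determined up to a scalar by their weight. -/
theorem exists_smul_singVec (hq1 : q < 1) (h : Occurs j₁ j₂ j)
    {z : SpinSpace j₁ ⊗[ℂ] SpinSpace j₂}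
    (hz : ((spinMod hq j₁).tensor hq (spinMod hq j₂)).h z = (j.twice : ℂ) • z)
    (hez : ((spinMod hq j₁).tensor hq (spinMod hq j₂)).e z = 0) :
    ∃ c : ℂ, z = c • singVec hq j₁ j₂ j ∧
      slice (SpinSpace j₂) (shapovalov q j₁ (finTop j₁.twice)) z =
        c • xVec hq j₂ (defect j₁ j₂ j) := by
  have h1 := slice_weight hq (isContravariant_shapovalov hq) (spin_h_top hq j₁) hz
  have h2 : (j.twice : ℂ) - j₁.twice = j₂.twice - 2 * (defect j₁ j₂ j : ℕ) := by
    rw [← h.weight_eq]; ring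
  rw [h2] at h1
  obtain ⟨c, hc⟩ := exists_smul_xVec hq h1
  refine ⟨c, ?_, hc⟩
  rw [← sub_eq_zero]
  refine eq_zero_of_slice_finTop hq hq1 (N := spinMod hq j₂) ?_ ?_
  · rw [map_sub, map_smul, hez, singVec_e hq hq1 h, smul_zero]
    exact sub_zero (0 : SpinSpace j₁ ⊗[ℂ] SpinSpace j₂)
  · rw [map_sub, map_smul, slice_singVec, hc, sub_self]

/-- Iterating `slice_e` for singular z replaces f on the contracting vector by e on the result, up
to a power of q and a sign, hence up to a nonzero scalar. -/
theorem slice_f_pow_of_singular {V W : Type*} [AddCommGroup V] [Module ℂ V] [AddCommGroup W]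
    [Module ℂ W] {M : UqModule q V} {N : UqModule q W} {B : LinearMap.BilinForm ℂ V}
    (hB : M.IsContravariant B) {a b : ℂ} {x : V} (hx : M.h x = a • x) {z : V ⊗[ℂ] W}
    (hz : (M.tensor hq N).h z = b • z) (hez : (M.tensor hq N).e z = 0) (k : ℕ) :
    ∃ c : ℂ, c ≠ 0 ∧ slice W (B ((M.f ^ k) x)) z = c • (N.e ^ k) (slice W (B x) z) := by
  induction k with
  | zero => exact ⟨1, one_ne_zero, by simp⟩
  | succ k ih =>
    obtain ⟨c, hc, h⟩ := ih
    have h1 := slice_e (N := N) hq hB (M.f_pow_weight hx k) z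
    have h2 := slice_weight (N := N) hq hB (M.f_pow_weight hx (k + 1)) hz
    rw [hez, map_zero, ← Module.End.mul_apply, ← pow_succ', N.qPowH_apply _ h2, h, map_smul,
      ← Module.End.mul_apply, ← pow_succ', smul_smul] at h1
    refine ⟨-(((q : ℂ) ^ (1 / 4 * (b - (a - 2 * ((k + 1 : ℕ) : ℂ)))))⁻¹ *
      ((q : ℂ) ^ (-1 / 4 * (a - 2 * (k : ℂ))) * c)), ?_, ?_⟩
    · exact neg_ne_zero.2 (mul_ne_zero (inv_ne_zero (cpow_ne_zero_of_pos hq _))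
        (mul_ne_zero (cpow_ne_zero_of_pos hq _) hc))
    · rw [neg_smul, ← smul_smul, ← smul_neg, ← eq_neg_of_add_eq_zero_left h1.symm,
        inv_smul_smul₀ (cpow_ne_zero_of_pos hq _)]

/-- A nonzero singular vector of weight `2j` exists only if `V^j` occurs. -/
theorem occurs_of_singular (hq1 : q < 1) {z : SpinSpace j₁ ⊗[ℂ] SpinSpace j₂}
    (hz : ((spinMod hq j₁).tensor hq (spinMod hq j₂)).h z = (j.twice : ℂ) • z)
    (hez : ((spinMod hq j₁).tensor hq (spinMod hq j₂)).e z = 0) (hne : z ≠ 0) :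
    Occurs j₁ j₂ j := by
  have hB := isContravariant_shapovalov hq (j := j₁)
  have h1 := slice_weight hq hB (spin_h_top hq j₁) hz
  set u := slice (SpinSpace j₂) (shapovalov q j₁ (finTop j₁.twice)) z with hu
  have hu0 : u ≠ 0 := fun h0 => hne (eq_zero_of_slice_finTop hq hq1 (N := spinMod hq j₂) hez h0)
  -- A nonzero contraction must have a weight of V^{j₂}; otherwise it would be orthogonal to every
  -- basis vector.
  obtain ⟨i, hi⟩ : ∃ i : Fin (j₂.twice + 1), (j.twice : ℂ) - j₁.twice = j₂.twice - 2 * (i : ℕ) := by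
    by_contra! hcon
    apply hu0
    have h2 : ∀ n, shapovalov q j₂ u (xVec hq j₂ n) = 0 := by
      intro n
      rcases lt_or_ge n (j₂.twice + 1) with hn | hn
      · exact (isContravariant_shapovalov hq).eq_zero_of_ne h1 (xVec_weight hq j₂ n)
          (hcon ⟨n, hn⟩)
      · rw [xVec_eq_zero hq j₂ hn, map_zero]
    ext n
    have h3 := h2 n
    rw [(isContravariant_shapovalov hq).symm, shapovalov_xVec_left hq j₂ n.2] at h3
    exact (mul_eq_zero.1 h3).resolve_left
      (shap_natCast_pos hq hq1 (Nat.lt_succ_iff.1 n.2)).ne'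
  have hi' : j₁.twice + j₂.twice = j.twice + 2 * (i : ℕ) := by
    have : (j₁.twice : ℂ) + j₂.twice = j.twice + 2 * (i : ℕ) := by linear_combination -hi
    exact_mod_cast this
  rw [hi] at h1
  obtain ⟨c, hc⟩ := exists_smul_xVec hq h1
  have hc0 : c ≠ 0 := by
    rintro rfl
    exact hu0 (by rw [hc, zero_smul])
  -- Since f^{2j₁+1} annihilates the top of V^{j₁}, e^{2j₁+1} must annihilate the contraction. For i
  -- > 2j₁ it would send it to a nonzero multiple of a basis vector.
  have hle : (i : ℕ) ≤ j₁.twice := by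
    by_contra! hlt
    obtain ⟨c', hc', h3⟩ := slice_f_pow_of_singular hq hB (spin_h_top hq j₁) hz hez (j₁.twice + 1)
    have h4 : ((spinMod hq j₁).f ^ (j₁.twice + 1)) (finTop j₁.twice) = 0 :=
      xVec_eq_zero hq j₁ (lt_add_one _)
    have h5 := spin_e_pow_xVec hq j₂ (j₁.twice + 1) (i - (j₁.twice + 1))
    rw [Nat.sub_add_cancel hlt] at h5
    rw [h4, ← hu, hc, map_smul, smul_smul] at h3
    have h6 : slice (SpinSpace j₂) (shapovalov q j₁ 0) z = 0 := by
      rw [map_zero]; simp [slice]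
    rw [h6, eq_comm, smul_eq_zero, or_iff_right (mul_ne_zero hc' hc0)] at h3
    rw [h3, smul_zero, eq_comm, smul_eq_zero, or_iff_right
      (shap_natCast_pos hq hq1 (Nat.lt_succ_iff.1 i.2)).ne',
      xVec_eq_single hq j₂ (by omega)] at h5
    simp at h5
  rw [occurs_iff]
  have := i.2
  exact ⟨by omega, by omega, i, hi'⟩

end Singular

/-! ### The maps Φ_{q,2j}, their norms, and the standard embeddings. -/

section FinPhi

variable {q : ℝ} (hq : 0 < q) {j₁ j₂ j : Spin}

theorem exists_finPhi (hq1 : q < 1) (h : Occurs j₁ j₂ j) :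
    ∃ Φ, ((spinMod hq j).IsIntertwining ((spinMod hq j₁).tensor hq (spinMod hq j₂)) Φ ∧
      Φ (finTop j.twice) = singVec hq j₁ j₂ j) :=
  exists_spin_hom hq (singVec_weight hq h) (singVec_e hq hq1 h)
    (f_pow_succ_eq_zero hq hq1 (singVec_weight hq h) (singVec_e hq hq1 h))

/-- Whichever map is chosen, its top vector is singular and its contraction with the highest weight
vector is the prescribed v; these two facts determine it. -/
theorem finPhi_spec (hq1 : q < 1) (h : Occurs j₁ j₂ j) :
    (spinMod hq j).IsIntertwining ((spinMod hq j₁).tensor hq (spinMod hq j₂))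
      (finPhi hq j₁ j₂ j) ∧ finPhi hq j₁ j₂ j (finTop j.twice) = singVec hq j₁ j₂ j := by
  have hex : ∃ Φ, IsIntertwiningMap hq (spinMod hq j) (finTop j.twice) (spinMod hq j₁)
      (finTop j₁.twice) (spinMod hq j₂) (xVec hq j₂ (defect j₁ j₂ j)) Φ := by
    obtain ⟨Φ, h1, h2⟩ := exists_finPhi hq hq1 h
    -- The components v_k are read off from the explicit singular vector.
    refine ⟨Φ, h1, ∑ k ∈ Finset.range (defect j₁ j₂ j + 1), Finsupp.single k
      (phiCoeff q j₁.twice (j₂.twice - 2 * (defect j₁ j₂ j : ℕ)) k •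
        ((spinMod hq j₂).e ^ k) (xVec hq j₂ (defect j₁ j₂ j))), ?_, ?_⟩
    · rw [Finsupp.finsetSum_apply, Finset.sum_eq_single 0]
      · simp
      · intro k _ hk
        simp [hk]
      · simp
    · rw [h2, ← Finsupp.sum_finsetSum_index, singVec, phiTop]
      · refine Finset.sum_congr rfl fun k _ => ?_
        rw [Finsupp.sum_single_index, TensorProduct.tmul_smul]
        simp
      · simp
      · intros; rw [TensorProduct.tmul_add]
  rw [finPhi, dif_pos hex]
  obtain ⟨h1, u, hu0, hu⟩ := hex.choose_spec
  refine ⟨h1, ?_⟩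
  set z := hex.choose (finTop j.twice) with hz
  rw [← sub_eq_zero]
  refine eq_zero_of_slice_finTop hq hq1 (N := spinMod hq j₂) ?_ ?_
  · rw [map_sub, singVec_e hq hq1 h, hz, ← h1.2.1, spin_e_top, map_zero]
    exact sub_zero (0 : SpinSpace j₁ ⊗[ℂ] SpinSpace j₂)
  -- Contraction with the top vector retains only the component with k = 0.
  · rw [map_sub, slice_singVec, hu, Finsupp.sum, map_sum, sub_eq_zero, ← hu0]
    have : ∀ k ∈ u.support, slice (SpinSpace j₂) (shapovalov q j₁ (finTop j₁.twice))
        (((spinMod hq j₁).f ^ k) (finTop j₁.twice) ⊗ₜ[ℂ] u k) = if k = 0 then u 0 else 0 := by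
      intro k _
      have := shapovalov_xVec hq j₁ 0 k
      rw [xVec_zero] at this
      rw [slice_tmul]
      rcases eq_or_ne k 0 with rfl | hk
      · rw [if_pos rfl, pow_zero, Module.End.one_apply, shapovalov_top_top, one_smul]
      · rw [if_neg hk.symm] at this
        rw [if_neg hk]
        erw [this]
        rw [zero_smul]
    rw [Finset.sum_congr rfl this, Finset.sum_ite_eq']
    split_ifs with h3
    · rfl
    · exact (Finsupp.notMem_support_iff.1 h3).symm

/-- The sign (-1)^k squares away; an integral weight makes the power of q real and positive. -/
theorem phiCoeff_mul_self_pos (hq : 0 < q) (hq1 : q < 1) {a k : ℕ} (hk : k ≤ a) (r : ℤ) :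
    0 < phiCoeff q a (r : ℂ) k * phiCoeff q a (r : ℂ) k := by
  have h1 : -((k : ℂ) * (a + r + 2)) / 4 = ((-((k : ℝ) * (a + r + 2)) / 4 : ℝ) : ℂ) := by
    push_cast; ring
  have h2 := cpow_ofReal_pos hq (-((k : ℝ) * (a + r + 2)) / 4)
  have h3 := shap_natCast_pos hq hq1 hk
  have h4 : phiCoeff q a (r : ℂ) k * phiCoeff q a (r : ℂ) k =
      (q : ℂ) ^ ((-((k : ℝ) * (a + r + 2)) / 4 : ℝ) : ℂ) / shap q a k *
      ((q : ℂ) ^ ((-((k : ℝ) * (a + r + 2)) / 4 : ℝ) : ℂ) / shap q a k) := by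
    have : (-1 : ℂ) ^ k * (-1) ^ k = 1 := by rw [← mul_pow]; simp
    rw [phiCoeff, h1]
    linear_combination ((q : ℂ) ^ ((-((k : ℝ) * (a + r + 2)) / 4 : ℝ) : ℂ) / shap q a k *
      ((q : ℂ) ^ ((-((k : ℝ) * (a + r + 2)) / 4 : ℝ) : ℂ) / shap q a k)) * this
  rw [h4]
  exact mul_pos (div_pos h2 h3) (div_pos h2 h3)

theorem shapovalov_e_pow_xVec_pos (hq1 : q < 1) {k d : ℕ} (hkd : k ≤ d) (hd : d ≤ j.twice) :
    0 < shapovalov q j (((spinMod hq j).e ^ k) (xVec hq j d))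
      (((spinMod hq j).e ^ k) (xVec hq j d)) := by
  obtain ⟨n, rfl⟩ : ∃ n, d = n + k := ⟨d - k, by omega⟩
  have hn := shap_natCast_pos hq hq1 (a := j.twice) (k := n) (by omega)
  have hnk := shap_natCast_pos hq hq1 (a := j.twice) (k := n + k) hd
  have h1 := spin_e_pow_xVec hq j k n
  have h2 : ((spinMod hq j).e ^ k) (xVec hq j (n + k)) =
      ((shap q j.twice n)⁻¹ * shap q j.twice (n + k)) • xVec hq j n := by
    rw [← smul_smul, ← h1, inv_smul_smul₀ hn.ne']
  rw [h2, map_smul, map_smul, LinearMap.smul_apply, shapovalov_xVec, if_pos rfl, smul_eq_mul,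
    smul_eq_mul]
  have := mul_pos (inv_pos.2 hn) hnk
  exact mul_pos this (mul_pos this hn)

/-- The first factors f^k x are pairwise orthogonal, so the norm is a sum of squares with positive
weights. The range of `defect` keeps every `shap` involved positive. -/
theorem singVec_norm_pos (hq1 : q < 1) (h : Occurs j₁ j₂ j) :
    0 < shapovalov₂ q j₁ j₂ (singVec hq j₁ j₂ j) (singVec hq j₁ j₂ j) := by
  set d := defect j₁ j₂ j with hd
  set ν : ℂ := j₂.twice - 2 * (d : ℕ) with hν
  have hν' : ν = ((j₂.twice - 2 * d : ℤ) : ℂ) := by rw [hν]; push_cast; ring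
  have key : shapovalov₂ q j₁ j₂ (singVec hq j₁ j₂ j) (singVec hq j₁ j₂ j) =
      ∑ k ∈ Finset.range (d + 1), phiCoeff q j₁.twice ν k * phiCoeff q j₁.twice ν k *
        (shap q j₁.twice k * shapovalov q j₂ (((spinMod hq j₂).e ^ k) (xVec hq j₂ d))
          (((spinMod hq j₂).e ^ k) (xVec hq j₂ d))) := by
    rw [singVec, phiTop, map_sum (shapovalov₂ q j₁ j₂), LinearMap.sum_apply]
    refine Finset.sum_congr rfl fun k hk => ?_
    rw [map_sum, Finset.sum_eq_single k]
    · rw [map_smul, map_smul, LinearMap.smul_apply, shapovalov₂, tmul_form_apply]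
      have := shapovalov_xVec hq j₁ k k
      rw [if_pos rfl, xVec] at this
      rw [this, smul_eq_mul, smul_eq_mul, mul_assoc]
    · intro n _ hn
      rw [map_smul, map_smul, LinearMap.smul_apply, shapovalov₂, tmul_form_apply]
      have := shapovalov_xVec hq j₁ k n
      rw [if_neg hn.symm, xVec, xVec] at this
      rw [this]; simp
    · intro h; exact absurd hk h
  rw [key, hν']
  refine Finset.sum_pos (fun k hk => ?_) ⟨0, by simp⟩
  have hk : k ≤ d := Nat.lt_succ_iff.1 (Finset.mem_range.1 hk)
  have hd1 := h.defect_le_left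
  have hd2 := h.defect_le_right
  exact mul_pos (phiCoeff_mul_self_pos hq hq1 (by omega) _)
    (mul_pos (shap_natCast_pos hq hq1 (by omega)) (shapovalov_e_pow_xVec_pos hq hq1 hk (by omega)))

theorem phiNorm_pos (hq1 : q < 1) (h : Occurs j₁ j₂ j) : 0 < phiNorm hq j₁ j₂ j := by
  have := singVec_norm_pos hq hq1 h
  rw [phiNorm, (finPhi_spec hq hq1 h).2]
  exact Real.sqrt_pos.2 (Complex.pos_iff.1 this).1

/-- The real part in the definition loses nothing: positivity in ℂ includes a zero imaginary part.
-/
theorem phiNorm_sq (hq1 : q < 1) (h : Occurs j₁ j₂ j) :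
    (phiNorm hq j₁ j₂ j : ℂ) * phiNorm hq j₁ j₂ j =
      shapovalov₂ q j₁ j₂ (singVec hq j₁ j₂ j) (singVec hq j₁ j₂ j) := by
  have := singVec_norm_pos hq hq1 h
  rw [phiNorm, (finPhi_spec hq hq1 h).2, ← Complex.ofReal_mul,
    Real.mul_self_sqrt (Complex.pos_iff.1 this).1.le]
  exact Complex.ext rfl (Complex.pos_iff.1 this).2

theorem stdVec_eq_smul (k : ℕ) : stdVec hq j k =
    (((Real.sqrt (shap q j.twice k).re)⁻¹ : ℝ) : ℂ) • xVec hq j k := by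
  rw [stdVec, qPoch_mul_qFact]

theorem stdVec_zero : stdVec hq j 0 = finTop j.twice := by
  rw [stdVec_eq_smul]; simp [xVec_zero]

theorem shapovalov_stdVec (hq1 : q < 1) {k n : ℕ} (hk : k ≤ j.twice) :
    shapovalov q j (stdVec hq j k) (stdVec hq j n) = if k = n then 1 else 0 := by
  rw [stdVec_eq_smul, stdVec_eq_smul, map_smul, map_smul, LinearMap.smul_apply, shapovalov_xVec]
  rcases eq_or_ne k n with rfl | h
  · rw [if_pos rfl, if_pos rfl]
    obtain ⟨h1, h2⟩ := Complex.pos_iff.1 (shap_natCast_pos hq hq1 hk)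
    have h3 : shap q j.twice k = ((shap q j.twice k).re : ℂ) := Complex.ext rfl h2.symm
    rw [smul_eq_mul, smul_eq_mul]
    nth_rewrite 3 [h3]
    have h4 := Real.sqrt_pos.2 h1
    have h5 := Real.mul_self_sqrt h1.le
    norm_cast
    field_simp
    nlinarith
  · rw [if_neg h, if_neg h, smul_zero, smul_zero]

theorem tmul_form_tmul_right {V W : Type*} [AddCommGroup V] [Module ℂ V] [AddCommGroup W]
    [Module ℂ W] {M : UqModule q V} {B : LinearMap.BilinForm ℂ V} (hB : M.IsContravariant B)
    (C : LinearMap.BilinForm ℂ W) (z : V ⊗[ℂ] W) (x : V) (w : W) :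
    B.tmul C z (x ⊗ₜ w) = C (slice W (B x) z) w := by
  induction z using TensorProduct.induction_on with
  | zero => simp
  | add x y hx hy => simp only [map_add, LinearMap.add_apply, hx, hy]
  | tmul v w => rw [tmul_form_apply, slice_tmul, map_smul, LinearMap.smul_apply, smul_eq_mul,
      hB.symm]

theorem shapovalov_xVec_stdVec_pos (hq1 : q < 1) {k : ℕ} (hk : k ≤ j.twice) :
    0 < shapovalov q j (xVec hq j k) (stdVec hq j k) := by
  have h1 := shap_natCast_pos hq hq1 hk
  rw [stdVec_eq_smul, map_smul, shapovalov_xVec, if_pos rfl, smul_eq_mul]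
  refine mul_pos ?_ h1
  have := inv_pos.2 (Real.sqrt_pos.2 (Complex.pos_iff.1 h1).1)
  exact_mod_cast this

theorem isStdEmbedding_smul_finPhi (hq1 : q < 1) (h : Occurs j₁ j₂ j) :
    IsStdEmbedding hq j₁ j₂ j (((phiNorm hq j₁ j₂ j : ℂ))⁻¹ • finPhi hq j₁ j₂ j) := by
  obtain ⟨h1, h2⟩ := finPhi_spec hq hq1 h
  have hpos : (0 : ℂ) < phiNorm hq j₁ j₂ j := by exact_mod_cast phiNorm_pos hq hq1 h
  refine ⟨⟨fun v => ?_, fun v => ?_, fun v => ?_⟩, fun k n hk _ => ?_, ?_⟩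
  · simp [h1.1]
  · simp [h1.2.1]
  · simp [h1.2.2]
  · rw [LinearMap.smul_apply, LinearMap.smul_apply, map_smul, map_smul, LinearMap.smul_apply,
      form_spin_hom hq (isContravariant_shapovalov₂ hq) h1 h1, h2, ← phiNorm_sq hq hq1 h,
      shapovalov_stdVec hq hq1 hk, smul_eq_mul, smul_eq_mul, ← mul_assoc, ← mul_assoc]
    have := hpos.ne'
    field_simp
  · rw [stdVec_zero, stdVec_zero, LinearMap.smul_apply, h2, map_smul, LinearMap.smul_apply,
      shapovalov₂, tmul_form_tmul_right (isContravariant_shapovalov hq), slice_singVec, smul_eq_mul]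
    exact mul_pos (inv_pos.2 hpos) (shapovalov_xVec_stdVec_pos hq hq1 h.defect_le_right)

/-- By uniqueness of singular vectors any standard embedding has top vector c times `singVec`. The
sign condition makes c positive, and the normalisation makes c times the norm a square root of 1. -/
theorem stdEmbedding_eq (hq1 : q < 1) (h : Occurs j₁ j₂ j) :
    stdEmbedding hq j₁ j₂ j = ((phiNorm hq j₁ j₂ j : ℂ))⁻¹ • finPhi hq j₁ j₂ j := by
  have hex : ∃ ι, IsStdEmbedding hq j₁ j₂ j ι := ⟨_, isStdEmbedding_smul_finPhi hq hq1 h⟩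
  rw [stdEmbedding, dif_pos hex]
  obtain ⟨h1, h2, h3⟩ := hex.choose_spec
  obtain ⟨g1, g2⟩ := finPhi_spec hq hq1 h
  have hpos : (0 : ℂ) < phiNorm hq j₁ j₂ j := by exact_mod_cast phiNorm_pos hq hq1 h
  have hstd := (isStdEmbedding_smul_finPhi hq hq1 h).1
  refine spin_hom_ext hq h1 hstd ?_
  obtain ⟨c, hc, -⟩ := exists_smul_singVec hq hq1 h (h1.weight (spin_h_top hq j))
    (by rw [← h1.2.1, spin_e_top, map_zero])
  have h4 := h2 0 0 (Nat.zero_le _) (Nat.zero_le _)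
  rw [stdVec_zero, stdVec_zero, hc, map_smul, LinearMap.smul_apply, shapovalov₂,
    tmul_form_tmul_right (isContravariant_shapovalov hq), slice_singVec, smul_eq_mul] at h3
  have hp := shapovalov_xVec_stdVec_pos hq hq1 h.defect_le_right
  have hc0 : 0 < c := by
    have := mul_pos h3 (inv_pos.2 hp)
    rwa [mul_inv_cancel_right₀ hp.ne'] at this
  rw [stdVec_zero, hc, map_smul, map_smul, LinearMap.smul_apply, ← phiNorm_sq hq hq1 h,
    smul_eq_mul, smul_eq_mul, if_pos rfl] at h4
  have h5 : (c * phiNorm hq j₁ j₂ j) ^ 2 = 1 := by linear_combination h4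
  have h6 : c * phiNorm hq j₁ j₂ j = 1 := by
    refine (sq_eq_one_iff.1 h5).resolve_right ?_
    have : 0 < c * phiNorm hq j₁ j₂ j + 1 := add_pos (mul_pos hc0 hpos) one_pos
    exact fun h => this.ne' (by rw [h]; ring)
  rw [hc, LinearMap.smul_apply, g2, eq_inv_of_mul_eq_one_left h6]

end FinPhi

/-! ### The action of the braiding on irreducible submodules. -/

section StdEmbedding

variable {q : ℝ} (hq : 0 < q) {j₁ j₂ j : Spin}

theorem isIntertwining_stdEmbedding (hq1 : q < 1) (h : Occurs j₁ j₂ j) :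
    (spinMod hq j).IsIntertwining ((spinMod hq j₁).tensor hq (spinMod hq j₂))
      (stdEmbedding hq j₁ j₂ j) := by
  rw [stdEmbedding_eq hq hq1 h]
  exact (isStdEmbedding_smul_finPhi hq hq1 h).1

theorem stdEmbedding_top (hq1 : q < 1) (h : Occurs j₁ j₂ j) :
    stdEmbedding hq j₁ j₂ j (finTop j.twice) =
      (phiNorm hq j₁ j₂ j : ℂ)⁻¹ • singVec hq j₁ j₂ j := by
  rw [stdEmbedding_eq hq hq1 h, LinearMap.smul_apply, (finPhi_spec hq hq1 h).2]

theorem shapovalov₂_stdEmbedding (hq1 : q < 1) (h : Occurs j₁ j₂ j) (x y : SpinSpace j) :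
    shapovalov₂ q j₁ j₂ (stdEmbedding hq j₁ j₂ j x) (stdEmbedding hq j₁ j₂ j y) =
      shapovalov q j x y := by
  have hι := isIntertwining_stdEmbedding hq hq1 h
  have hpos : (phiNorm hq j₁ j₂ j : ℂ) ≠ 0 := by exact_mod_cast (phiNorm_pos hq hq1 h).ne'
  rw [form_spin_hom hq (isContravariant_shapovalov₂ hq) hι hι, stdEmbedding_top hq hq1 h, map_smul,
    map_smul, LinearMap.smul_apply, ← phiNorm_sq hq hq1 h, smul_eq_mul, smul_eq_mul]
  field_simp

/-- The scalar by which the braiding maps singular vectors to each other. -/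
def braidScalar (q : ℝ) (a b d : ℕ) : ℂ :=
  phiCoeff q a (b - 2 * d) d * (q : ℂ) ^ (((a : ℂ) - 2 * d) * b / 4) * shap q b d

/-- The image is singular of the same weight, hence a multiple of the singular vector in the
opposite order. Contraction with the top of V^{j₂} reads off the scalar: only the last term of the
singular vector and the Cartan part of R contribute. -/
theorem braid_singVec (hq1 : q < 1) (h : Occurs j₁ j₂ j) :
    braid (spinMod hq j₁) (spinMod hq j₂) (singVec hq j₁ j₂ j) =
      braidScalar q j₁.twice j₂.twice (defect j₁ j₂ j) • singVec hq j₂ j₁ j := by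
  have hbr := isIntertwining_braid hq hq1 (spinMod hq j₁) (spinMod hq j₂)
  obtain ⟨c, hc, hs⟩ := exists_smul_singVec hq hq1 h.symm (hbr.weight (singVec_weight hq h))
    (by rw [← hbr.2.1, singVec_e hq hq1 h, map_zero])
  rw [hc]
  congr 1
  set d := defect j₁ j₂ j with hd
  rw [defect_comm, ← hd] at hs
  have hd1 := h.defect_le_left
  have hd2 := h.defect_le_right
  have key : slice (SpinSpace j₁) (shapovalov q j₂ (finTop j₂.twice))
      (braid (spinMod hq j₁) (spinMod hq j₂) (singVec hq j₁ j₂ j)) =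
      braidScalar q j₁.twice j₂.twice d • xVec hq j₁ d := by
    rw [singVec, phiTop, map_sum, map_sum, ← hd, Finset.sum_range_succ, Finset.sum_eq_zero, zero_add]
    · have e1 := (spinMod hq j₂).e_pow_weight (xVec_weight hq j₂ d) d
      have e2 := xVec_weight hq j₁ d
      have e3 : ((spinMod hq j₁).e ^ (d + 1)) (xVec hq j₁ d) = 0 := spin_e_pow_xVec_eq_zero hq j₁ d
      rw [map_smul, map_smul, ← xVec, braid_weight hq _ _ e2 e1 e3, map_sum,
        Finset.sum_range_succ', Finset.sum_eq_zero, zero_add]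
      · have e4 := spin_e_pow_xVec hq j₂ d 0
        rw [zero_add, shap_zero, one_smul, xVec_zero] at e4
        rw [map_smul, slice_tmul, pow_zero, Module.End.one_apply, pow_zero, Module.End.one_apply, e4,
          map_smul, shapovalov_top_top, rCoeff, rScalar_zero, smul_smul, smul_smul, braidScalar,
          smul_eq_mul, mul_one, one_mul]
        congr 4
        push_cast; ring
      · intro k _
        rw [map_smul, slice_tmul, pow_succ', Module.End.mul_apply,
          ← (isContravariant_shapovalov hq).e, spin_e_top]
        simp
    · intro k hk
      have hk : k < d := Finset.mem_range.1 hk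
      have e1 := (spinMod hq j₂).e_pow_weight (xVec_weight hq j₂ d) k
      have e2 := xVec_weight hq j₁ k
      have e3 : ((spinMod hq j₁).e ^ (k + 1)) (xVec hq j₁ k) = 0 := spin_e_pow_xVec_eq_zero hq j₁ k
      rw [map_smul, map_smul, ← xVec, braid_weight hq _ _ e2 e1 e3, map_sum, Finset.sum_eq_zero,
        smul_zero]
      intro i _
      have e5 := shapovalov_xVec hq j₂ k d
      rw [if_neg hk.ne] at e5
      -- Two reasons for vanishing: without a power of f the weight k ≠ d is wrong, and with one the
      -- top vector is orthogonal to the image of f.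
      rw [map_smul, slice_tmul]
      rcases i with _ | i
      · rw [pow_zero, Module.End.one_apply, ← (isContravariant_shapovalov hq).f_pow, ← xVec, e5,
          zero_smul, smul_zero]
      · rw [pow_succ', Module.End.mul_apply, ← (isContravariant_shapovalov hq).e, spin_e_top]
        simp
  rw [hs] at key
  have hx : xVec hq j₁ d ≠ 0 := by
    rw [xVec_eq_single hq j₁ (by omega)]; simp
  exact smul_left_injective ℂ hx key

/-- The sign comes from `phiCoeff` alone. In the product of the scalars for the two orders the
`shap` factors cancel, leaving a pure power of q. -/
theorem braidScalar_eq (hq : 0 < q) (hq1 : q < 1) {a b d : ℕ} (hda : d ≤ a) (hdb : d ≤ b) :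
    ∃ ρ : ℂ, 0 < ρ ∧ braidScalar q a b d = (-1) ^ d * ρ ∧
      braidScalar q a b d * braidScalar q b a d =
        (q : ℂ) ^ ((-(d * (a + b - 2 * d + 2)) / 2 + ((a - 2 * d) * b + (b - 2 * d) * a) / 4 : ℝ) : ℂ)
      := by
  have ha := shap_natCast_pos hq hq1 hda
  have hb := shap_natCast_pos hq hq1 hdb
  have h1 := cpow_ofReal_pos hq (-(d * (a + (b - 2 * d) + 2)) / 4)
  have h2 := cpow_ofReal_pos hq ((a - 2 * d) * b / 4)
  refine ⟨_, mul_pos (mul_pos (div_pos h1 ha) h2) hb, ?_, ?_⟩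
  · rw [braidScalar, phiCoeff]
    push_cast
    ring
  · have hs : (-1 : ℂ) ^ d * (-1) ^ d = 1 := by rw [← mul_pow]; simp
    have hQ : (q : ℂ) ^ (-((d : ℂ) * (a + (b - 2 * d) + 2)) / 4) *
        (q : ℂ) ^ (((a : ℂ) - 2 * d) * b / 4) *
        ((q : ℂ) ^ (-((d : ℂ) * (b + (a - 2 * d) + 2)) / 4) *
        (q : ℂ) ^ (((b : ℂ) - 2 * d) * a / 4)) =
        (q : ℂ) ^ ((-(d * (a + b - 2 * d + 2)) / 2 +
          ((a - 2 * d) * b + (b - 2 * d) * a) / 4 : ℝ) : ℂ) := by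
      simp only [← Complex.cpow_add _ _ (ofReal_ne_zero_of_pos hq)]
      congr 1; push_cast; ring
    rw [← hQ, braidScalar, braidScalar, phiCoeff, phiCoeff]
    calc _ = ((-1 : ℂ) ^ d * (-1) ^ d) * ((q : ℂ) ^ (-((d : ℂ) * (a + (b - 2 * d) + 2)) / 4) *
        (q : ℂ) ^ (((a : ℂ) - 2 * d) * b / 4) *
        ((q : ℂ) ^ (-((d : ℂ) * (b + (a - 2 * d) + 2)) / 4) *
        (q : ℂ) ^ (((b : ℂ) - 2 * d) * a / 4))) * (shap q a d / shap q a d) *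
          (shap q b d / shap q b d) := by ring
      _ = _ := by rw [hs, div_self ha.ne', div_self hb.ne']; ring

theorem Occurs.casimir_eq (h : Occurs j₁ j₂ j) :
    (-((defect j₁ j₂ j : ℕ) * (j₁.twice + j₂.twice - 2 * (defect j₁ j₂ j : ℕ) + 2)) / 2 +
      ((j₁.twice - 2 * (defect j₁ j₂ j : ℕ)) * j₂.twice +
        (j₂.twice - 2 * (defect j₁ j₂ j : ℕ)) * j₁.twice) / 4 : ℝ) =
      casimir j - casimir j₁ - casimir j₂ := by
  have : (j.twice : ℝ) = j₁.twice + j₂.twice - 2 * (defect j₁ j₂ j : ℕ) := by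
    have : (j₁.twice : ℝ) + j₂.twice = j.twice + 2 * (defect j₁ j₂ j : ℕ) := by
      exact_mod_cast h.add_eq
    linarith
  simp only [casimir, this]
  ring

/-- The braiding maps the standard basis of `V^j` in `V^{j₁} ⊗ V^{j₂}` to a multiple of the
standard basis of `V^j` in `V^{j₂} ⊗ V^{j₁}`. -/
theorem braid_stdEmbedding (hq1 : q < 1) (h : Occurs j₁ j₂ j) (x : SpinSpace j) :
    braid (spinMod hq j₁) (spinMod hq j₂) (stdEmbedding hq j₁ j₂ j x) =
      ((-1) ^ defect j₁ j₂ j *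
        ((q ^ ((casimir j - casimir j₁ - casimir j₂) / 2) : ℝ) : ℂ)) •
        stdEmbedding hq j₂ j₁ j x := by
  have hbr := isIntertwining_braid hq hq1 (spinMod hq j₁) (spinMod hq j₂)
  have h1 := hbr.comp (isIntertwining_stdEmbedding hq hq1 h)
  have h2 := isIntertwining_stdEmbedding hq hq1 h.symm
  set d := defect j₁ j₂ j with hd
  set σ : ℂ := ((q ^ ((casimir j - casimir j₁ - casimir j₂) / 2) : ℝ) : ℂ) with hσ
  have hσ0 : 0 < σ := by
    rw [hσ]
    exact_mod_cast Real.rpow_pos_of_pos hq _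
  suffices hs : braid (spinMod hq j₁) (spinMod hq j₂) ∘ₗ stdEmbedding hq j₁ j₂ j =
      ((-1) ^ d * σ) • stdEmbedding hq j₂ j₁ j by
    simpa using LinearMap.congr_fun hs x
  refine spin_hom_ext hq h1 ⟨fun v => by simp [h2.1], fun v => by simp [h2.2.1],
    fun v => by simp [h2.2.2]⟩ ?_
  rw [LinearMap.comp_apply, LinearMap.smul_apply, stdEmbedding_top hq hq1 h,
    stdEmbedding_top hq hq1 h.symm, map_smul, braid_singVec hq hq1 h, smul_smul, smul_smul, ← hd]
  congr 1
  obtain ⟨ρ, hρ, hκ, hκκ⟩ := braidScalar_eq hq hq1 h.defect_le_left h.defect_le_right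
  rw [h.casimir_eq, ← hd] at hκκ
  have n1 : (0 : ℂ) < phiNorm hq j₁ j₂ j := by exact_mod_cast phiNorm_pos hq hq1 h
  have n2 : (0 : ℂ) < phiNorm hq j₂ j₁ j := by exact_mod_cast phiNorm_pos hq hq1 h.symm
  set n₁ : ℂ := (phiNorm hq j₁ j₂ j : ℂ)
  set n₂ : ℂ := (phiNorm hq j₂ j₁ j : ℂ)
  rw [← hd] at hκ
  -- Self-adjointness of the braiding relates the two scalars through the two norms. With the known
  -- product of the scalars, no explicit evaluation of the norms is needed.
  have hadj : braidScalar q j₁.twice j₂.twice d * (n₂ * n₂) =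
      braidScalar q j₂.twice j₁.twice d * (n₁ * n₁) := by
    have := (isContravariant_shapovalov hq (j := j₁)).braid hq
      (isContravariant_shapovalov hq (j := j₂)) (singVec hq j₁ j₂ j) (singVec hq j₂ j₁ j)
    rw [braid_singVec hq hq1 h, braid_singVec hq hq1 h.symm, map_smul, map_smul,
      LinearMap.smul_apply, defect_comm j₁ j₂ j, ← hd] at this
    rw [phiNorm_sq hq hq1 h, phiNorm_sq hq hq1 h.symm]
    exact this
  have hσσ : σ * σ = (q : ℂ) ^ ((casimir j - casimir j₁ - casimir j₂ : ℝ) : ℂ) := by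
    rw [hσ, ← Complex.ofReal_mul, ← Real.rpow_add hq, Complex.ofReal_cpow hq.le]
    congr 1; push_cast; ring
  set κ := braidScalar q j₁.twice j₂.twice d
  set κ' := braidScalar q j₂.twice j₁.twice d
  have hτ : 0 < n₁⁻¹ * ρ * n₂ := mul_pos (mul_pos (inv_pos.2 n1) hρ) n2
  have hs : (-1 : ℂ) ^ d * (-1) ^ d = 1 := by rw [← mul_pow]; simp
  -- The normalised scalar squares to the product of the scalars for the two orders, which is a
  -- power of q with Casimir exponent.
  have hsq : (n₁⁻¹ * ρ * n₂) ^ 2 = σ ^ 2 := by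
    have e1 : ρ * ρ = κ * κ := by rw [hκ]; linear_combination (-ρ * ρ) * hs
    have e2 : n₁⁻¹ * n₁ = 1 := inv_mul_cancel₀ n1.ne'
    calc (n₁⁻¹ * ρ * n₂) ^ 2 = n₁⁻¹ * n₁⁻¹ * (ρ * ρ) * (n₂ * n₂) := by ring
      _ = n₁⁻¹ * n₁⁻¹ * κ * (κ * (n₂ * n₂)) := by rw [e1]; ring
      _ = (n₁⁻¹ * n₁) * (n₁⁻¹ * n₁) * (κ * κ') := by rw [hadj]; ring
      _ = σ ^ 2 := by rw [e2, hκκ, ← hσσ]; ring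
  -- Both are positive, which selects the square root.
  have hτσ : n₁⁻¹ * ρ * n₂ = σ := by
    refine (sq_eq_sq_iff_eq_or_eq_neg.1 hsq).resolve_right fun hneg => ?_
    have := add_pos hτ hσ0
    exact this.ne' (by rw [hneg]; ring)
  rw [hκ, ← hτσ]
  have e3 : n₂ * n₂⁻¹ = 1 := mul_inv_cancel₀ n2.ne'
  linear_combination (-n₁⁻¹ * (-1) ^ d * ρ) * e3

end StdEmbedding

/-! ### Complete decomposition of V^{j₁} ⊗ V^{j₂}. -/

section Decomposition

variable {q : ℝ} (hq : 0 < q) {j₁ j₂ j : Spin}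

theorem eq_zero_of_shapovalov (hq : 0 < q) (hq1 : q < 1) {u : SpinSpace j}
    (h : ∀ y, shapovalov q j u y = 0) : u = 0 := by
  ext n
  have h3 := h (xVec hq j n)
  rw [(isContravariant_shapovalov hq).symm, shapovalov_xVec_left hq j n.2] at h3
  exact (mul_eq_zero.1 h3).resolve_left (shap_natCast_pos hq hq1 (Nat.lt_succ_iff.1 n.2)).ne'

/-- The adjoint of a linear map defined on an irreducible module. -/
def spinAdjoint (q : ℝ) {V : Type*} [AddCommGroup V] [Module ℂ V] (B : LinearMap.BilinForm ℂ V)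
    (T : SpinSpace j →ₗ[ℂ] V) : V →ₗ[ℂ] SpinSpace j :=
  ∑ k : Fin (j.twice + 1), (shap q j.twice k)⁻¹ •
    (B (T (Finsupp.single k 1))).smulRight (Finsupp.single k 1)

theorem shapovalov_spinAdjoint (hq : 0 < q) (hq1 : q < 1) {V : Type*} [AddCommGroup V] [Module ℂ V]
    {B : LinearMap.BilinForm ℂ V} {T : SpinSpace j →ₗ[ℂ] V} (u : V) (y : SpinSpace j) :
    shapovalov q j (spinAdjoint q B T u) y = B (T y) u := by
  suffices h : shapovalov q j (spinAdjoint q B T u) = B.flip u ∘ₗ T by rw [h]; rfl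
  refine LinearMap.ext_on (span_single_one _) ?_
  rintro _ ⟨k, rfl⟩
  have hk := (shap_natCast_pos hq hq1 (Nat.lt_succ_iff.1 k.2)).ne'
  have h1 : spinAdjoint q B T u k = (shap q j.twice k)⁻¹ * B (T (Finsupp.single k 1)) u := by
    rw [spinAdjoint, LinearMap.sum_apply, Finsupp.finsetSum_apply, Finset.sum_eq_single k]
    · simp
    · intro i _ hi
      simp [hi]
    · simp
  have h2 := shapovalov_xVec_left hq j k.2 (spinAdjoint q B T u)
  rw [xVec_eq_single hq j k.2] at h2
  rw [(isContravariant_shapovalov hq).symm]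
  show shapovalov q j (Finsupp.single k 1) (spinAdjoint q B T u) = B (T (Finsupp.single k 1)) u
  refine h2.trans ?_
  show shap q j.twice k * spinAdjoint q B T u k = _
  rw [h1, mul_inv_cancel_left₀ hk]

/-- Contravariance on both sides exchanges e and f twice, so adjoints of intertwining maps
intertwine. -/
theorem isIntertwining_spinAdjoint (hq1 : q < 1) {V : Type*} [AddCommGroup V] [Module ℂ V]
    {N : UqModule q V} {B : LinearMap.BilinForm ℂ V} (hB : N.IsContravariant B)
    {T : SpinSpace j →ₗ[ℂ] V} (hT : (spinMod hq j).IsIntertwining N T) :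
    N.IsIntertwining (spinMod hq j) (spinAdjoint q B T) := by
  have hS := isContravariant_shapovalov hq (j := j)
  refine ⟨fun u => ?_, fun u => ?_, fun u => ?_⟩ <;> rw [← sub_eq_zero] <;>
    refine eq_zero_of_shapovalov hq hq1 fun y => ?_ <;>
    rw [map_sub, LinearMap.sub_apply, sub_eq_zero, shapovalov_spinAdjoint hq hq1]
  · rw [hS.h, shapovalov_spinAdjoint hq hq1, hT.1, hB.h]
  · rw [hS.e, shapovalov_spinAdjoint hq hq1, hT.2.2, hB.f]
  · rw [hS.f, shapovalov_spinAdjoint hq hq1, hT.2.1, hB.e]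

open Classical in
/-- The (doubled) spins which occur in a tensor product. -/
def occurring (j₁ j₂ : Spin) : Finset ℕ :=
  (Finset.range (j₁.twice + j₂.twice + 1)).filter fun t => Occurs j₁ j₂ ⟨t⟩

theorem mem_occurring {t : ℕ} : t ∈ occurring j₁ j₂ ↔ Occurs j₁ j₂ ⟨t⟩ := by
  classical
  rw [occurring, Finset.mem_filter, and_iff_right_iff_imp]
  intro h
  have := h.add_eq
  simp only at this
  rw [Finset.mem_range]
  omega

theorem sum_occurring_of_le (h : j₂.twice ≤ j₁.twice) :
    ∑ t ∈ occurring j₁ j₂, (t + 1) = (j₁.twice + 1) * (j₂.twice + 1) := by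
  have h1 : ∑ t ∈ occurring j₁ j₂, (t + 1) =
      ∑ d ∈ Finset.range (j₂.twice + 1), (j₁.twice + j₂.twice - 2 * d + 1) := by
    -- The occurring spins are indexed by their defect d, which runs from 0 to 2j₂.
    refine Finset.sum_nbij' (fun t => (j₁.twice + j₂.twice - t) / 2)
      (fun d => j₁.twice + j₂.twice - 2 * d) ?_ ?_ ?_ ?_ ?_
    · intro t ht
      obtain ⟨a1, a2, k, hk⟩ := occurs_iff.1 (mem_occurring.1 ht)
      simp only at a1 a2 hk
      rw [Finset.mem_range]; omega
    · intro d hd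
      rw [Finset.mem_range] at hd
      rw [mem_occurring, occurs_iff]
      exact ⟨by simp only; omega, by simp only; omega, d, by simp only; omega⟩
    · intro t ht
      obtain ⟨a1, a2, k, hk⟩ := occurs_iff.1 (mem_occurring.1 ht)
      simp only at a1 a2 hk
      omega
    · intro d hd
      rw [Finset.mem_range] at hd
      omega
    · intro t ht
      obtain ⟨a1, a2, k, hk⟩ := occurs_iff.1 (mem_occurring.1 ht)
      simp only at a1 a2 hk
      omega
  -- The partial sum is n(2j₁ + 2j₂ + 2) - n²; the square stands on the left to avoid subtraction in
  -- ℕ.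
  have h2 : ∀ n ≤ j₂.twice + 1, ∑ d ∈ Finset.range n, (j₁.twice + j₂.twice - 2 * d + 1) + n * n =
      n * (j₁.twice + j₂.twice + 2) := by
    intro n
    induction n with
    | zero => simp
    | succ n ih =>
      intro hn
      have := ih (by omega)
      rw [Finset.sum_range_succ]
      obtain ⟨c, hc⟩ : ∃ c, j₁.twice + j₂.twice = 2 * n + c := ⟨j₁.twice + j₂.twice - 2 * n, by omega⟩
      rw [hc] at this ⊢
      rw [Nat.add_sub_cancel_left]
      nlinarith
  have h3 := h2 _ le_rfl
  rw [h1]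
  nlinarith

theorem sum_occurring : ∑ t ∈ occurring j₁ j₂, (t + 1) = (j₁.twice + 1) * (j₂.twice + 1) := by
  rcases le_total j₂.twice j₁.twice with h | h
  · exact sum_occurring_of_le h
  · have : occurring j₁ j₂ = occurring j₂ j₁ := by
      ext t
      rw [mem_occurring, mem_occurring]
      exact ⟨Occurs.symm, Occurs.symm⟩
    rw [this, sum_occurring_of_le h, mul_comm]

theorem form_stdEmbedding_single (hq1 : q < 1) {t t' : Spin} (ht : Occurs j₁ j₂ t)
    (ht' : Occurs j₁ j₂ t') (k : Fin (t.twice + 1)) (k' : Fin (t'.twice + 1))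
    (hne : (⟨t, k⟩ : Σ t : Spin, Fin (t.twice + 1)) ≠ ⟨t', k'⟩) :
    shapovalov₂ q j₁ j₂ (stdEmbedding hq j₁ j₂ t (Finsupp.single k 1))
      (stdEmbedding hq j₁ j₂ t' (Finsupp.single k' 1)) = 0 := by
  rcases eq_or_ne t t' with rfl | htt
  · rw [shapovalov₂_stdEmbedding hq hq1 ht]
    have hk : (k : ℕ) ≠ k' := fun h => hne (by rw [Fin.ext h])
    have := shapovalov_xVec hq t k k'
    rw [xVec_eq_single hq t k.2, xVec_eq_single hq t k'.2, if_neg hk] at this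
    exact this
  · exact form_spin_hom_ne hq (isContravariant_shapovalov₂ hq)
      (isIntertwining_stdEmbedding hq hq1 ht) (isIntertwining_stdEmbedding hq hq1 ht') htt _ _

theorem form_stdEmbedding_single_self (hq1 : q < 1) {t : Spin} (ht : Occurs j₁ j₂ t)
    (k : Fin (t.twice + 1)) :
    shapovalov₂ q j₁ j₂ (stdEmbedding hq j₁ j₂ t (Finsupp.single k 1))
      (stdEmbedding hq j₁ j₂ t (Finsupp.single k 1)) ≠ 0 := by
  rw [shapovalov₂_stdEmbedding hq hq1 ht]
  have := shapovalov_xVec hq t k k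
  rw [xVec_eq_single hq t k.2, if_pos rfl] at this
  exact this.trans_ne (shap_natCast_pos hq hq1 (Nat.lt_succ_iff.1 k.2)).ne'

theorem linearIndependent_of_form {V ι : Type*} [AddCommGroup V] [Module ℂ V]
    (B : LinearMap.BilinForm ℂ V) (v : ι → V) (h : ∀ i k, i ≠ k → B (v i) (v k) = 0)
    (h' : ∀ i, B (v i) (v i) ≠ 0) : LinearIndependent ℂ v :=
  LinearMap.linearIndependent_of_isOrthoᵢ (B := B) (fun i k hik => h i k hik) h'

/-- The tensor product of two irreducible modules is spanned by the standard bases of its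
irreducible submodules. -/
theorem span_stdEmbedding (hq1 : q < 1) :
    Submodule.span ℂ (Set.range fun p : Σ t : occurring j₁ j₂, Fin ((⟨t⟩ : Spin).twice + 1) =>
      stdEmbedding hq j₁ j₂ ⟨p.1⟩ (Finsupp.single p.2 1)) = ⊤ := by
  have hind := linearIndependent_of_form (shapovalov₂ q j₁ j₂)
    (fun p : Σ t : occurring j₁ j₂, Fin ((⟨t⟩ : Spin).twice + 1) =>
      stdEmbedding hq j₁ j₂ ⟨p.1⟩ (Finsupp.single p.2 1))
    (fun p p' hne => form_stdEmbedding_single hq hq1 (mem_occurring.1 p.1.2)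
      (mem_occurring.1 p'.1.2) p.2 p'.2 fun h => hne (by
        obtain ⟨⟨t, ht⟩, k⟩ := p
        obtain ⟨⟨t', ht'⟩, k'⟩ := p'
        simp only [Sigma.mk.injEq, Spin.mk.injEq] at h
        obtain ⟨rfl, h⟩ := h
        rw [eq_of_heq h]))
    (fun p => form_stdEmbedding_single_self hq hq1 (mem_occurring.1 p.1.2) p.2)
  -- An orthogonal family of non-isotropic vectors is independent, and its size equals the dimension
  -- of the tensor product by `sum_occurring`.
  refine hind.span_eq_top_of_card_eq_finrank' ?_
  rw [Fintype.card_sigma]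
  simp only [Fintype.card_fin, Module.finrank_tensorProduct, Module.finrank_finsupp_self]
  rw [Finset.sum_coe_sort (occurring j₁ j₂) (fun t => t + 1), sum_occurring]

/-- The projection of a tensor product of irreducible modules onto an irreducible submodule. -/
def stdProjection (j₁ j₂ j : Spin) : SpinSpace j₁ ⊗[ℂ] SpinSpace j₂ →ₗ[ℂ] SpinSpace j :=
  spinAdjoint q (V := SpinSpace j₁ ⊗[ℂ] SpinSpace j₂) (shapovalov₂ q j₁ j₂) (stdEmbedding hq j₁ j₂ j)

theorem shapovalov_stdProjection (hq1 : q < 1) (u : SpinSpace j₁ ⊗[ℂ] SpinSpace j₂)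
    (y : SpinSpace j) : shapovalov q j (stdProjection hq j₁ j₂ j u) y =
      shapovalov₂ q j₁ j₂ (stdEmbedding hq j₁ j₂ j y) u :=
  shapovalov_spinAdjoint hq hq1 u y

theorem isIntertwining_stdProjection (hq1 : q < 1) (h : Occurs j₁ j₂ j) :
    ((spinMod hq j₁).tensor hq (spinMod hq j₂)).IsIntertwining (spinMod hq j)
      (stdProjection hq j₁ j₂ j) :=
  isIntertwining_spinAdjoint hq hq1 (isContravariant_shapovalov₂ hq)
    (isIntertwining_stdEmbedding hq hq1 h)

theorem stdProjection_stdEmbedding (hq1 : q < 1) (h : Occurs j₁ j₂ j) (x : SpinSpace j) :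
    stdProjection hq j₁ j₂ j (stdEmbedding hq j₁ j₂ j x) = x := by
  rw [← sub_eq_zero]
  refine eq_zero_of_shapovalov hq hq1 fun y => ?_
  rw [map_sub, LinearMap.sub_apply, shapovalov_stdProjection hq hq1,
      shapovalov₂_stdEmbedding hq hq1 h, (isContravariant_shapovalov hq).symm, sub_self]

theorem stdProjection_stdEmbedding_ne (hq1 : q < 1) {j' : Spin} (h : Occurs j₁ j₂ j)
    (h' : Occurs j₁ j₂ j') (hne : j ≠ j') (x : SpinSpace j') :
    stdProjection hq j₁ j₂ j (stdEmbedding hq j₁ j₂ j' x) = 0 := by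
  refine eq_zero_of_shapovalov hq hq1 fun y => ?_
  rw [shapovalov_stdProjection hq hq1]
  exact form_spin_hom_ne hq (isContravariant_shapovalov₂ hq)
      (isIntertwining_stdEmbedding hq hq1 h) (isIntertwining_stdEmbedding hq hq1 h') hne _ _

theorem sum_stdEmbedding_stdProjection (hq1 : q < 1) :
    ∑ t ∈ occurring j₁ j₂, stdEmbedding hq j₁ j₂ ⟨t⟩ ∘ₗ stdProjection hq j₁ j₂ ⟨t⟩ =
      LinearMap.id := by
  refine LinearMap.ext_on (span_stdEmbedding hq hq1) ?_
  rintro _ ⟨⟨t, k⟩, rfl⟩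
  have ht := mem_occurring.1 t.2
  rw [LinearMap.sum_apply, LinearMap.id_apply, Finset.sum_eq_single (t : ℕ)]
  · rw [LinearMap.comp_apply, stdProjection_stdEmbedding hq hq1 ht]
  · intro t' ht' hne
    rw [LinearMap.comp_apply, stdProjection_stdEmbedding_ne hq hq1 (mem_occurring.1 ht') ht
      (fun h => hne (congrArg Spin.twice h)), map_zero]
  · intro h
    exact absurd t.2 h

end Decomposition

/-! ### q-Racah coefficients as inner products. -/

section Racah

variable {q : ℝ} (hq : 0 < q) {j₁ j₂ j₃ j j₁₂ j₂₃ : Spin}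

/-- The Shapovalov form on `V^{j₁} ⊗ (V^{j₂} ⊗ V^{j₃})`. -/
def shapovalov₃ (q : ℝ) (j₁ j₂ j₃ : Spin) :
    LinearMap.BilinForm ℂ (SpinSpace j₁ ⊗[ℂ] (SpinSpace j₂ ⊗[ℂ] SpinSpace j₃)) :=
  (shapovalov q j₁).tmul (shapovalov₂ q j₂ j₃)

/-- The embedding of `V^j` in `V^{j₁} ⊗ V^{j₂₃}` in `V^{j₁} ⊗ (V^{j₂} ⊗ V^{j₃})`. -/
def rightEmbedding (j₁ j₂ j₃ j j₂₃ : Spin) :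
    SpinSpace j →ₗ[ℂ] SpinSpace j₁ ⊗[ℂ] (SpinSpace j₂ ⊗[ℂ] SpinSpace j₃) :=
  (stdEmbedding hq j₂ j₃ j₂₃).lTensor (SpinSpace j₁) ∘ₗ stdEmbedding hq j₁ j₂₃ j

/-- The embedding of `V^j` in `V^{j₁₂} ⊗ V^{j₃}` in `V^{j₁} ⊗ (V^{j₂} ⊗ V^{j₃})`. -/
def leftEmbedding (j₁ j₂ j₃ j j₁₂ : Spin) :
    SpinSpace j →ₗ[ℂ] SpinSpace j₁ ⊗[ℂ] (SpinSpace j₂ ⊗[ℂ] SpinSpace j₃) :=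
  (TensorProduct.assoc ℂ _ _ _).toLinearMap ∘ₗ
    (stdEmbedding hq j₁ j₂ j₁₂).rTensor (SpinSpace j₃) ∘ₗ stdEmbedding hq j₁₂ j₃ j

theorem isIntertwining_rightEmbedding (hq1 : q < 1) (h23 : Occurs j₂ j₃ j₂₃)
    (h : Occurs j₁ j₂₃ j) : (spinMod hq j).IsIntertwining ((spinMod hq j₁).tensor hq
      ((spinMod hq j₂).tensor hq (spinMod hq j₃))) (rightEmbedding hq j₁ j₂ j₃ j j₂₃) :=
  ((isIntertwining_stdEmbedding hq hq1 h23).lTensor hq _).comp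
    (isIntertwining_stdEmbedding hq hq1 h)

theorem isIntertwining_assoc_rTensor {U V V' V₁₂ V₃ : Type*} [AddCommGroup U] [Module ℂ U]
    [AddCommGroup V] [Module ℂ V] [AddCommGroup V'] [Module ℂ V'] [AddCommGroup V₁₂] [Module ℂ V₁₂]
    [AddCommGroup V₃] [Module ℂ V₃] {L : UqModule q U} {M : UqModule q V} {M' : UqModule q V'}
    {M₁₂ : UqModule q V₁₂} {M₃ : UqModule q V₃} {S : V₁₂ →ₗ[ℂ] V ⊗[ℂ] V'}
    {T : U →ₗ[ℂ] V₁₂ ⊗[ℂ] V₃} (hS : M₁₂.IsIntertwining (M.tensor hq M') S)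
    (hT : L.IsIntertwining (M₁₂.tensor hq M₃) T) :
    L.IsIntertwining (M.tensor hq (M'.tensor hq M₃))
      ((TensorProduct.assoc ℂ V V' V₃).toLinearMap ∘ₗ S.rTensor V₃ ∘ₗ T) :=
  (isIntertwining_assoc hq M M' M₃).comp ((hS.rTensor hq M₃).comp hT)

theorem isIntertwining_leftEmbedding (hq1 : q < 1) (h12 : Occurs j₁ j₂ j₁₂)
    (h : Occurs j₁₂ j₃ j) : (spinMod hq j).IsIntertwining ((spinMod hq j₁).tensor hq
      ((spinMod hq j₂).tensor hq (spinMod hq j₃))) (leftEmbedding hq j₁ j₂ j₃ j j₁₂) :=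
  isIntertwining_assoc_rTensor hq (isIntertwining_stdEmbedding hq hq1 h12)
    (isIntertwining_stdEmbedding hq hq1 h)

theorem tmul_form_lTensor {V W W' X : Type*} [AddCommMonoid V] [Module ℂ V] [AddCommMonoid W]
    [Module ℂ W] [AddCommMonoid W'] [Module ℂ W'] [AddCommMonoid X] [Module ℂ X]
    (B : LinearMap.BilinForm ℂ V) (C : LinearMap.BilinForm ℂ X) (S : W →ₗ[ℂ] X) (T : W' →ₗ[ℂ] X)
    (h : ∀ w w', C (S w) (T w') = 0) (z : V ⊗[ℂ] W) (z' : V ⊗[ℂ] W') :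
    B.tmul C (S.lTensor V z) (T.lTensor V z') = 0 := by
  induction z using TensorProduct.induction_on with
  | zero => simp
  | add x y hx hy => simp only [map_add, LinearMap.add_apply, hx, hy, add_zero]
  | tmul v w =>
    induction z' using TensorProduct.induction_on with
    | zero => simp
    | add x y hx hy => simp only [map_add, hx, hy, add_zero]
    | tmul v' w' =>
      rw [LinearMap.lTensor_tmul, LinearMap.lTensor_tmul,
        LinearMap.BilinForm.tensorDistrib_tmul, h, zero_smul]

theorem tmul_form_lTensor_isometry {V W X : Type*} [AddCommMonoid V] [Module ℂ V] [AddCommMonoid W]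
    [Module ℂ W] [AddCommMonoid X] [Module ℂ X]
    (B : LinearMap.BilinForm ℂ V) (C : LinearMap.BilinForm ℂ X) (D : LinearMap.BilinForm ℂ W)
    (S : W →ₗ[ℂ] X) (h : ∀ w w', C (S w) (S w') = D w w') (z z' : V ⊗[ℂ] W) :
    B.tmul C (S.lTensor V z) (S.lTensor V z') = B.tmul D z z' := by
  induction z using TensorProduct.induction_on with
  | zero => simp
  | add x y hx hy => simp only [map_add, LinearMap.add_apply, hx, hy]
  | tmul v w =>
    induction z' using TensorProduct.induction_on with
    | zero => simp
    | add x y hx hy => simp only [map_add, hx, hy]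
    | tmul v' w' =>
      rw [LinearMap.lTensor_tmul, LinearMap.lTensor_tmul,
        LinearMap.BilinForm.tensorDistrib_tmul, LinearMap.BilinForm.tensorDistrib_tmul, h]

theorem shapovalov₃_rightEmbedding (hq1 : q < 1) (h23 : Occurs j₂ j₃ j₂₃)
    (h : Occurs j₁ j₂₃ j) (x y : SpinSpace j) :
    shapovalov₃ q j₁ j₂ j₃ (rightEmbedding hq j₁ j₂ j₃ j j₂₃ x)
      (rightEmbedding hq j₁ j₂ j₃ j j₂₃ y) = shapovalov q j x y := by
  rw [← shapovalov₂_stdEmbedding hq hq1 h, shapovalov₃, rightEmbedding, LinearMap.comp_apply,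
    LinearMap.comp_apply]
  exact tmul_form_lTensor_isometry (shapovalov q j₁) (shapovalov₂ q j₂ j₃) (shapovalov q j₂₃)
    (stdEmbedding hq j₂ j₃ j₂₃) (shapovalov₂_stdEmbedding hq hq1 h23) _ _

theorem shapovalov₃_rightEmbedding_ne (hq1 : q < 1) {j₂₃' : Spin} (h23 : Occurs j₂ j₃ j₂₃)
    (h23' : Occurs j₂ j₃ j₂₃') (hne : j₂₃ ≠ j₂₃') (x y : SpinSpace j) :
    shapovalov₃ q j₁ j₂ j₃ (rightEmbedding hq j₁ j₂ j₃ j j₂₃ x)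
      (rightEmbedding hq j₁ j₂ j₃ j j₂₃' y) = 0 := by
  rw [shapovalov₃, rightEmbedding, rightEmbedding, LinearMap.comp_apply, LinearMap.comp_apply]
  exact tmul_form_lTensor (shapovalov q j₁) (shapovalov₂ q j₂ j₃) (stdEmbedding hq j₂ j₃ j₂₃)
    (stdEmbedding hq j₂ j₃ j₂₃') (form_spin_hom_ne hq (isContravariant_shapovalov₂ hq)
    (isIntertwining_stdEmbedding hq hq1 h23) (isIntertwining_stdEmbedding hq hq1 h23') hne) _ _

open Classical in
/-- Singular vectors in a threefold tensor product are combinations of those that come from the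
irreducible submodules of the last two factors. -/
theorem exists_sum_rightEmbedding (hq1 : q < 1)
    {z : SpinSpace j₁ ⊗[ℂ] (SpinSpace j₂ ⊗[ℂ] SpinSpace j₃)}
    (hz : ((spinMod hq j₁).tensor hq ((spinMod hq j₂).tensor hq (spinMod hq j₃))).h z =
      (j.twice : ℂ) • z)
    (hez : ((spinMod hq j₁).tensor hq ((spinMod hq j₂).tensor hq (spinMod hq j₃))).e z = 0) :
    ∃ w : Spin → ℂ, z = ∑ t ∈ (Finset.range (j₂.twice + j₃.twice + 1)).filter
        (fun t => Occurs j₂ j₃ ⟨t⟩ ∧ Occurs j₁ ⟨t⟩ j),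
      w ⟨t⟩ • rightEmbedding hq j₁ j₂ j₃ j ⟨t⟩ (finTop j.twice) := by
  set A := fun t : ℕ => stdProjection hq j₂ j₃ ⟨t⟩ with hA
  -- The identity on the last two factors is resolved into the projections on irreducible
  -- submodules.
  have hsum : z = ∑ t ∈ occurring j₂ j₃, (stdEmbedding hq j₂ j₃ ⟨t⟩).lTensor (SpinSpace j₁)
      ((A t).lTensor (SpinSpace j₁) z) := by
    have h2 := congrArg (fun T => LinearMap.lTensorHom (SpinSpace j₁) T z)
      (sum_stdEmbedding_stdProjection hq hq1 (j₁ := j₂) (j₂ := j₃))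
    simp only [map_sum, LinearMap.coe_lTensorHom, LinearMap.lTensor_id, LinearMap.id_apply,
      LinearMap.sum_apply, LinearMap.lTensor_comp, LinearMap.comp_apply] at h2
    exact h2.symm
  -- Each component is a singular vector in a twofold tensor product: a multiple of the standard
  -- one, or zero if V^j does not occur.
  have hA' : ∀ t ∈ occurring j₂ j₃, ∃ c : ℂ, (A t).lTensor (SpinSpace j₁) z =
      if Occurs j₁ ⟨t⟩ j then c • stdEmbedding hq j₁ ⟨t⟩ j (finTop j.twice) else 0 := by
    intro t ht
    have hAt := isIntertwining_stdProjection hq hq1 (mem_occurring.1 ht)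
    have hAt' := hAt.lTensor hq (spinMod hq j₁)
    have w1 := hAt'.weight hz
    have w2 : ((spinMod hq j₁).tensor hq (spinMod hq ⟨t⟩)).e ((A t).lTensor (SpinSpace j₁) z) = 0 := by
      rw [hA, ← hAt'.2.1, hez, map_zero]
    by_cases ho : Occurs j₁ ⟨t⟩ j
    · obtain ⟨c, hc, -⟩ := exists_smul_singVec hq hq1 ho w1 w2
      refine ⟨c * phiNorm hq j₁ ⟨t⟩ j, ?_⟩
      have hpos : (phiNorm hq j₁ ⟨t⟩ j : ℂ) ≠ 0 := by
        exact_mod_cast (phiNorm_pos hq hq1 ho).ne'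
      rw [if_pos ho, stdEmbedding_top hq hq1 ho, smul_smul, mul_inv_cancel_right₀ hpos, ← hc]
    · refine ⟨0, ?_⟩
      rw [if_neg ho]
      by_contra hne
      exact ho (occurs_of_singular hq hq1 w1 w2 hne)
  choose! c hc using hA'
  refine ⟨fun s => c s.twice, ?_⟩
  rw [← Finset.filter_filter]
  show z = ∑ t ∈ (occurring j₂ j₃).filter (fun t => Occurs j₁ ⟨t⟩ j), _
  rw [Finset.sum_filter]
  refine hsum.trans (Finset.sum_congr rfl fun t ht => ?_)
  rw [hc t ht]
  split_ifs
  · rw [map_smul]; rfl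
  · rw [map_zero]

/-- The expansion of the singular vector, once known at the highest weight, propagates along f; so
the same coefficients serve for every m. -/
theorem exists_isRacah (hq1 : q < 1) (h12 : Occurs j₁ j₂ j₁₂) (h : Occurs j₁₂ j₃ j) :
    ∃ w, IsRacah hq j₁ j₂ j₃ j j₁₂ w := by
  classical
  have hL := isIntertwining_leftEmbedding hq hq1 h12 h
  obtain ⟨w, hw⟩ := exists_sum_rightEmbedding hq hq1 (hL.weight (spin_h_top hq j))
    (by rw [← hL.2.1, spin_e_top, map_zero])
  refine ⟨w, fun k _ => ?_⟩
  have hS : leftEmbedding hq j₁ j₂ j₃ j j₁₂ =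
      ∑ t ∈ (Finset.range (j₂.twice + j₃.twice + 1)).filter
        (fun t => Occurs j₂ j₃ ⟨t⟩ ∧ Occurs j₁ ⟨t⟩ j), w ⟨t⟩ • rightEmbedding hq j₁ j₂ j₃ j ⟨t⟩ := by
    have hR : ∀ t ∈ (Finset.range (j₂.twice + j₃.twice + 1)).filter
        (fun t => Occurs j₂ j₃ ⟨t⟩ ∧ Occurs j₁ ⟨t⟩ j), (spinMod hq j).IsIntertwining
        ((spinMod hq j₁).tensor hq ((spinMod hq j₂).tensor hq (spinMod hq j₃)))
        (rightEmbedding hq j₁ j₂ j₃ j ⟨t⟩) := fun t ht =>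
      isIntertwining_rightEmbedding hq hq1 (Finset.mem_filter.1 ht).2.1 (Finset.mem_filter.1 ht).2.2
    refine spin_hom_ext hq hL ⟨fun v => ?_, fun v => ?_, fun v => ?_⟩ ?_
    · simp only [LinearMap.sum_apply, LinearMap.smul_apply, map_sum, map_smul]
      exact Finset.sum_congr rfl fun t ht => by rw [(hR t ht).1]
    · simp only [LinearMap.sum_apply, LinearMap.smul_apply, map_sum, map_smul]
      exact Finset.sum_congr rfl fun t ht => by rw [(hR t ht).2.1]
    · simp only [LinearMap.sum_apply, LinearMap.smul_apply, map_sum, map_smul]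
      exact Finset.sum_congr rfl fun t ht => by rw [(hR t ht).2.2]
    · simpa only [LinearMap.sum_apply, LinearMap.smul_apply] using hw
  have := LinearMap.congr_fun hS (stdVec hq j k)
  simp only [LinearMap.sum_apply, LinearMap.smul_apply] at this
  exact this

/-- The `q`-Racah coefficients are the inner products of the two kinds of basis vectors. -/
theorem qRacah_eq (hq1 : q < 1) (h12 : Occurs j₁ j₂ j₁₂) (h : Occurs j₁₂ j₃ j)
    (h23 : Occurs j₂ j₃ j₂₃) (h' : Occurs j₁ j₂₃ j) :
    qRacah hq j₁ j₂ j₃ j j₁₂ j₂₃ = shapovalov₃ q j₁ j₂ j₃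
      (leftEmbedding hq j₁ j₂ j₃ j j₁₂ (finTop j.twice))
      (rightEmbedding hq j₁ j₂ j₃ j j₂₃ (finTop j.twice)) := by
  classical
  have hex := exists_isRacah hq hq1 h12 h
  rw [qRacah, dif_pos hex]
  -- The chosen coefficients are arbitrary off the summation range, but orthonormality of the
  -- right-hand basis fixes those on it. The case m = j suffices.
  have hw := hex.choose_spec 0 (Nat.zero_le _)
  set w := hex.choose
  have h1 : leftEmbedding hq j₁ j₂ j₃ j j₁₂ (finTop j.twice) = leftVec hq j₁ j₂ j₃ j j₁₂ 0 := by
    rw [leftVec, stdVec_zero]; rfl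
  have h2 : ∀ t, rightVec hq j₁ j₂ j₃ j t 0 = rightEmbedding hq j₁ j₂ j₃ j t (finTop j.twice) := by
    intro t; rw [rightVec, stdVec_zero]; rfl
  rw [h1, hw, map_sum, LinearMap.sum_apply, Finset.sum_eq_single j₂₃.twice]
  · rw [map_smul, LinearMap.smul_apply, h2]
    erw [shapovalov₃_rightEmbedding hq hq1 h23 h', shapovalov_top_top]
    rw [smul_eq_mul, mul_one]
  · intro t ht hne
    rw [map_smul, LinearMap.smul_apply, h2, shapovalov₃_rightEmbedding_ne hq hq1
      (Finset.mem_filter.1 ht).2.1 h23 (fun h => hne (congrArg Spin.twice h)), smul_zero]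
  · intro hn
    refine absurd (Finset.mem_filter.2 ⟨?_, h23, h'⟩) hn
    have := h23.add_eq
    rw [Finset.mem_range]
    omega

end Racah

/-! ### Composite singular vectors in threefold tensor products. -/

section CompositeVector

variable {q : ℝ} {U V W : Type*} [AddCommGroup U] [Module ℂ U] [AddCommGroup V] [Module ℂ V]
  [AddCommGroup W] [Module ℂ W]

theorem tmul_form_assoc (B : LinearMap.BilinForm ℂ U) (C : LinearMap.BilinForm ℂ V)
    (D : LinearMap.BilinForm ℂ W) (z z' : (U ⊗[ℂ] V) ⊗[ℂ] W) :
    B.tmul (C.tmul D) (TensorProduct.assoc ℂ U V W z) (TensorProduct.assoc ℂ U V W z') =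
      LinearMap.BilinForm.tmul (B.tmul C) D z z' := by
  suffices h : (B.tmul (C.tmul D)).compl₁₂ (TensorProduct.assoc ℂ U V W).toLinearMap
      (TensorProduct.assoc ℂ U V W).toLinearMap = LinearMap.BilinForm.tmul (B.tmul C) D from
    LinearMap.congr_fun (LinearMap.congr_fun h z) z'
  refine TensorProduct.ext_threefold fun u v w => ?_
  refine TensorProduct.ext_threefold fun u' v' w' => ?_
  simp only [LinearMap.compl₁₂_apply, LinearEquiv.coe_coe, TensorProduct.assoc_tmul,
    tmul_form_apply, mul_assoc]

/-- The vector attached to a highest weight vector `x` and two vectors `v`, `w`, i.e. the image of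
the highest weight vector under a composition of two intertwining maps. -/
def compTop (hq : 0 < q) (M : UqModule q U) (x : U) (a : ℂ) (A : UqModule q V) (v : V) (α : ℂ)
    (m : ℕ) (B : UqModule q W) (w : W) (β : ℂ) (n : ℕ) : U ⊗[ℂ] (V ⊗[ℂ] W) :=
  TensorProduct.assoc ℂ U V W
    (phiTop (M.tensor hq A) (phiTop M x a A v α m) (a + α) B w β n)

variable (hq : 0 < q) {M : UqModule q U} {x : U} {a : ℂ} {A : UqModule q V} {v : V} {α : ℂ} {m : ℕ}
  {B : UqModule q W} {w : W} {β : ℂ} {n : ℕ}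

theorem compTop_e (hx : M.h x = a • x) (hex : M.e x = 0) (hv : A.h v = α • v)
    (hw : B.h w = β • w) (hm : (A.e ^ (m + 1)) v = 0) (hn : (B.e ^ (n + 1)) w = 0)
    (ha : shap q a m ≠ 0) (haα : shap q (a + α) n ≠ 0) :
    (M.tensor hq (A.tensor hq B)).e (compTop hq M x a A v α m B w β n) = 0 := by
  have hassoc := (isIntertwining_assoc hq M A B).2.1
    (phiTop (M.tensor hq A) (phiTop M x a A v α m) (a + α) B w β n)
  rw [phiTop_e hq (phiTop_weight hq hx hv m) (phiTop_e hq hx hex hv hm ha) hw hn haα,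
    map_zero] at hassoc
  exact hassoc.symm

/-- The value of the fusion matrix on a tensor product of two weight vectors. -/
def fusionVec (q : ℝ) (a : ℂ) (A : UqModule q V) (v : V) (α : ℂ) (B : UqModule q W) (w : W) (β : ℂ)
    (n : ℕ) : V ⊗[ℂ] W :=
  ∑ k ∈ Finset.range (n + 1), (phiCoeff q (a + α) β k * (q : ℂ) ^ (-(k * a) / 4)) •
    ((A.f ^ k) v ⊗ₜ[ℂ] (B.e ^ k) w)

/-- Against a highest weight vector of weight a, Δ(f)^k reduces to q^{-ka/4} f^k on the remaining
factor, and the inner vector contracts to v. This is the origin of the powers of q in `fusionVec`.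
-/
theorem slice_compTop {C : LinearMap.BilinForm ℂ U} (hC : M.IsContravariant C)
    (hx : M.h x = a • x) (hex : M.e x = 0) (hxx : C x x = 1) :
    slice (V ⊗[ℂ] W) (C x) (compTop hq M x a A v α m B w β n) =
      fusionVec q a A v α B w β n := by
  rw [compTop, slice_assoc, phiTop, map_sum, fusionVec]
  refine Finset.sum_congr rfl fun k _ => ?_
  rw [map_smul, LinearMap.rTensor_tmul, slice_f_pow hq hC hx hex, slice_phiTop_self hC hex hxx,
    mul_smul, ← TensorProduct.smul_tmul']

theorem compTop_natural {U' V' W' : Type*} [AddCommGroup U'] [Module ℂ U'] [AddCommGroup V']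
    [Module ℂ V'] [AddCommGroup W'] [Module ℂ W'] {M' : UqModule q U'} {A' : UqModule q V'}
    {B' : UqModule q W'} {R : U →ₗ[ℂ] U'} {S : V →ₗ[ℂ] V'} {T : W →ₗ[ℂ] W'}
    (hR : M.IsIntertwining M' R) (hS : A.IsIntertwining A' S) (hT : B.IsIntertwining B' T) :
    TensorProduct.map R (TensorProduct.map S T) (compTop hq M x a A v α m B w β n) =
      compTop hq M' (R x) a A' (S v) α m B' (T w) β n := by
  have h1 := phiTop_natural (x := phiTop M x a A v α m) (a := a + α) (v := w) (ν := β)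
    (hR.map hq hS) hT n
  rw [phiTop_natural hR hS] at h1
  rw [compTop, compTop, ← h1]
  generalize phiTop (M.tensor hq A) (phiTop M x a A v α m) (a + α) B w β n = z
  suffices h : TensorProduct.map R (TensorProduct.map S T) ∘ₗ
      (TensorProduct.assoc ℂ U V W).toLinearMap = (TensorProduct.assoc ℂ U' V' W').toLinearMap ∘ₗ
        TensorProduct.map (TensorProduct.map R S) T from LinearMap.congr_fun h z
  exact TensorProduct.ext_threefold fun u v w => by simp

/-- Each composite vector is built from f^k applied to an inner singular vector, of weight a + α or
a + α'. Modules generated by singular vectors of different weights are orthogonal. -/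
theorem compTop_orthogonal {C : LinearMap.BilinForm ℂ U} {D : LinearMap.BilinForm ℂ V}
    (hC : M.IsContravariant C) (hD : A.IsContravariant D) (E : LinearMap.BilinForm ℂ W)
    (hx : M.h x = a • x) (hex : M.e x = 0)
    {v' : V} {α' : ℂ} {m' : ℕ} {w' : W} {β' : ℂ} {n' : ℕ} (hv : A.h v = α • v)
    (hv' : A.h v' = α' • v') (hm : (A.e ^ (m + 1)) v = 0) (hm' : (A.e ^ (m' + 1)) v' = 0)
    (ha : shap q a m ≠ 0) (ha' : shap q a m' ≠ 0) (hne : α ≠ α') :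
    C.tmul (D.tmul E) (compTop hq M x a A v α m B w β n) (compTop hq M x a A v' α' m' B w' β' n') =
      0 := by
  rw [compTop, compTop, tmul_form_assoc, phiTop.eq_def _ (phiTop _ _ _ _ _ _ _),
    phiTop.eq_def _ (phiTop _ _ _ _ v' _ _)]
  simp only [map_sum, LinearMap.sum_apply, map_smul, LinearMap.smul_apply]
  refine Finset.sum_eq_zero fun k _ => smul_eq_zero_of_right _
    (Finset.sum_eq_zero fun l _ => ?_)
  have hCD := hC.tmul hq hD
  rw [tmul_form_apply,
    hCD.f_pow_f_pow hq (phiTop_e hq hx hex hv hm ha) (phiTop_e hq hx hex hv' hm' ha')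
      (phiTop_weight hq hx hv' m'),
    hCD.eq_zero_of_ne (phiTop_weight hq hx hv m) (phiTop_weight hq hx hv' m')
      (fun h => hne (add_left_cancel h))]
  simp

end CompositeVector

/-! ### Existence and uniqueness of intertwining maps of Verma modules. -/

section VermaPhi

variable {q : ℝ} (hq : 0 < q) {V W : Type*} [AddCommGroup V] [Module ℂ V] [AddCommGroup W]
  [Module ℂ W] {l μ : ℂ} {N : UqModule q V} {v : V}

/-- Singular vectors of `M_μ ⊗ V` are determined by their first component. -/
theorem eq_of_slice_vermaTop (hμ : ∀ k, shap q μ k ≠ 0) {z z' : (ℕ →₀ ℂ) ⊗[ℂ] V}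
    (hz : ((verma hq μ).tensor hq N).e z = 0) (hz' : ((verma hq μ).tensor hq N).e z' = 0)
    (h : slice V (vermaForm q μ vermaTop) z = slice V (vermaForm q μ vermaTop) z') : z = z' := by
  refine sub_eq_zero.1 (eq_zero_of_slice_vermaTop hq (N := N) hμ ?_ ?_)
  · rw [map_sub, hz, hz']; exact sub_self _
  · rw [map_sub, h, sub_self]

/-- The terms f^k y with k > 0 are orthogonal to y, so the leading component is a contraction. This
replaces the expansion by a linear condition. -/
theorem slice_of_isIntertwiningMap {Φ : (ℕ →₀ ℂ) →ₗ[ℂ] (ℕ →₀ ℂ) ⊗[ℂ] V}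
    (h : IsIntertwiningMap hq (verma hq l) vermaTop (verma hq μ) vermaTop N v Φ) :
    slice V (vermaForm q μ vermaTop) (Φ vermaTop) = v := by
  obtain ⟨-, u, hu, hΦ⟩ := h
  rw [hΦ, Finsupp.sum, map_sum, Finset.sum_eq_single 0]
  · rw [slice_tmul, pow_zero, Module.End.one_apply, vermaForm_top_top, one_smul, hu]
  · intro k _ hk
    obtain ⟨k, rfl⟩ := Nat.exists_eq_succ_of_ne_zero hk
    rw [slice_tmul, pow_succ', Module.End.mul_apply, ← (isContravariant_vermaForm hq).e,
      verma_e_top]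
    simp
  · intro h0
    rw [slice_tmul, Finsupp.notMem_support_iff.1 h0, smul_zero]

/-- Zero is the default value of `vermaPhi`. Since v need not be a weight vector here, this applies
to values of an operator not yet known to preserve weights. -/
theorem vermaPhi_eq_zero_or (l μ : ℂ) (N : UqModule q V) (v : V) : vermaPhi hq l μ N v = 0 ∨
    slice V (vermaForm q μ vermaTop) (vermaPhi hq l μ N v vermaTop) = v := by
  rw [vermaPhi]
  split_ifs with h
  · exact Or.inr (slice_of_isIntertwiningMap hq h.choose_spec)
  · exact Or.inl rfl

theorem isIntertwiningMap_vermaHom (hμ : ∀ k, shap q μ k ≠ 0) (hv : N.h v = (l - μ) • v) {n : ℕ}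
    (hn : (N.e ^ (n + 1)) v = 0) :
    IsIntertwiningMap hq (verma hq l) vermaTop (verma hq μ) vermaTop N v
      (vermaHom ((verma hq μ).tensor hq N) (phiTop (verma hq μ) vermaTop μ N v (l - μ) n)) := by
  refine ⟨isIntertwining_vermaHom hq ?_ ?_, ?_⟩
  · rw [phiTop_weight hq (verma_h_top hq μ) hv, add_sub_cancel]
  · exact phiTop_e hq (verma_h_top hq μ) (verma_e_top hq μ) hv hn (hμ n)
  · refine ⟨∑ k ∈ Finset.range (n + 1), Finsupp.single k (phiCoeff q μ (l - μ) k • (N.e ^ k) v),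
      ?_, ?_⟩
    · rw [Finsupp.finsetSum_apply, Finset.sum_eq_single 0]
      · simp
      · intro k _ hk
        rw [Finsupp.single_eq_of_ne hk.symm]
      · simp
    · rw [vermaHom_top, ← Finsupp.sum_finsetSum_index, phiTop]
      · refine Finset.sum_congr rfl fun k _ => ?_
        rw [Finsupp.sum_single_index, TensorProduct.tmul_smul]
        exact TensorProduct.tmul_zero _ _
      · intro k; exact TensorProduct.tmul_zero _ _
      · intro k x y; exact TensorProduct.tmul_add _ _ _

theorem vermaPhi_eq (hμ : ∀ k, shap q μ k ≠ 0) (hv : N.h v = (l - μ) • v) {n : ℕ}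
    (hn : (N.e ^ (n + 1)) v = 0) : vermaPhi hq l μ N v =
      vermaHom ((verma hq μ).tensor hq N) (phiTop (verma hq μ) vermaTop μ N v (l - μ) n) := by
  have h1 := isIntertwiningMap_vermaHom hq hμ hv hn
  have hex : ∃ Φ, IsIntertwiningMap hq (verma hq l) vermaTop (verma hq μ) vermaTop N v Φ := ⟨_, h1⟩
  rw [vermaPhi, dif_pos hex]
  have h2 := hex.choose_spec
  set Φ := hex.choose
  refine verma_hom_ext hq h2.1 h1.1 ?_
  refine eq_of_slice_vermaTop hq (N := N) hμ ?_ ?_ ?_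
  · rw [← h2.1.2.1, verma_e_top, map_zero]
  · rw [← h1.1.2.1, verma_e_top, map_zero]
  · rw [slice_of_isIntertwiningMap hq h2, slice_of_isIntertwiningMap hq h1]

theorem isIntertwining_vermaPhi (hμ : ∀ k, shap q μ k ≠ 0) (hv : N.h v = (l - μ) • v) :
    (verma hq l).IsIntertwining ((verma hq μ).tensor hq N) (vermaPhi hq l μ N v) := by
  obtain ⟨n, hn⟩ := N.e_locally_nilpotent v
  rw [vermaPhi_eq hq hμ hv (hn (n + 1) (Nat.le_succ n))]
  exact (isIntertwiningMap_vermaHom hq hμ hv (hn (n + 1) (Nat.le_succ n))).1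

theorem vermaPhi_unique (hμ : ∀ k, shap q μ k ≠ 0) (hv : N.h v = (l - μ) • v)
    {Φ : (ℕ →₀ ℂ) →ₗ[ℂ] (ℕ →₀ ℂ) ⊗[ℂ] V}
    (hΦ : (verma hq l).IsIntertwining ((verma hq μ).tensor hq N) Φ)
    (h0 : slice V (vermaForm q μ vermaTop) (Φ vermaTop) = v) : Φ = vermaPhi hq l μ N v := by
  obtain ⟨n, hn⟩ := N.e_locally_nilpotent v
  have h1 := isIntertwiningMap_vermaHom hq hμ hv (hn (n + 1) (Nat.le_succ n))
  rw [vermaPhi_eq hq hμ hv (hn (n + 1) (Nat.le_succ n))]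
  refine verma_hom_ext hq hΦ h1.1 ?_
  refine eq_of_slice_vermaTop hq (N := N) hμ ?_ ?_ ?_
  · rw [← hΦ.2.1, verma_e_top, map_zero]
  · rw [← h1.1.2.1, verma_e_top, map_zero]
  · rw [h0, slice_of_isIntertwiningMap hq h1]

/-- The composition of two intertwining maps of Verma modules. -/
theorem vermaPhi_comp_top {A : UqModule q V} {B : UqModule q W} {α β : ℂ} {w : W} {m n : ℕ}
    (hv : A.h v = α • v) (hw : B.h w = β • w)
    (hm : (A.e ^ (m + 1)) v = 0) (hn : (B.e ^ (n + 1)) w = 0)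
    (h1 : ∀ k, shap q (l - β) k ≠ 0) (h2 : ∀ k, shap q (l - β - α) k ≠ 0) :
    ((TensorProduct.assoc ℂ (ℕ →₀ ℂ) V W).toLinearMap ∘ₗ
      (vermaPhi hq (l - β) (l - β - α) A v).rTensor W ∘ₗ vermaPhi hq l (l - β) B w) vermaTop =
      compTop hq (verma hq (l - β - α)) vermaTop (l - β - α) A v α m B w β n := by
  have e1 : l - (l - β) = β := by ring
  have e2 : l - β - (l - β - α) = α := by ring
  rw [LinearMap.comp_apply, LinearMap.comp_apply, LinearEquiv.coe_coe, compTop]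
  congr 1
  rw [vermaPhi_eq hq h1 (by rw [e1]; exact hw) hn, vermaHom_top, e1]
  have := phiTop_natural (x := vermaTop) (a := l - β) (v := w) (ν := β)
    (isIntertwining_vermaPhi hq h2 (v := v) (N := A) (by rw [e2]; exact hv))
    (isIntertwining_id B) n
  refine this.trans ?_
  rw [vermaPhi_eq hq h2 (by rw [e2]; exact hv) hm, vermaHom_top, e2, LinearMap.id_apply,
    sub_add_cancel]

theorem isIntertwining_vermaPhi_comp {A : UqModule q V} {B : UqModule q W} {α β : ℂ} {w : W}
    (hv : A.h v = α • v) (hw : B.h w = β • w)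
    (h1 : ∀ k, shap q (l - β) k ≠ 0) (h2 : ∀ k, shap q (l - β - α) k ≠ 0) :
    (verma hq l).IsIntertwining ((verma hq (l - β - α)).tensor hq (A.tensor hq B))
      ((TensorProduct.assoc ℂ (ℕ →₀ ℂ) V W).toLinearMap ∘ₗ
        (vermaPhi hq (l - β) (l - β - α) A v).rTensor W ∘ₗ vermaPhi hq l (l - β) B w) := by
  refine isIntertwining_assoc_rTensor hq (isIntertwining_vermaPhi hq h2 ?_)
    (isIntertwining_vermaPhi hq h1 ?_)
  · rw [hv]; congr 1; ring
  · rw [hw]; congr 1; ring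

end VermaPhi

/-! ### The fusion matrix of two Verma modules. -/

section Fusion

/-- A geometric series inverts J, being finite on each vector. The condition on D says D = J - 1. -/
theorem isUnit_of_locally_nilpotent {X : Type*} [AddCommGroup X] [Module ℂ X] (J : Module.End ℂ X)
    (h : ∀ D : Module.End ℂ X, (∀ z y, J z = y + z → D z = y) → ∀ z, ∃ n, (D ^ n) z = 0) : IsUnit J := by
  have h := h (J - 1) fun z y hz => by simp [hz]
  -- From here on D denotes 1 - J, whose powers agree with those of J - 1 up to sign.
  obtain ⟨D, rfl⟩ : ∃ D, J = 1 - D := ⟨1 - J, by abel⟩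
  have h : ∀ z, ∃ n, (D ^ n) z = 0 := by
    intro z
    obtain ⟨n, hn⟩ := h z
    refine ⟨n, ?_⟩
    rw [sub_sub_cancel_left, neg_pow, Module.End.mul_apply] at hn
    rcases Nat.even_or_odd n with hev | hodd
    · simpa [hev.neg_one_pow] using hn
    · simpa [hodd.neg_one_pow] using hn
  rw [Module.End.isUnit_iff]
  constructor
  · rw [← LinearMap.ker_eq_bot, LinearMap.ker_eq_bot']
    intro z hz
    have h0 : D z = z := (sub_eq_zero.1 hz).symm
    have h1 : ∀ n, (D ^ n) z = z := by
      intro n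
      induction n with
      | zero => simp
      | succ n ih => rw [pow_succ, Module.End.mul_apply, h0, ih]
    obtain ⟨n, hn⟩ := h z
    rw [← h1 n, hn]
  · intro z
    obtain ⟨n, hn⟩ := h z
    refine ⟨(∑ i ∈ Finset.range n, D ^ i) z, ?_⟩
    rw [← Module.End.mul_apply, mul_neg_geom_sum, LinearMap.sub_apply, hn, sub_zero,
      Module.End.one_apply]

variable {q : ℝ} (hq : 0 < q)

theorem verma_weight_vector {γ α : ℂ} {w : ℕ →₀ ℂ} (hw : (verma hq γ).h w = α • w) (hw0 : w ≠ 0) :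
    ∃ (a : ℕ) (c : ℂ), c ≠ 0 ∧ α = γ - 2 * a ∧ w = c • Finsupp.single a 1 := by
  have hcoord : ∀ k : ℕ, (γ - 2 * k) * w k = α * w k := by
    intro k
    have h1 : (Finsupp.lapply k : (ℕ →₀ ℂ) →ₗ[ℂ] ℂ) ∘ₗ (verma hq γ).h =
        (γ - 2 * k) • Finsupp.lapply k := by
      refine LinearMap.ext_on (span_single_one ℕ) ?_
      rintro _ ⟨i, rfl⟩
      rw [LinearMap.comp_apply, verma_h_single]
      rcases eq_or_ne i k with rfl | hik
      · simp
      · simp [hik]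
    have h2 := LinearMap.congr_fun h1 w
    rw [LinearMap.comp_apply, hw] at h2
    simpa using h2.symm
  obtain ⟨a, ha⟩ := Finsupp.ne_iff.1 hw0
  have hα : α = γ - 2 * a := (mul_right_cancel₀ ha (hcoord a)).symm
  refine ⟨a, w a, ha, hα, ?_⟩
  ext k
  rcases eq_or_ne k a with rfl | hk
  · simp
  · have h3 := hcoord k
    rw [hα, ← sub_eq_zero, ← sub_mul, mul_eq_zero] at h3
    rw [h3.resolve_left]
    · simp [hk.symm]
    · intro h4
      refine hk ?_
      have : (k : ℂ) = a := by linear_combination (-1 / 2) * h4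
      exact_mod_cast this

theorem verma_e_pow_single_eq (γ : ℂ) (k b : ℕ) :
    ∃ c : ℂ, ((verma hq γ).e ^ k) (Finsupp.single b 1) = c • Finsupp.single (b - k) 1 := by
  induction k with
  | zero => exact ⟨1, by simp⟩
  | succ k ih =>
    obtain ⟨c, hc⟩ := ih
    rw [pow_succ', Module.End.mul_apply, hc, map_smul, verma_e_single, smul_smul]
    exact ⟨_, by rw [Nat.sub_sub]⟩

/-- All weights of the form `l + i` with an integer `i` are generic. -/
def Nonresonant (q : ℝ) (l : ℂ) : Prop := ∀ (i : ℤ) (k : ℕ), shap q (l + i) k ≠ 0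

theorem Nonresonant.shap_ne_zero {l : ℂ} (hl : Nonresonant q l) (i : ℤ) {z : ℂ} (hz : z = l + i)
    (k : ℕ) : shap q z k ≠ 0 := by
  rw [hz]; exact hl i k

/-- The fusion matrix of two Verma modules. -/
def fusionOp (γ δ l : ℂ) : Module.End ℂ ((ℕ →₀ ℂ) ⊗[ℂ] (ℕ →₀ ℂ)) :=
  TensorProduct.lift (Finsupp.linearCombination ℂ fun a : ℕ =>
    Finsupp.linearCombination ℂ fun b : ℕ =>
      fusionVec q (l - (δ - 2 * b) - (γ - 2 * a)) (verma hq γ) (Finsupp.single a 1) (γ - 2 * a)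
        (verma hq δ) (Finsupp.single b 1) (δ - 2 * b) b)

theorem fusionOp_single (γ δ l : ℂ) (a b : ℕ) :
    fusionOp hq γ δ l (Finsupp.single a 1 ⊗ₜ[ℂ] Finsupp.single b 1) =
      fusionVec q (l - (δ - 2 * b) - (γ - 2 * a)) (verma hq γ) (Finsupp.single a 1) (γ - 2 * a)
        (verma hq δ) (Finsupp.single b 1) (δ - 2 * b) b := by
  simp [fusionOp]

/-- The operator is unitriangular: it adds to x_a ⊗ x_b only terms with smaller second index. This
needs no genericity of l. -/
theorem isUnit_fusionOp (γ δ l : ℂ) : IsUnit (fusionOp hq γ δ l) := by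
  refine isUnit_of_locally_nilpotent (X := (ℕ →₀ ℂ) ⊗[ℂ] (ℕ →₀ ℂ)) (fusionOp hq γ δ l)
    fun D hD => ?_
  have hb : ∀ b n : ℕ, b < n → ∀ a : ℕ,
      (D ^ n) (Finsupp.single a 1 ⊗ₜ[ℂ] Finsupp.single b 1) = 0 := by
    intro b n
    induction n generalizing b with
    | zero => intro h; omega
    | succ n ih =>
      intro hbn a
      have hDab := fusionOp_single hq γ δ l a b
      rw [fusionVec, Finset.sum_range_succ'] at hDab
      simp only [Nat.cast_zero, zero_mul, neg_zero, zero_div, Complex.cpow_zero, phiCoeff_zero,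
        mul_one, one_smul, pow_zero, Module.End.one_apply] at hDab
      rw [pow_succ, Module.End.mul_apply, hD _ _ hDab, map_sum]
      refine Finset.sum_eq_zero fun k hk => ?_
      have hk := Finset.mem_range.1 hk
      obtain ⟨c, hc⟩ := verma_e_pow_single_eq hq δ (k + 1) b
      rw [hc, verma_f_pow_single, TensorProduct.tmul_smul, map_smul, map_smul,
        ih _ (by omega), smul_zero, smul_zero]
  intro z
  -- Vanishing of all large powers, unlike vanishing of a single one, passes directly to sums.
  suffices h : ∃ n, ∀ k, n ≤ k → (D ^ k) z = 0 by
    obtain ⟨n, hn⟩ := h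
    exact ⟨n, hn n le_rfl⟩
  have hadd : ∀ x y, (∃ n, ∀ k, n ≤ k → (D ^ k) x = 0) →
      (∃ n, ∀ k, n ≤ k → (D ^ k) y = 0) → ∃ n, ∀ k, n ≤ k → (D ^ k) (x + y) = 0 := by
    rintro x y ⟨n, hn⟩ ⟨n', hn'⟩
    refine ⟨max n n', fun k hk => ?_⟩
    rw [map_add, hn k (le_trans (le_max_left _ _) hk), hn' k (le_trans (le_max_right _ _) hk),
      add_zero]
  induction z using TensorProduct.induction_on with
  | zero => exact ⟨0, fun k _ => map_zero _⟩
  | add x y hx hy => exact hadd x y hx hy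
  | tmul v w =>
    induction v using Finsupp.induction_linear with
    | zero => exact ⟨0, fun k _ => by rw [TensorProduct.zero_tmul, map_zero]⟩
    | add x y hx hy => rw [TensorProduct.add_tmul]; exact hadd _ _ hx hy
    | single a c =>
      induction w using Finsupp.induction_linear with
      | zero => exact ⟨0, fun k _ => by rw [TensorProduct.tmul_zero, map_zero]⟩
      | add x y hx hy => rw [TensorProduct.tmul_add]; exact hadd _ _ hx hy
      | single b d =>
        refine ⟨b + 1, fun k hk => ?_⟩
        rw [← mul_one c, ← mul_one d, ← smul_eq_mul, ← smul_eq_mul, ← Finsupp.smul_single,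
          ← Finsupp.smul_single, TensorProduct.tmul_smul, ← TensorProduct.smul_tmul', map_smul,
          map_smul, hb b k hk, smul_zero, smul_zero]

theorem verma_single_weight (γ : ℂ) (a : ℕ) :
    (verma hq γ).h (Finsupp.single a 1) = (γ - 2 * a) • Finsupp.single a 1 := verma_h_single hq γ a

/-- The composite vector attached to two basis vectors of Verma modules. -/
def vermaComp (γ δ μ : ℂ) (a b : ℕ) : (ℕ →₀ ℂ) ⊗[ℂ] ((ℕ →₀ ℂ) ⊗[ℂ] (ℕ →₀ ℂ)) :=
  compTop hq (verma hq μ) vermaTop μ (verma hq γ) (Finsupp.single a 1) (γ - 2 * a) a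
    (verma hq δ) (Finsupp.single b 1) (δ - 2 * b) b

theorem slice_vermaComp {γ δ l μ : ℂ} {a b : ℕ} (hμ : l - (δ - 2 * b) - (γ - 2 * a) = μ) :
    slice _ (vermaForm q μ vermaTop) (vermaComp hq γ δ μ a b) =
      fusionOp hq γ δ l (Finsupp.single a 1 ⊗ₜ[ℂ] Finsupp.single b 1) := by
  rw [fusionOp_single, vermaComp, hμ]
  exact slice_compTop hq (isContravariant_vermaForm hq) (verma_h_top hq _) (verma_e_top hq _)
    vermaForm_top_top

variable {γ δ : ℕ} {l : ℂ}

/-- For γ, δ ∈ ℕ all highest weights that occur lie in l + ℤ, so one condition on l covers all of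
them. -/
theorem Nonresonant.first (hl : Nonresonant q l) (γ : ℕ) (a k : ℕ) :
    shap q (l - ((γ : ℂ) - 2 * a)) k ≠ 0 :=
  hl.shap_ne_zero (2 * a - γ) (by push_cast; ring) k

theorem Nonresonant.second (hl : Nonresonant q l) (γ δ : ℕ) (a b k : ℕ) :
    shap q (l - ((δ : ℂ) - 2 * b) - ((γ : ℂ) - 2 * a)) k ≠ 0 :=
  hl.shap_ne_zero (2 * a - γ + (2 * b - δ)) (by push_cast; ring) k

theorem vermaPhi_comp_single (hl : Nonresonant q l) (a b : ℕ) :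
    ((TensorProduct.assoc ℂ (ℕ →₀ ℂ) (ℕ →₀ ℂ) (ℕ →₀ ℂ)).toLinearMap ∘ₗ
      (vermaPhi hq (l - ((δ : ℂ) - 2 * b)) (l - ((δ : ℂ) - 2 * b) - ((γ : ℂ) - 2 * a)) (verma hq γ)
        (Finsupp.single a 1)).rTensor (ℕ →₀ ℂ) ∘ₗ vermaPhi hq l (l - ((δ : ℂ) - 2 * b))
          (verma hq δ) (Finsupp.single b 1)) vermaTop =
      vermaComp hq γ δ (l - ((δ : ℂ) - 2 * b) - ((γ : ℂ) - 2 * a)) a b :=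
  vermaPhi_comp_top hq (verma_single_weight hq _ a) (verma_single_weight hq _ b)
    (verma_e_pow_single hq _ a 1) (verma_e_pow_single hq _ b 1) (hl.first δ b) (hl.second γ δ a b)

theorem vermaPhi_smul (l μ : ℂ) {V : Type*} [AddCommGroup V] [Module ℂ V] {N : UqModule q V}
    {v : V} (hμ : ∀ k, shap q μ k ≠ 0) (hv : N.h v = (l - μ) • v) (c : ℂ) :
    vermaPhi hq l μ N (c • v) = c • vermaPhi hq l μ N v := by
  have h1 := isIntertwining_vermaPhi hq hμ hv
  obtain ⟨n, hn⟩ := N.e_locally_nilpotent v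
  symm
  refine vermaPhi_unique hq hμ (by rw [map_smul, hv, smul_comm]) ⟨?_, ?_, ?_⟩ ?_
  · intro x; rw [LinearMap.smul_apply, h1.1, LinearMap.smul_apply, map_smul]
  · intro x; rw [LinearMap.smul_apply, h1.2.1, LinearMap.smul_apply, map_smul]
  · intro x; rw [LinearMap.smul_apply, h1.2.2, LinearMap.smul_apply, map_smul]
  · rw [LinearMap.smul_apply, map_smul, vermaPhi_eq hq hμ hv (hn (n + 1) (Nat.le_succ n)),
      slice_of_isIntertwiningMap hq
        (isIntertwiningMap_vermaHom hq hμ hv (hn (n + 1) (Nat.le_succ n)))]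

theorem fusionOp_weight (γ δ l : ℂ) (a b : ℕ) :
    ((verma hq γ).tensor hq (verma hq δ)).h
      (fusionOp hq γ δ l (Finsupp.single a 1 ⊗ₜ[ℂ] Finsupp.single b 1)) =
      ((γ - 2 * a) + (δ - 2 * b)) •
        fusionOp hq γ δ l (Finsupp.single a 1 ⊗ₜ[ℂ] Finsupp.single b 1) := by
  rw [fusionOp_single, fusionVec, map_sum, Finset.smul_sum]
  refine Finset.sum_congr rfl fun k _ => ?_
  rw [map_smul, tensor_weight hq _ _ ((verma hq γ).f_pow_weight (verma_single_weight hq γ a) k)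
    ((verma hq δ).e_pow_weight (verma_single_weight hq δ b) k), smul_comm]
  congr 1; ring

/-- Both sides of the defining property are intertwining maps out of M_l, so it is enough that their
leading components agree, which is `slice_vermaComp`. Scalars come in because weight vectors are
multiples of basis vectors. -/
theorem isFusionMatrix_fusionOp (hl : Nonresonant q l) :
    IsFusionMatrix hq (verma hq γ) (verma hq δ) l (fusionOp hq γ δ l) := by
  intro α β w v hw0 hv0 hw hv
  obtain ⟨a, c, -, rfl, rfl⟩ := verma_weight_vector hq hw hw0
  obtain ⟨b, d, -, rfl, rfl⟩ := verma_weight_vector hq hv hv0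
  have hwt := fusionOp_weight hq γ δ l a b
  have hsl := slice_vermaComp hq (γ := γ) (δ := δ) (l := l) (a := a) (b := b) rfl
  have hμ := hl.second γ δ a b
  rw [vermaPhi_smul hq _ _ hμ, vermaPhi_smul hq _ _ (hl.first δ b), TensorProduct.tmul_smul,
    ← TensorProduct.smul_tmul', map_smul, map_smul, vermaPhi_smul hq _ _ hμ,
    vermaPhi_smul hq _ _ hμ, LinearMap.rTensor_smul]
  · simp only [LinearMap.comp_smul, LinearMap.smul_comp]
    congr 2
    refine vermaPhi_unique hq hμ ?_ (isIntertwining_vermaPhi_comp hq (verma_single_weight hq _ a)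
      (verma_single_weight hq _ b) (hl.first δ b) (hl.second γ δ a b)) ?_
    · rw [hwt]; congr 1; ring
    · rw [vermaPhi_comp_single hq hl, hsl]
  · rw [hwt]; congr 1; ring
  · rw [map_smul, hwt, smul_comm]; congr 2; ring
  · rw [verma_single_weight]; congr 1; ring
  · rw [verma_single_weight]; congr 1; ring

theorem single_tmul_single_ne_zero (a b : ℕ) :
    (Finsupp.single a 1 : ℕ →₀ ℂ) ⊗ₜ[ℂ] (Finsupp.single b 1 : ℕ →₀ ℂ) ≠ 0 := by
  intro h
  have := congrArg (finsuppTensorFinsupp' ℂ ℕ ℕ) h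
  rw [finsuppTensorFinsupp'_single_tmul_single, map_zero] at this
  simp at this

theorem fusion_eq (hl : Nonresonant q l) :
    fusion hq (verma hq γ) (verma hq δ) l = fusionOp hq γ δ l := by
  have hex : ∃ J, IsFusionMatrix hq (verma hq γ) (verma hq δ) l J :=
    ⟨_, isFusionMatrix_fusionOp hq hl⟩
  rw [fusion, dif_pos hex]
  have hJ := hex.choose_spec
  set J := hex.choose
  have key : ∀ a b : ℕ, J (Finsupp.single a 1 ⊗ₜ[ℂ] Finsupp.single b 1) =
      fusionOp hq γ δ l (Finsupp.single a 1 ⊗ₜ[ℂ] Finsupp.single b 1) := by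
    intro a b
    have h1 := hJ _ _ _ _ (by simp) (by simp) (verma_single_weight hq γ a)
      (verma_single_weight hq δ b)
    have h2 := LinearMap.congr_fun h1 vermaTop
    rw [vermaPhi_comp_single hq hl] at h2
    have h3 := slice_vermaComp hq (γ := γ) (δ := δ) (l := l) (a := a) (b := b) rfl
    rw [h2] at h3
    -- If `vermaPhi` took its default value, the composite map would have leading component zero,
    -- contrary to injectivity of `fusionOp`.
    rcases vermaPhi_eq_zero_or hq l (l - ((δ : ℂ) - 2 * b) - ((γ : ℂ) - 2 * a))
      ((verma hq γ).tensor hq (verma hq δ))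
      (J (Finsupp.single a 1 ⊗ₜ[ℂ] Finsupp.single b 1)) with h0 | h0
    · rw [h0, LinearMap.zero_apply, map_zero] at h3
      refine absurd ?_ (single_tmul_single_ne_zero a b)
      refine ((Module.End.isUnit_iff _).1 (isUnit_fusionOp hq γ δ l)).1 ?_
      rw [← h3, map_zero]
    · rw [← h3, h0]
  refine TensorProduct.ext (Finsupp.lhom_ext' fun a => LinearMap.ext_ring ?_)
  refine Finsupp.lhom_ext' fun b => LinearMap.ext_ring ?_
  exact key a b

end Fusion

/-! ### Matrix elements of the exchange matrix as pairings. -/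

section ExchangeElement

variable {q : ℝ} (hq : 0 < q)

theorem verma_tensor_coeff (γ δ : ℂ) (z : (ℕ →₀ ℂ) ⊗[ℂ] (ℕ →₀ ℂ)) (a b : ℕ) :
    finsuppTensorFinsupp' ℂ ℕ ℕ (((verma hq γ).tensor hq (verma hq δ)).h z) (a, b) =
      (γ - 2 * a + (δ - 2 * b)) * finsuppTensorFinsupp' ℂ ℕ ℕ z (a, b) := by
  suffices h : (Finsupp.lapply (a, b) : (ℕ × ℕ →₀ ℂ) →ₗ[ℂ] ℂ) ∘ₗ
      (finsuppTensorFinsupp' ℂ ℕ ℕ).toLinearMap ∘ₗ ((verma hq γ).tensor hq (verma hq δ)).h =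
      (γ - 2 * a + (δ - 2 * b)) • ((Finsupp.lapply (a, b) : (ℕ × ℕ →₀ ℂ) →ₗ[ℂ] ℂ) ∘ₗ
        (finsuppTensorFinsupp' ℂ ℕ ℕ).toLinearMap) from LinearMap.congr_fun h z
  refine TensorProduct.ext (Finsupp.lhom_ext' fun i => LinearMap.ext_ring ?_)
  refine Finsupp.lhom_ext' fun k => LinearMap.ext_ring ?_
  have h1 := tensor_weight hq _ _ (verma_single_weight hq γ i) (verma_single_weight hq δ k)
  show finsuppTensorFinsupp' ℂ ℕ ℕ (((verma hq γ).tensor hq (verma hq δ)).h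
    (Finsupp.single i 1 ⊗ₜ[ℂ] Finsupp.single k 1)) (a, b) = _ *
      finsuppTensorFinsupp' ℂ ℕ ℕ (Finsupp.single i 1 ⊗ₜ[ℂ] Finsupp.single k 1) (a, b)
  rw [h1, map_smul, finsuppTensorFinsupp'_single_tmul_single, Finsupp.smul_apply, smul_eq_mul]
  by_cases h : (i, k) = (a, b)
  · obtain ⟨rfl, rfl⟩ := Prod.mk.inj h
    rfl
  · rw [Finsupp.single_eq_of_ne (Ne.symm h), mul_zero, mul_zero]

theorem eq_sum_of_weight {γ δ : ℂ} {s : ℕ} {z : (ℕ →₀ ℂ) ⊗[ℂ] (ℕ →₀ ℂ)}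
    (hz : ((verma hq γ).tensor hq (verma hq δ)).h z = (γ + δ - 2 * s) • z) :
    z = ∑ a ∈ Finset.range (s + 1), finsuppTensorFinsupp' ℂ ℕ ℕ z (a, s - a) •
      (Finsupp.single a 1 ⊗ₜ[ℂ] Finsupp.single (s - a) 1) := by
  refine (finsuppTensorFinsupp' ℂ ℕ ℕ).injective ?_
  ext ⟨a, b⟩
  simp only [map_sum, map_smul, finsuppTensorFinsupp'_single_tmul_single,
    Finsupp.finsetSum_apply, Finsupp.smul_apply, smul_eq_mul, mul_one]
  by_cases hab : a + b = s
  · subst hab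
    rw [Finset.sum_eq_single a]
    · simp
    · intro i _ hi
      rw [Finsupp.single_eq_of_ne (by simp [hi.symm]), mul_zero]
    · intro h; exact absurd (Finset.mem_range.2 (by omega)) h
  · rw [Finset.sum_eq_zero]
    · have h1 := verma_tensor_coeff hq γ δ z a b
      rw [hz, map_smul, Finsupp.smul_apply, smul_eq_mul, ← sub_eq_zero, ← sub_mul] at h1
      refine (mul_eq_zero.1 h1).resolve_left fun h2 => hab ?_
      have : (a : ℂ) + b = s := by linear_combination h2 / 2
      exact_mod_cast this
    · intro i hi
      have := Finset.mem_range.1 hi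
      rw [Finsupp.single_eq_of_ne, mul_zero]
      rintro h
      obtain ⟨rfl, rfl⟩ := Prod.mk.inj h
      omega

theorem fusionOp_h (γ δ l : ℂ) (z : (ℕ →₀ ℂ) ⊗[ℂ] (ℕ →₀ ℂ)) :
    ((verma hq γ).tensor hq (verma hq δ)).h (fusionOp hq γ δ l z) =
      fusionOp hq γ δ l (((verma hq γ).tensor hq (verma hq δ)).h z) := by
  suffices h : ((verma hq γ).tensor hq (verma hq δ)).h ∘ₗ fusionOp hq γ δ l =
      fusionOp hq γ δ l ∘ₗ ((verma hq γ).tensor hq (verma hq δ)).h from LinearMap.congr_fun h z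
  refine TensorProduct.ext (Finsupp.lhom_ext' fun a => LinearMap.ext_ring ?_)
  refine Finsupp.lhom_ext' fun b => LinearMap.ext_ring ?_
  show ((verma hq γ).tensor hq (verma hq δ)).h (fusionOp hq γ δ l
      (Finsupp.single a 1 ⊗ₜ[ℂ] Finsupp.single b 1)) =
    fusionOp hq γ δ l (((verma hq γ).tensor hq (verma hq δ)).h
      (Finsupp.single a 1 ⊗ₜ[ℂ] Finsupp.single b 1))
  rw [fusionOp_weight, tensor_weight hq _ _ (verma_single_weight hq γ a)
    (verma_single_weight hq δ b), map_smul]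

variable {γ δ : ℕ} {l μ : ℂ}

/-- The definition with J cleared: R²¹ J²¹ is the braiding after the fusion matrix after the flip,
because the two middle flips cancel. -/
theorem fusionOp_exchange (hl : Nonresonant q l) (z : (ℕ →₀ ℂ) ⊗[ℂ] (ℕ →₀ ℂ)) :
    fusionOp hq γ δ l (exchange hq (verma hq γ) (verma hq δ) l z) =
      braid (verma hq δ) (verma hq γ)
        (fusionOp hq δ γ l (TensorProduct.comm ℂ (ℕ →₀ ℂ) (ℕ →₀ ℂ) z)) := by
  rw [exchange, fusion_eq hq hl, fusion_eq hq hl, mul_assoc, ← Module.End.mul_apply, ← mul_assoc,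
    Ring.mul_inverse_cancel _ (isUnit_fusionOp hq γ δ l), one_mul]
  simp [braid]

theorem exchange_weight (hq1 : q < 1) (hl : Nonresonant q l) {s n : ℕ} (hn : n ≤ s) :
    ((verma hq (γ : ℂ)).tensor hq (verma hq (δ : ℂ))).h (exchange hq (verma hq γ) (verma hq δ) l
      (Finsupp.single n 1 ⊗ₜ[ℂ] Finsupp.single (s - n) 1)) =
      ((γ : ℂ) + δ - 2 * s) • exchange hq (verma hq γ) (verma hq δ) l
      (Finsupp.single n 1 ⊗ₜ[ℂ] Finsupp.single (s - n) 1) := by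
  refine ((Module.End.isUnit_iff _).1 (isUnit_fusionOp hq γ δ l)).1 ?_
  have hbr := isIntertwining_braid hq hq1 (verma hq (δ : ℂ)) (verma hq (γ : ℂ))
  rw [← fusionOp_h, map_smul, fusionOp_exchange hq hl, ← hbr.1, TensorProduct.comm_tmul,
    fusionOp_weight, map_smul]
  congr 1
  push_cast [hn]
  ring

theorem vermaComp_e {γ δ μ : ℂ} {a b : ℕ} (h1 : shap q μ a ≠ 0)
    (h2 : shap q (μ + (γ - 2 * a)) b ≠ 0) :
    ((verma hq μ).tensor hq ((verma hq γ).tensor hq (verma hq δ))).e (vermaComp hq γ δ μ a b) = 0 :=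
  compTop_e hq (verma_h_top hq μ) (verma_e_top hq μ) (verma_single_weight hq γ a)
    (verma_single_weight hq δ b) (verma_e_pow_single hq γ a 1) (verma_e_pow_single hq δ b 1) h1 h2

theorem eq_lTensor_of_slice {V W : Type*} [AddCommGroup V] [Module ℂ V] [AddCommGroup W]
    [Module ℂ W] {N : UqModule q V} {N' : UqModule q W} {S : V →ₗ[ℂ] W}
    (hS : N.IsIntertwining N' S) {μ : ℂ} (hμ : ∀ k, shap q μ k ≠ 0) {y : (ℕ →₀ ℂ) ⊗[ℂ] V}
    {z : (ℕ →₀ ℂ) ⊗[ℂ] W} (hz : ((verma hq μ).tensor hq N').e z = 0)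
    (hy : ((verma hq μ).tensor hq N).e y = 0)
    (h : slice W (vermaForm q μ vermaTop) z = S (slice V (vermaForm q μ vermaTop) y)) :
    z = S.lTensor (ℕ →₀ ℂ) y := by
  refine eq_of_slice_vermaTop hq (N := N') hμ hz ?_ (by rw [h, slice_lTensor])
  rw [← (hS.lTensor hq (verma hq μ)).2.1, hy, map_zero]

/-- The exchange matrix relates the two kinds of composite vectors. -/
theorem sum_exchangeElement (hq1 : q < 1) (hl : Nonresonant q l) {s n : ℕ} (hn : n ≤ s)
    (hμ : μ = l - γ - δ + 2 * s) :
    ∑ a ∈ Finset.range (s + 1), exchangeElement hq γ δ s a n l • vermaComp hq γ δ μ a (s - a) =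
      (braid (verma hq (δ : ℂ)) (verma hq (γ : ℂ))).lTensor (ℕ →₀ ℂ)
        (vermaComp hq δ γ μ (s - n) n) := by
  have hμ0 : ∀ k, shap q μ k ≠ 0 := hl.shap_ne_zero (2 * s - γ - δ) (by rw [hμ]; push_cast; ring)
  have hbr := isIntertwining_braid hq hq1 (verma hq (δ : ℂ)) (verma hq (γ : ℂ))
  refine eq_lTensor_of_slice hq hbr hμ0 ?_ ?_ ?_
  · rw [map_sum]
    refine Finset.sum_eq_zero fun a _ => ?_
    rw [map_smul, vermaComp_e hq (hμ0 a), smul_zero]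
    exact hl.shap_ne_zero (2 * s - δ - 2 * a) (by rw [hμ]; push_cast; ring) _
  · refine vermaComp_e hq (hμ0 _) ?_
    exact hl.shap_ne_zero (2 * n - γ) (by rw [hμ]; push_cast [hn]; ring) _
  -- Leading components are values of fusion matrices, so the claim becomes `fusionOp_exchange`
  -- applied to the expansion of the exchange matrix in its weight space.
  · rw [slice_vermaComp hq (l := l) (by rw [hμ]; push_cast [hn]; ring), map_sum]
    have h1 := congrArg (fusionOp hq γ δ l) (eq_sum_of_weight hq
      (exchange_weight hq (γ := γ) (δ := δ) hq1 hl hn))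
    rw [fusionOp_exchange hq hl, TensorProduct.comm_tmul, map_sum] at h1
    rw [h1]
    refine Finset.sum_congr rfl fun a ha => ?_
    have ha : a ≤ s := Nat.lt_succ_iff.1 (Finset.mem_range.1 ha)
    rw [map_smul, map_smul, slice_vermaComp hq (l := l) (by rw [hμ]; push_cast [ha]; ring)]
    rfl

/-- The form on a tensor product of three Verma modules. -/
def vermaForm₃ (q : ℝ) (μ γ δ : ℂ) :
    LinearMap.BilinForm ℂ ((ℕ →₀ ℂ) ⊗[ℂ] ((ℕ →₀ ℂ) ⊗[ℂ] (ℕ →₀ ℂ))) :=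
  (vermaForm q μ).tmul ((vermaForm q γ).tmul (vermaForm q δ))

/-- Pairing with the m-th composite vector isolates one coefficient by orthogonality. The two
pairings here still make sense at the nongeneric limit point. -/
theorem exchangeElement_mul (hq1 : q < 1) (hl : Nonresonant q l) {s m n : ℕ} (hm : m ≤ s) (hn : n ≤ s)
    (hμ : μ = l - γ - δ + 2 * s) :
    exchangeElement hq γ δ s m n l *
      vermaForm₃ q μ γ δ (vermaComp hq γ δ μ m (s - m)) (vermaComp hq γ δ μ m (s - m)) =
      vermaForm₃ q μ γ δ ((braid (verma hq (δ : ℂ)) (verma hq (γ : ℂ))).lTensor (ℕ →₀ ℂ)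
        (vermaComp hq δ γ μ (s - n) n)) (vermaComp hq γ δ μ m (s - m)) := by
  have hμ0 : ∀ k, shap q μ k ≠ 0 := hl.shap_ne_zero (2 * s - γ - δ) (by rw [hμ]; push_cast; ring)
  rw [← sum_exchangeElement hq hq1 hl hn hμ, map_sum, LinearMap.sum_apply, Finset.sum_eq_single m]
  · rw [map_smul, LinearMap.smul_apply, smul_eq_mul]
  · intro a _ ham
    rw [map_smul, LinearMap.smul_apply, vermaForm₃, vermaComp, vermaComp,
      compTop_orthogonal hq (isContravariant_vermaForm hq) (isContravariant_vermaForm hq) _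
        (verma_h_top hq μ) (verma_e_top hq μ) (verma_single_weight hq _ a)
        (verma_single_weight hq _ m) (verma_e_pow_single hq _ a 1) (verma_e_pow_single hq _ m 1)
        (hμ0 a) (hμ0 m), smul_zero]
    intro h
    have : (a : ℂ) = m := by linear_combination (-1 / 2) * h
    exact ham (by exact_mod_cast this)
  · intro h; exact absurd (Finset.mem_range.2 (by omega)) h

end ExchangeElement

/-! ### Adjoints of braidings in threefold products; composite vectors of irreducible modules. -/

section BraidAdjoint

variable {q : ℝ} (hq : 0 < q)

theorem tmul_form_lTensor_adjoint {V W W' : Type*} [AddCommMonoid V] [Module ℂ V] [AddCommMonoid W]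
    [Module ℂ W] [AddCommMonoid W'] [Module ℂ W'] (B : LinearMap.BilinForm ℂ V)
    {C : LinearMap.BilinForm ℂ W} {D : LinearMap.BilinForm ℂ W'} {S : W →ₗ[ℂ] W'} {T : W' →ₗ[ℂ] W}
    (h : ∀ w w', D (S w) w' = C w (T w')) (z : V ⊗[ℂ] W) (z' : V ⊗[ℂ] W') :
    B.tmul D (S.lTensor V z) z' = B.tmul C z (T.lTensor V z') := by
  induction z using TensorProduct.induction_on with
  | zero => simp
  | add x y hx hy => simp only [map_add, LinearMap.add_apply, hx, hy]
  | tmul v w =>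
    induction z' using TensorProduct.induction_on with
    | zero => simp
    | add x y hx hy => simp only [map_add, hx, hy]
    | tmul v' w' =>
      rw [LinearMap.lTensor_tmul, LinearMap.lTensor_tmul, LinearMap.BilinForm.tensorDistrib_tmul,
        LinearMap.BilinForm.tensorDistrib_tmul, h]

theorem tmul_form_rTensor_adjoint {V W W' : Type*} [AddCommMonoid V] [Module ℂ V] [AddCommMonoid W]
    [Module ℂ W] [AddCommMonoid W'] [Module ℂ W'] (B : LinearMap.BilinForm ℂ V)
    {C : LinearMap.BilinForm ℂ W} {D : LinearMap.BilinForm ℂ W'} {S : W →ₗ[ℂ] W'} {T : W' →ₗ[ℂ] W}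
    (h : ∀ w w', D (S w) w' = C w (T w')) (z : W ⊗[ℂ] V) (z' : W' ⊗[ℂ] V) :
    D.tmul B (S.rTensor V z) z' = C.tmul B z (T.rTensor V z') := by
  induction z using TensorProduct.induction_on with
  | zero => simp
  | add x y hx hy => simp only [map_add, LinearMap.add_apply, hx, hy]
  | tmul v w =>
    induction z' using TensorProduct.induction_on with
    | zero => simp
    | add x y hx hy => simp only [map_add, hx, hy]
    | tmul v' w' =>
      rw [LinearMap.rTensor_tmul, LinearMap.rTensor_tmul, LinearMap.BilinForm.tensorDistrib_tmul,
        LinearMap.BilinForm.tensorDistrib_tmul, h]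

/-- The adjoint of (1 ⊗ c_{32})(c_{31} ⊗ 1) is (c_{13} ⊗ 1)(1 ⊗ c_{23}), and by the hexagon identity
this braids the pair V₁ ⊗ V₂ past V₃. -/
theorem form_braid_braid (hq1 : q < 1) {V₁ V₂ V₃ : Type*} [AddCommGroup V₁] [Module ℂ V₁]
    [AddCommGroup V₂] [Module ℂ V₂] [AddCommGroup V₃] [Module ℂ V₃] {M₁ : UqModule q V₁}
    {M₂ : UqModule q V₂} {M₃ : UqModule q V₃} {B₁ : LinearMap.BilinForm ℂ V₁}
    {B₂ : LinearMap.BilinForm ℂ V₂} {B₃ : LinearMap.BilinForm ℂ V₃} (h₁ : M₁.IsContravariant B₁)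
    (h₂ : M₂.IsContravariant B₂) (h₃ : M₃.IsContravariant B₃) (u : (V₃ ⊗[ℂ] V₁) ⊗[ℂ] V₂)
    (y : (V₁ ⊗[ℂ] V₂) ⊗[ℂ] V₃) :
    B₁.tmul (B₂.tmul B₃) ((braid M₃ M₂).lTensor V₁
        (TensorProduct.assoc ℂ V₁ V₃ V₂ ((braid M₃ M₁).rTensor V₂ u)))
      (TensorProduct.assoc ℂ V₁ V₂ V₃ y) =
    B₃.tmul (B₁.tmul B₂) (TensorProduct.assoc ℂ V₃ V₁ V₂ u) (braid (M₁.tensor hq M₂) M₃ y) := by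
  rw [tmul_form_lTensor_adjoint B₁ (h₃.braid hq h₂)]
  obtain ⟨y', hy'⟩ := (TensorProduct.assoc ℂ V₁ V₃ V₂).surjective
    ((braid M₂ M₃).lTensor V₁ (TensorProduct.assoc ℂ V₁ V₂ V₃ y))
  rw [← hy', tmul_form_assoc, tmul_form_rTensor_adjoint B₂ (h₃.braid hq h₁),
    ← tmul_form_assoc, braid_tensor_left hq hq1]
  simp only [LinearMap.comp_apply, LinearEquiv.coe_coe, ← hy', LinearEquiv.symm_apply_apply]

theorem phiTop_smul_left {V W : Type*} [AddCommGroup V] [Module ℂ V] [AddCommGroup W] [Module ℂ W]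
    (M : UqModule q V) (x : V) (a : ℂ) (N : UqModule q W) (v : W) (ν : ℂ) (n : ℕ) (c : ℂ) :
    phiTop M (c • x) a N v ν n = c • phiTop M x a N v ν n := by
  rw [phiTop, phiTop, Finset.smul_sum]
  refine Finset.sum_congr rfl fun k _ => ?_
  rw [map_smul, ← TensorProduct.smul_tmul', smul_comm]

theorem assoc_rTensor_phiTop {U V W X : Type*} [AddCommGroup U] [Module ℂ U] [AddCommGroup V]
    [Module ℂ V] [AddCommGroup W] [Module ℂ W] [AddCommGroup X] [Module ℂ X] {L : UqModule q X}
    {M : UqModule q U} {A : UqModule q V} {B : UqModule q W} {S : X →ₗ[ℂ] U ⊗[ℂ] V}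
    (hS : L.IsIntertwining (M.tensor hq A) S) {y : X} {x : U} {a : ℂ} {v : V} {α : ℂ} {m : ℕ}
    {w : W} {β : ℂ} {n : ℕ} {c : ℂ} (hy : S y = c • phiTop M x a A v α m) :
    TensorProduct.assoc ℂ U V W (S.rTensor W (phiTop L y (a + α) B w β n)) =
      c • compTop hq M x a A v α m B w β n := by
  have := phiTop_natural (x := y) (a := a + α) (v := w) (ν := β) hS (isIntertwining_id B) n
  rw [compTop, ← map_smul, ← phiTop_smul_left, ← hy]
  exact congrArg _ this

variable {j₁ j₂ j₃ j j₁₂ j₁₃ : Spin}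

/-- The composite vector attached to basis vectors of irreducible modules. -/
def spinComp (j₁ j₂ j₃ : Spin) (a b : ℕ) :
    SpinSpace j₁ ⊗[ℂ] (SpinSpace j₂ ⊗[ℂ] SpinSpace j₃) :=
  compTop hq (spinMod hq j₁) (finTop j₁.twice) j₁.twice (spinMod hq j₂) (xVec hq j₂ a)
    (j₂.twice - 2 * a) a (spinMod hq j₃) (xVec hq j₃ b) (j₃.twice - 2 * b) b

/-- Each of the two nested standard embeddings contributes the inverse of one norm; naturality of
`phiTop` identifies what is left with the composite vector. -/
theorem leftEmbedding_top (hq1 : q < 1) (h12 : Occurs j₁ j₂ j₁₂) (h : Occurs j₁₂ j₃ j) :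
    leftEmbedding hq j₁ j₂ j₃ j j₁₂ (finTop j.twice) =
      ((phiNorm hq j₁ j₂ j₁₂ : ℂ) * phiNorm hq j₁₂ j₃ j)⁻¹ •
        spinComp hq j₁ j₂ j₃ (defect j₁ j₂ j₁₂) (defect j₁₂ j₃ j) := by
  have hw : (j₁.twice : ℂ) + (j₂.twice - 2 * (defect j₁ j₂ j₁₂ : ℕ)) = j₁₂.twice := by
    have : (j₁.twice : ℂ) + j₂.twice = j₁₂.twice + 2 * (defect j₁ j₂ j₁₂ : ℕ) := by
      exact_mod_cast h12.add_eq
    linear_combination this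
  have := assoc_rTensor_phiTop hq (isIntertwining_stdEmbedding hq hq1 h12)
    (stdEmbedding_top hq hq1 h12) (B := spinMod hq j₃)
    (w := xVec hq j₃ (defect j₁₂ j₃ j)) (β := j₃.twice - 2 * (defect j₁₂ j₃ j : ℕ))
    (n := defect j₁₂ j₃ j)
  rw [hw] at this
  rw [leftEmbedding, LinearMap.comp_apply, LinearMap.comp_apply, stdEmbedding_top hq hq1 h,
    map_smul, map_smul, mul_inv_rev, mul_smul]
  exact congrArg _ this

end BraidAdjoint

/-! ### One braiding between two embeddings, evaluated by a q-Racah coefficient. -/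

section BraidRacah

variable {q : ℝ} (hq : 0 < q)

/-- Here c and d are the scalars of the braiding on X inside V₃ ⊗ V₁ and on r in Y ⊗ V₃. Naturality
lets the pair V₁ ⊗ V₂ be braided at the level of Y. -/
theorem form_braid_embeddings (hq1 : q < 1) {V₁ V₂ V₃ X Y : Type*} [AddCommGroup V₁] [Module ℂ V₁]
    [AddCommGroup V₂] [Module ℂ V₂] [AddCommGroup V₃] [Module ℂ V₃] [AddCommGroup X] [Module ℂ X]
    [AddCommGroup Y] [Module ℂ Y] {M₁ : UqModule q V₁}
    {M₂ : UqModule q V₂} {M₃ : UqModule q V₃} {L : UqModule q Y} {B₁ : LinearMap.BilinForm ℂ V₁}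
    {B₂ : LinearMap.BilinForm ℂ V₂} {B₃ : LinearMap.BilinForm ℂ V₃} (h₁ : M₁.IsContravariant B₁)
    (h₂ : M₂.IsContravariant B₂) (h₃ : M₃.IsContravariant B₃) {S : X →ₗ[ℂ] V₃ ⊗[ℂ] V₁}
    {S' : X →ₗ[ℂ] V₁ ⊗[ℂ] V₃} {T : Y →ₗ[ℂ] V₁ ⊗[ℂ] V₂} (hT : L.IsIntertwining (M₁.tensor hq M₂) T)
    {c d : ℂ} (hS : ∀ x, braid M₃ M₁ (S x) = c • S' x) {t : X ⊗[ℂ] V₂} {r : Y ⊗[ℂ] V₃}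
    {r' : V₃ ⊗[ℂ] Y} (hr : braid L M₃ r = d • r') :
    c * B₁.tmul (B₂.tmul B₃) ((braid M₃ M₂).lTensor V₁
        (TensorProduct.assoc ℂ V₁ V₃ V₂ (S'.rTensor V₂ t)))
      (TensorProduct.assoc ℂ V₁ V₂ V₃ (T.rTensor V₃ r)) =
    d * B₃.tmul (B₁.tmul B₂) (TensorProduct.assoc ℂ V₃ V₁ V₂ (S.rTensor V₂ t))
      (T.lTensor V₃ r') := by
  have h1 : (braid M₃ M₁).rTensor V₂ (S.rTensor V₂ t) = c • S'.rTensor V₂ t := by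
    have : braid M₃ M₁ ∘ₗ S = c • S' := LinearMap.ext hS
    rw [← LinearMap.comp_apply, ← LinearMap.rTensor_comp, this, LinearMap.rTensor_smul,
      LinearMap.smul_apply]
  have h2 : braid (M₁.tensor hq M₂) M₃ (T.rTensor V₃ r) = d • T.lTensor V₃ r' := by
    have := braid_natural hq hT (isIntertwining_id M₃) r
    rw [hr, map_smul] at this
    exact this
  have h3 := form_braid_braid hq hq1 h₁ h₂ h₃ (S.rTensor V₂ t) (T.rTensor V₃ r)
  rw [h1, h2] at h3
  simpa only [map_smul, LinearMap.smul_apply, smul_eq_mul] using h3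

variable {j₁ j₂ j₃ j j₁₂ j₁₃ : Spin}

theorem form_braid_leftEmbedding (hq1 : q < 1) (h12 : Occurs j₁ j₂ j₁₂) (h : Occurs j₁₂ j₃ j)
    (h13 : Occurs j₁ j₃ j₁₃) (h' : Occurs j₁₃ j₂ j) :
    shapovalov₃ q j₁ j₂ j₃ ((braid (spinMod hq j₃) (spinMod hq j₂)).lTensor (SpinSpace j₁)
        (leftEmbedding hq j₁ j₃ j₂ j j₁₃ (finTop j.twice)))
      (leftEmbedding hq j₁ j₂ j₃ j j₁₂ (finTop j.twice)) =
    (-1) ^ (defect j₁₂ j₃ j + defect j₁ j₃ j₁₃) *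
      ((q ^ ((casimir j + casimir j₁ - casimir j₁₂ - casimir j₁₃) / 2) : ℝ) : ℂ) *
      qRacah hq j₃ j₁ j₂ j j₁₃ j₁₂ := by
  have key := form_braid_embeddings hq hq1 (isContravariant_shapovalov hq (j := j₁))
    (isContravariant_shapovalov hq (j := j₂)) (isContravariant_shapovalov hq (j := j₃))
    (isIntertwining_stdEmbedding hq hq1 h12) (braid_stdEmbedding hq hq1 h13.symm)
    (t := stdEmbedding hq j₁₃ j₂ j (finTop j.twice))
    (braid_stdEmbedding hq hq1 h (finTop j.twice))
  rw [qRacah_eq hq hq1 h13.symm h' h12 h.symm]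
  set A := shapovalov₃ q j₁ j₂ j₃ ((braid (spinMod hq j₃) (spinMod hq j₂)).lTensor (SpinSpace j₁)
        (leftEmbedding hq j₁ j₃ j₂ j j₁₃ (finTop j.twice)))
      (leftEmbedding hq j₁ j₂ j₃ j j₁₂ (finTop j.twice)) with hA
  set W := shapovalov₃ q j₃ j₁ j₂ (leftEmbedding hq j₃ j₁ j₂ j j₁₃ (finTop j.twice))
      (rightEmbedding hq j₃ j₁ j₂ j j₁₂ (finTop j.twice)) with hW
  set c : ℂ := ((q ^ ((casimir j₁₃ - casimir j₃ - casimir j₁) / 2) : ℝ) : ℂ) with hc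
  set d : ℂ := ((q ^ ((casimir j - casimir j₁₂ - casimir j₃) / 2) : ℝ) : ℂ) with hd
  have key' : (-1) ^ defect j₃ j₁ j₁₃ * c * A = (-1) ^ defect j₁₂ j₃ j * d * W := key
  -- In the quotient of the two braiding scalars the Casimir value of j₃ cancels.
  have hcd : ((q ^ ((casimir j + casimir j₁ - casimir j₁₂ - casimir j₁₃) / 2) : ℝ) : ℂ) * c = d := by
    rw [hc, hd, ← Complex.ofReal_mul, ← Real.rpow_add hq]
    congr 2; ring
  have hc0 : c ≠ 0 := by
    rw [hc]
    exact_mod_cast (Real.rpow_pos_of_pos hq _).ne'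
  have hs : ((-1 : ℂ) ^ defect j₁ j₃ j₁₃) * (-1) ^ defect j₁ j₃ j₁₃ = 1 := by
    rw [← mul_pow]; simp
  rw [defect_comm j₁ j₃ j₁₃] at key'
  refine mul_left_cancel₀ hc0 ?_
  rw [pow_add]
  linear_combination (-1 : ℂ) ^ defect j₁ j₃ j₁₃ * key' - c * A * hs -
    (-1) ^ defect j₁₂ j₃ j * (-1) ^ defect j₁ j₃ j₁₃ * W * hcd

end BraidRacah

/-! ### From Verma modules to their irreducible quotients. -/

section Projection

variable {q : ℝ} (hq : 0 < q)

/-- The projection of a Verma module to its irreducible quotient. -/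
def vermaProj (j : Spin) : (ℕ →₀ ℂ) →ₗ[ℂ] SpinSpace j := vermaHom (spinMod hq j) (finTop j.twice)

theorem vermaProj_single (j : Spin) (k : ℕ) :
    vermaProj hq j (Finsupp.single k 1) = xVec hq j k := vermaHom_single _ _ k

theorem vermaProj_top (j : Spin) : vermaProj hq j vermaTop = finTop j.twice := vermaHom_top _ _

theorem isIntertwining_vermaProj (j : Spin) :
    (verma hq (j.twice : ℂ)).IsIntertwining (spinMod hq j) (vermaProj hq j) :=
  isIntertwining_vermaHom hq (spin_h_top hq j) (spin_e_top hq j)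

/-- Below the lowest weight the projection and `shap` vanish together, so the projection preserves
the forms. Pairings at λ = 2j can therefore be computed in the quotients. -/
theorem shapovalov_vermaProj (j : Spin) (x y : ℕ →₀ ℂ) :
    shapovalov q j (vermaProj hq j x) (vermaProj hq j y) = vermaForm q j.twice x y := by
  refine verma_bilin_ext (B := (shapovalov q j).compl₁₂ (vermaProj hq j) (vermaProj hq j))
    (fun k n => ?_) x y
  rw [LinearMap.compl₁₂_apply, vermaProj_single, vermaProj_single, shapovalov_xVec,
    vermaForm_single_single]

theorem tmul_form_map {V W V' W' : Type*} [AddCommMonoid V] [Module ℂ V] [AddCommMonoid W]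
    [Module ℂ W] [AddCommMonoid V'] [Module ℂ V'] [AddCommMonoid W'] [Module ℂ W']
    {B : LinearMap.BilinForm ℂ V} {C : LinearMap.BilinForm ℂ W}
    {B' : LinearMap.BilinForm ℂ V'} {C' : LinearMap.BilinForm ℂ W'} {S : V →ₗ[ℂ] V'}
    {T : W →ₗ[ℂ] W'} (hS : ∀ x y, B' (S x) (S y) = B x y) (hT : ∀ x y, C' (T x) (T y) = C x y)
    (z z' : V ⊗[ℂ] W) :
    B'.tmul C' (TensorProduct.map S T z) (TensorProduct.map S T z') = B.tmul C z z' := by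
  induction z using TensorProduct.induction_on with
  | zero => simp
  | add x y hx hy => simp only [map_add, LinearMap.add_apply, hx, hy]
  | tmul v w =>
    induction z' using TensorProduct.induction_on with
    | zero => simp
    | add x y hx hy => simp only [map_add, hx, hy]
    | tmul v' w' =>
      rw [TensorProduct.map_tmul, TensorProduct.map_tmul, LinearMap.BilinForm.tensorDistrib_tmul,
        LinearMap.BilinForm.tensorDistrib_tmul, hS, hT]

/-- The projection of a product of three Verma modules. -/
def vermaProj₃ (j₁ j₂ j₃ : Spin) : (ℕ →₀ ℂ) ⊗[ℂ] ((ℕ →₀ ℂ) ⊗[ℂ] (ℕ →₀ ℂ)) →ₗ[ℂ]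
    SpinSpace j₁ ⊗[ℂ] (SpinSpace j₂ ⊗[ℂ] SpinSpace j₃) :=
  TensorProduct.map (vermaProj hq j₁) (TensorProduct.map (vermaProj hq j₂) (vermaProj hq j₃))

theorem shapovalov₃_vermaProj₃ (j₁ j₂ j₃ : Spin)
    (z z' : (ℕ →₀ ℂ) ⊗[ℂ] ((ℕ →₀ ℂ) ⊗[ℂ] (ℕ →₀ ℂ))) :
    shapovalov₃ q j₁ j₂ j₃ (vermaProj₃ hq j₁ j₂ j₃ z) (vermaProj₃ hq j₁ j₂ j₃ z') =
      vermaForm₃ q j₁.twice j₂.twice j₃.twice z z' := by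
  rw [shapovalov₃, vermaProj₃, vermaForm₃, shapovalov₂]
  exact tmul_form_map (shapovalov_vermaProj hq j₁)
    (tmul_form_map (shapovalov_vermaProj hq j₂) (shapovalov_vermaProj hq j₃)) z z'

theorem vermaProj₃_vermaComp (j₁ j₂ j₃ : Spin) (a b : ℕ) :
    vermaProj₃ hq j₁ j₂ j₃ (vermaComp hq j₂.twice j₃.twice j₁.twice a b) =
      spinComp hq j₁ j₂ j₃ a b := by
  rw [vermaProj₃, vermaComp, spinComp, compTop_natural hq (isIntertwining_vermaProj hq j₁)
    (isIntertwining_vermaProj hq j₂) (isIntertwining_vermaProj hq j₃), vermaProj_top,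
    vermaProj_single, vermaProj_single]

theorem map_lTensor_braid (hq : 0 < q) {U V W U' V' W' : Type*} [AddCommGroup U] [Module ℂ U] [AddCommGroup V]
    [Module ℂ V] [AddCommGroup W] [Module ℂ W] [AddCommGroup U'] [Module ℂ U'] [AddCommGroup V']
    [Module ℂ V'] [AddCommGroup W'] [Module ℂ W'] {M : UqModule q V} {N : UqModule q W}
    {M' : UqModule q V'} {N' : UqModule q W'} {S : V →ₗ[ℂ] V'} {T : W →ₗ[ℂ] W'} (R : U →ₗ[ℂ] U')
    (hS : M.IsIntertwining M' S) (hT : N.IsIntertwining N' T) (z : U ⊗[ℂ] (V ⊗[ℂ] W)) :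
    TensorProduct.map R (TensorProduct.map T S) ((braid M N).lTensor U z) =
      (braid M' N').lTensor U' (TensorProduct.map R (TensorProduct.map S T) z) := by
  induction z using TensorProduct.induction_on with
  | zero => simp
  | add x y hx hy => simp only [map_add, hx, hy]
  | tmul u y =>
    rw [LinearMap.lTensor_tmul, TensorProduct.map_tmul, TensorProduct.map_tmul,
      LinearMap.lTensor_tmul, braid_natural hq hS hT]

theorem vermaProj₃_braid (j₁ j₂ j₃ : Spin) (z : (ℕ →₀ ℂ) ⊗[ℂ] ((ℕ →₀ ℂ) ⊗[ℂ] (ℕ →₀ ℂ))) :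
    vermaProj₃ hq j₁ j₂ j₃ ((braid (verma hq (j₃.twice : ℂ))
      (verma hq (j₂.twice : ℂ))).lTensor (ℕ →₀ ℂ) z) =
    (braid (spinMod hq j₃) (spinMod hq j₂)).lTensor (SpinSpace j₁) (vermaProj₃ hq j₁ j₃ j₂ z) :=
  map_lTensor_braid hq _ (isIntertwining_vermaProj hq j₃) (isIntertwining_vermaProj hq j₂) z

end Projection

/-! ### Continuous families of vectors, without a topology on the spaces. -/

section ContinuousFamily

variable {E F G : Type*} [AddCommMonoid E] [Module ℂ E] [AddCommMonoid F] [Module ℂ F]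
  [AddCommMonoid G] [Module ℂ G] {l₀ : ℂ}

/-- Families of vectors with finitely many coefficients that are continuous at `l₀`. -/
def contFamily (E : Type*) [AddCommMonoid E] [Module ℂ E] (l₀ : ℂ) : Submodule ℂ (ℂ → E) :=
  Submodule.span ℂ {u | ∃ (g : ℂ → ℂ) (x : E), ContinuousAt g l₀ ∧ u = fun l => g l • x}

theorem add_mem_contFamily {u v : ℂ → E} (hu : u ∈ contFamily E l₀) (hv : v ∈ contFamily E l₀) :
    (fun l => u l + v l) ∈ contFamily E l₀ := Submodule.add_mem _ hu hv

theorem zero_mem_contFamily : (fun _ => (0 : E)) ∈ contFamily E l₀ := Submodule.zero_mem _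

theorem smul_mem_contFamily {g : ℂ → ℂ} (hg : ContinuousAt g l₀) {u : ℂ → E}
    (hu : u ∈ contFamily E l₀) : (fun l => g l • u l) ∈ contFamily E l₀ := by
  induction hu using Submodule.span_induction with
  | mem u hu =>
    obtain ⟨g', x, hg', rfl⟩ := hu
    exact Submodule.subset_span ⟨fun l => g l * g' l, x, hg.mul hg', by simp only [mul_smul]⟩
  | zero => simpa using zero_mem_contFamily
  | add u v _ _ hu hv => simpa only [Pi.add_apply, smul_add] using add_mem_contFamily hu hv
  | smul c u _ hu =>
    simpa only [Pi.smul_apply, smul_comm _ c, Pi.smul_def] using Submodule.smul_mem _ c hu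

theorem const_mem_contFamily (x : E) : (fun _ => x) ∈ contFamily E l₀ :=
  Submodule.subset_span ⟨fun _ => 1, x, continuousAt_const, by simp⟩

theorem sum_mem_contFamily {ι : Type*} (s : Finset ι) {u : ι → ℂ → E}
    (hu : ∀ i ∈ s, u i ∈ contFamily E l₀) : (fun l => ∑ i ∈ s, u i l) ∈ contFamily E l₀ := by
  have := Submodule.sum_mem _ hu
  convert this using 1
  ext l; simp

/-- Applying a family of operators which depends continuously on the parameter. -/
theorem map_mem_contFamily {T : ℂ → E →ₗ[ℂ] F} (hT : ∀ x, (fun l => T l x) ∈ contFamily F l₀)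
    {u : ℂ → E} (hu : u ∈ contFamily E l₀) : (fun l => T l (u l)) ∈ contFamily F l₀ := by
  induction hu using Submodule.span_induction with
  | mem u hu =>
    obtain ⟨g, x, hg, rfl⟩ := hu
    simpa only [map_smul] using smul_mem_contFamily hg (hT x)
  | zero => simpa using zero_mem_contFamily
  | add u v _ _ hu hv => simpa only [Pi.add_apply, map_add] using add_mem_contFamily hu hv
  | smul c u _ hu =>
    simpa only [Pi.smul_apply, map_smul, Pi.smul_def] using Submodule.smul_mem _ c hu

theorem linearMap_mem_contFamily (T : E →ₗ[ℂ] F) {u : ℂ → E} (hu : u ∈ contFamily E l₀) :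
    (fun l => T (u l)) ∈ contFamily F l₀ :=
  map_mem_contFamily (T := fun _ => T) (fun x => const_mem_contFamily (T x)) hu

theorem bilin_mem_contFamily {B : ℂ → E →ₗ[ℂ] F →ₗ[ℂ] G}
    (hB : ∀ x y, (fun l => B l x y) ∈ contFamily G l₀) {u : ℂ → E} {v : ℂ → F}
    (hu : u ∈ contFamily E l₀) (hv : v ∈ contFamily F l₀) :
    (fun l => B l (u l) (v l)) ∈ contFamily G l₀ :=
  map_mem_contFamily (T := fun l => B l (u l))
    (fun y => map_mem_contFamily (T := fun l => (B l).flip y) (fun x => hB x y) hu) hv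

theorem tmul_mem_contFamily {u : ℂ → E} {v : ℂ → F} (hu : u ∈ contFamily E l₀)
    (hv : v ∈ contFamily F l₀) : (fun l => u l ⊗ₜ[ℂ] v l) ∈ contFamily (E ⊗[ℂ] F) l₀ :=
  bilin_mem_contFamily (B := fun _ => TensorProduct.mk ℂ E F)
    (fun _ _ => const_mem_contFamily _) hu hv

theorem continuousAt_of_mem_contFamily {u : ℂ → ℂ} (hu : u ∈ contFamily ℂ l₀) :
    ContinuousAt u l₀ := by
  induction hu using Submodule.span_induction with
  | mem u hu =>
    obtain ⟨g, x, hg, rfl⟩ := hu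
    exact hg.mul continuousAt_const
  | zero => exact continuousAt_const
  | add u v _ _ hu hv => exact hu.add hv
  | smul c u _ hu => exact continuousAt_const.mul hu

theorem mem_contFamily_of_continuousAt {g : ℂ → ℂ} (hg : ContinuousAt g l₀) :
    g ∈ contFamily ℂ l₀ := by
  simpa using smul_mem_contFamily hg (const_mem_contFamily (1 : ℂ))

end ContinuousFamily

/-! ### Continuity of composite vectors and forms in the highest weight. -/

section VermaContinuous

variable {q : ℝ} (hq : 0 < q) {l₀ : ℂ} {μ : ℂ → ℂ}

theorem vermaForm_mem_contFamily (hq : 0 < q) (hμ : ContinuousAt μ l₀) (x y : ℕ →₀ ℂ) :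
    (fun l => vermaForm q (μ l) x y) ∈ contFamily ℂ l₀ := by
  induction x using Finsupp.induction_linear with
  | zero => simpa using const_mem_contFamily (0 : ℂ)
  | add x x' hx hx' => simpa only [map_add, LinearMap.add_apply] using add_mem_contFamily hx hx'
  | single k c =>
    have h1 : ∀ l, vermaForm q (μ l) (Finsupp.single k c) y = c * (shap q (μ l) k * y k) := by
      intro l
      rw [← mul_one c, ← smul_eq_mul, ← Finsupp.smul_single, map_smul, LinearMap.smul_apply,
        vermaForm_single, smul_eq_mul, smul_eq_mul, mul_one]
    simp only [h1]
    exact mem_contFamily_of_continuousAt (continuousAt_const.mul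
      (((continuous_shap hq k).continuousAt.comp hμ).mul continuousAt_const))

theorem tmul_form_mem_contFamily {E F : Type*} [AddCommMonoid E] [Module ℂ E] [AddCommMonoid F]
    [Module ℂ F] {B : ℂ → LinearMap.BilinForm ℂ E} (C : LinearMap.BilinForm ℂ F)
    (hB : ∀ x y, (fun l => B l x y) ∈ contFamily ℂ l₀) (z z' : E ⊗[ℂ] F) :
    (fun l => (B l).tmul C z z') ∈ contFamily ℂ l₀ := by
  induction z using TensorProduct.induction_on with
  | zero => simpa using const_mem_contFamily (0 : ℂ)
  | add x y hx hy => simpa only [map_add, LinearMap.add_apply] using add_mem_contFamily hx hy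
  | tmul v w =>
    induction z' using TensorProduct.induction_on with
    | zero => simpa using const_mem_contFamily (0 : ℂ)
    | add x y hx hy => simpa only [map_add] using add_mem_contFamily hx hy
    | tmul v' w' =>
      simp only [LinearMap.BilinForm.tensorDistrib_tmul]
      exact smul_mem_contFamily continuousAt_const (hB v v')

theorem tensor_f_mem_contFamily {W : Type*} [AddCommGroup W] [Module ℂ W] (A : UqModule q W)
    (hμ : ContinuousAt μ l₀) (z : (ℕ →₀ ℂ) ⊗[ℂ] W) :
    (fun l => ((verma hq (μ l)).tensor hq A).f z) ∈ contFamily ((ℕ →₀ ℂ) ⊗[ℂ] W) l₀ := by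
  induction z using TensorProduct.induction_on with
  | zero => simpa using const_mem_contFamily _
  | add x y hx hy => simpa only [map_add] using add_mem_contFamily hx hy
  | tmul v w =>
    simp only [tensor_f_tmul]
    -- In the basis f^k x the action of f does not involve the highest weight, so the weight 0
    -- stands for any weight; only q^{-h/4} varies.
    refine add_mem_contFamily
      (const_mem_contFamily ((verma hq 0).f v ⊗ₜ[ℂ] A.qPowH (1 / 4) w)) ?_
    refine tmul_mem_contFamily (u := fun l => (verma hq (μ l)).qPowH (-1 / 4) v) ?_
      (const_mem_contFamily _)
    induction v using Finsupp.induction_linear with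
    | zero => simpa using const_mem_contFamily (0 : ℕ →₀ ℂ)
    | add x y hx hy => simpa only [map_add] using add_mem_contFamily hx hy
    | single k c =>
      have h1 : ∀ l, (verma hq (μ l)).qPowH (-1 / 4) (Finsupp.single k c) =
          (q : ℂ) ^ (-1 / 4 * (μ l - 2 * k)) • Finsupp.single k c := by
        intro l
        refine qPowH_apply _ _ ?_
        rw [← mul_one c, ← smul_eq_mul, ← Finsupp.smul_single, map_smul, verma_h_single, smul_comm]
      simp only [h1]
      refine smul_mem_contFamily ?_ (const_mem_contFamily _)
      exact (continuous_cpow_const hq).continuousAt.comp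
        (continuousAt_const.mul (hμ.sub continuousAt_const))

theorem phiCoeff_continuousAt (hq : 0 < q) {ν : ℂ} {k : ℕ} (hμ : ContinuousAt μ l₀)
    (h0 : shap q (μ l₀) k ≠ 0) : ContinuousAt (fun l => phiCoeff q (μ l) ν k) l₀ := by
  refine ContinuousAt.div (continuousAt_const.mul ?_) ((continuous_shap hq k).continuousAt.comp hμ) h0
  exact (continuous_cpow_const hq).continuousAt.comp (by fun_prop)

theorem tensor_f_pow_mem_contFamily {W : Type*} [AddCommGroup W] [Module ℂ W] (A : UqModule q W)
    (hμ : ContinuousAt μ l₀) {u : ℂ → (ℕ →₀ ℂ) ⊗[ℂ] W} (hu : u ∈ contFamily _ l₀) (k : ℕ) :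
    (fun l => (((verma hq (μ l)).tensor hq A).f ^ k) (u l)) ∈
      contFamily ((ℕ →₀ ℂ) ⊗[ℂ] W) l₀ := by
  induction k with
  | zero => simpa using hu
  | succ k ih =>
    simp only [pow_succ', Module.End.mul_apply]
    exact map_mem_contFamily (T := fun l => ((verma hq (μ l)).tensor hq A).f)
      (tensor_f_mem_contFamily hq A hμ) ih

/-- The only denominators are the `shap` values up to m and n, so these two need to be nonzero at
l₀; genericity of all weights is not required there. -/
theorem compTop_mem_contFamily {V W : Type*} [AddCommGroup V] [Module ℂ V] [AddCommGroup W]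
    [Module ℂ W] (A : UqModule q V) (v : V) (α : ℂ) (m : ℕ) (B : UqModule q W) (w : W) (β : ℂ)
    (n : ℕ) (hμ : ContinuousAt μ l₀) (hm : shap q (μ l₀) m ≠ 0) (hn : shap q (μ l₀ + α) n ≠ 0) :
    (fun l => compTop hq (verma hq (μ l)) vermaTop (μ l) A v α m B w β n) ∈
      contFamily ((ℕ →₀ ℂ) ⊗[ℂ] (V ⊗[ℂ] W)) l₀ := by
  have h1 : (fun l => phiTop (verma hq (μ l)) vermaTop (μ l) A v α m) ∈
      contFamily ((ℕ →₀ ℂ) ⊗[ℂ] V) l₀ := by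
    simp only [phiTop, verma_f_pow_top]
    refine sum_mem_contFamily _ fun k hk => smul_mem_contFamily ?_ (const_mem_contFamily _)
    exact phiCoeff_continuousAt hq hμ
      (shap_ne_zero_of_le (Nat.lt_succ_iff.1 (Finset.mem_range.1 hk)) hm)
  refine linearMap_mem_contFamily (TensorProduct.assoc ℂ (ℕ →₀ ℂ) V W).toLinearMap ?_
  simp only [phiTop.eq_def (tensor _ _ _)]
  refine sum_mem_contFamily _ fun k hk => smul_mem_contFamily ?_
    (tmul_mem_contFamily (tensor_f_pow_mem_contFamily hq A hμ h1 k) (const_mem_contFamily _))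
  exact phiCoeff_continuousAt hq (hμ.add continuousAt_const)
    (shap_ne_zero_of_le (Nat.lt_succ_iff.1 (Finset.mem_range.1 hk)) hn)

theorem vermaComp_mem_contFamily (γ δ : ℂ) {a b : ℕ} (hμ : ContinuousAt μ l₀)
    (ha : shap q (μ l₀) a ≠ 0) (hb : shap q (μ l₀ + (γ - 2 * a)) b ≠ 0) :
    (fun l => vermaComp hq γ δ (μ l) a b) ∈ contFamily _ l₀ :=
  compTop_mem_contFamily hq _ _ _ _ _ _ _ _ hμ ha hb

theorem vermaForm₃_continuousAt (hq : 0 < q) (γ δ : ℂ) (hμ : ContinuousAt μ l₀)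
    {u v : ℂ → (ℕ →₀ ℂ) ⊗[ℂ] ((ℕ →₀ ℂ) ⊗[ℂ] (ℕ →₀ ℂ))} (hu : u ∈ contFamily _ l₀)
    (hv : v ∈ contFamily _ l₀) : ContinuousAt (fun l => vermaForm₃ q (μ l) γ δ (u l) (v l)) l₀ :=
  continuousAt_of_mem_contFamily (bilin_mem_contFamily (B := fun l => vermaForm₃ q (μ l) γ δ)
    (tmul_form_mem_contFamily _ (vermaForm_mem_contFamily hq hμ)) hu hv)

end VermaContinuous

/-! ### The limit λ → 2j. -/

section Limit

variable {q : ℝ} (hq : 0 < q) {j₁ j₂ j₃ j j₁₂ j₁₃ : Spin}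

theorem eventually_nonresonant (hq : 0 < q) (hq1 : q < 1) (N : ℕ) :
    ∀ᶠ l in 𝓝[≠] (N : ℂ), Nonresonant q l := by
  have := eventually_qNum_ne_zero hq hq1 N
  rw [Int.cast_natCast] at this
  filter_upwards [this] with l hl i k
  refine shap_ne_zero hq hq1 fun r _ => ?_
  have := hl (i - r)
  push_cast at this
  rwa [add_sub_assoc]

theorem shapovalov₃_leftEmbedding (hq1 : q < 1) (h12 : Occurs j₁ j₂ j₁₂) (h : Occurs j₁₂ j₃ j)
    (x y : SpinSpace j) : shapovalov₃ q j₁ j₂ j₃ (leftEmbedding hq j₁ j₂ j₃ j j₁₂ x)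
      (leftEmbedding hq j₁ j₂ j₃ j j₁₂ y) = shapovalov q j x y := by
  rw [← shapovalov₂_stdEmbedding hq hq1 h, shapovalov₃, leftEmbedding, shapovalov₂, shapovalov₂]
  refine (tmul_form_assoc (shapovalov q j₁) (shapovalov q j₂) (shapovalov q j₃) _ _).trans ?_
  exact tmul_form_map (S := stdEmbedding hq j₁ j₂ j₁₂) (T := LinearMap.id)
    (shapovalov₂_stdEmbedding hq hq1 h12) (fun _ _ => rfl) _ _

theorem spinComp_eq (hq1 : q < 1) (h12 : Occurs j₁ j₂ j₁₂) (h : Occurs j₁₂ j₃ j) :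
    spinComp hq j₁ j₂ j₃ (defect j₁ j₂ j₁₂) (defect j₁₂ j₃ j) =
      ((phiNorm hq j₁ j₂ j₁₂ : ℂ) * phiNorm hq j₁₂ j₃ j) •
        leftEmbedding hq j₁ j₂ j₃ j j₁₂ (finTop j.twice) := by
  have h1 : (phiNorm hq j₁ j₂ j₁₂ : ℂ) ≠ 0 := by exact_mod_cast (phiNorm_pos hq hq1 h12).ne'
  have h2 : (phiNorm hq j₁₂ j₃ j : ℂ) ≠ 0 := by exact_mod_cast (phiNorm_pos hq hq1 h).ne'
  rw [leftEmbedding_top hq hq1 h12 h, smul_smul, mul_inv_cancel₀ (mul_ne_zero h1 h2), one_smul]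

/-- The limit of the matrix elements of the exchange matrix. -/
theorem tendsto_exchangeElement (hq1 : q < 1) (h12 : Occurs j₁ j₂ j₁₂) (h : Occurs j₁₂ j₃ j)
    (h13 : Occurs j₁ j₃ j₁₃) (h' : Occurs j₁₃ j₂ j) {s m n : ℕ} (hm : m = defect j₁ j₂ j₁₂)
    (hsm : s - m = defect j₁₂ j₃ j) (hsn : s - n = defect j₁ j₃ j₁₃) (hn : n = defect j₁₃ j₂ j)
    (hms : m ≤ s) (hns : n ≤ s) :
    Filter.Tendsto (fun l : ℂ => exchangeElement hq (j₂.twice : ℂ) (j₃.twice : ℂ) s m n l)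
      (𝓝[≠] (j.twice : ℂ)) (𝓝 (((phiNorm hq j₁ j₃ j₁₃ : ℂ) * phiNorm hq j₁₃ j₂ j) /
        ((phiNorm hq j₁ j₂ j₁₂ : ℂ) * phiNorm hq j₁₂ j₃ j) *
        ((-1) ^ (defect j₁₂ j₃ j + defect j₁ j₃ j₁₃) *
          ((q ^ ((casimir j + casimir j₁ - casimir j₁₂ - casimir j₁₃) / 2) : ℝ) : ℂ) *
          qRacah hq j₃ j₁ j₂ j j₁₃ j₁₂))) := by
  have p1 : (phiNorm hq j₁ j₂ j₁₂ : ℂ) ≠ 0 := by exact_mod_cast (phiNorm_pos hq hq1 h12).ne'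
  have p2 : (phiNorm hq j₁₂ j₃ j : ℂ) ≠ 0 := by exact_mod_cast (phiNorm_pos hq hq1 h).ne'
  set γ : ℂ := (j₂.twice : ℂ) with hγ
  set δ : ℂ := (j₃.twice : ℂ) with hδ
  set μ : ℂ → ℂ := fun l => l - γ - δ + 2 * s with hμ
  have e1 := h12.add_eq
  have e2 := h.add_eq
  have e3 := h13.add_eq
  have e4 := h'.add_eq
  -- At λ = 2j the weight μ is 2j₁, because s = j₁ + j₂ + j₃ - j.
  have hμ0 : μ j.twice = j₁.twice := by
    have : (j.twice : ℂ) + 2 * s = j₁.twice + γ + δ := by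
      rw [hγ, hδ]; norm_cast; omega
    simp only [hμ]; linear_combination this
  have hμc : ContinuousAt μ j.twice := by fun_prop
  have w12 : μ j.twice + (γ - 2 * m) = j₁₂.twice := by
    have : (j₁.twice : ℂ) + γ = j₁₂.twice + 2 * m := by
      rw [hγ]; norm_cast; omega
    rw [hμ0]; linear_combination this
  have w13 : μ j.twice + (δ - 2 * (s - n : ℕ)) = j₁₃.twice := by
    have : (j₁.twice : ℂ) + δ = j₁₃.twice + 2 * (s - n : ℕ) := by
      rw [hδ]; norm_cast; omega
    rw [hμ0]; linear_combination this
  -- The denominators stay nonzero at 2j because m and s - m are defects, bounded by 2j₁ and 2j₁₂.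
  have hX := vermaComp_mem_contFamily hq γ δ (a := m) (b := s - m) hμc
    (by rw [hμ0]; exact (shap_natCast_pos hq hq1 (hm ▸ h12.defect_le_left)).ne')
    (by rw [w12]; exact (shap_natCast_pos hq hq1 (hsm ▸ h.defect_le_left)).ne')
  have hY := vermaComp_mem_contFamily hq δ γ (a := s - n) (b := n) hμc
    (by rw [hμ0]; exact (shap_natCast_pos hq hq1 (hsn ▸ h13.defect_le_left)).ne')
    (by rw [w13]; exact (shap_natCast_pos hq hq1 (hn ▸ h'.defect_le_left)).ne')
  have hD := vermaForm₃_continuousAt hq γ δ hμc hX hX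
  have hN := vermaForm₃_continuousAt hq γ δ hμc (linearMap_mem_contFamily
    ((braid (verma hq δ) (verma hq γ)).lTensor (ℕ →₀ ℂ)) hY) hX
  have hXv : vermaProj₃ hq j₁ j₂ j₃ (vermaComp hq γ δ j₁.twice m (s - m)) =
      ((phiNorm hq j₁ j₂ j₁₂ : ℂ) * phiNorm hq j₁₂ j₃ j) •
        leftEmbedding hq j₁ j₂ j₃ j j₁₂ (finTop j.twice) := by
    rw [vermaProj₃_vermaComp, hsm, hm, spinComp_eq hq hq1 h12 h]
  have hYv : vermaProj₃ hq j₁ j₃ j₂ (vermaComp hq δ γ j₁.twice (s - n) n) =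
      ((phiNorm hq j₁ j₃ j₁₃ : ℂ) * phiNorm hq j₁₃ j₂ j) •
        leftEmbedding hq j₁ j₃ j₂ j j₁₃ (finTop j.twice) := by
    rw [vermaProj₃_vermaComp, hsn, hn, spinComp_eq hq hq1 h13 h']
  -- The embedded highest weight vector is normalised, so only the squared product of norms remains;
  -- it is nonzero, which permits the division.
  have hD0 : vermaForm₃ q (μ j.twice) γ δ (vermaComp hq γ δ (μ j.twice) m (s - m))
      (vermaComp hq γ δ (μ j.twice) m (s - m)) =
      ((phiNorm hq j₁ j₂ j₁₂ : ℂ) * phiNorm hq j₁₂ j₃ j) ^ 2 := by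
    rw [hμ0, ← shapovalov₃_vermaProj₃ hq, hXv, map_smul, map_smul, LinearMap.smul_apply,
      shapovalov₃_leftEmbedding hq hq1 h12 h, shapovalov_top_top, smul_eq_mul, smul_eq_mul]
    ring
  have hN0 : vermaForm₃ q (μ j.twice) γ δ ((braid (verma hq δ) (verma hq γ)).lTensor (ℕ →₀ ℂ)
      (vermaComp hq δ γ (μ j.twice) (s - n) n)) (vermaComp hq γ δ (μ j.twice) m (s - m)) =
      ((phiNorm hq j₁ j₂ j₁₂ : ℂ) * phiNorm hq j₁₂ j₃ j) *
      (((phiNorm hq j₁ j₃ j₁₃ : ℂ) * phiNorm hq j₁₃ j₂ j) *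
        ((-1) ^ (defect j₁₂ j₃ j + defect j₁ j₃ j₁₃) *
          ((q ^ ((casimir j + casimir j₁ - casimir j₁₂ - casimir j₁₃) / 2) : ℝ) : ℂ) *
          qRacah hq j₃ j₁ j₂ j j₁₃ j₁₂)) := by
    rw [hμ0, ← shapovalov₃_vermaProj₃ hq, hXv, vermaProj₃_braid, hYv, map_smul, map_smul, map_smul,
      LinearMap.smul_apply, form_braid_leftEmbedding hq hq1 h12 h h13 h', smul_eq_mul, smul_eq_mul]
  have hne := mul_ne_zero p1 p2
  have hlim := (hN.tendsto.div hD.tendsto (by rw [hD0]; exact pow_ne_zero 2 hne)).mono_left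
    (nhdsWithin_le_nhds (s := {(j.twice : ℂ)}ᶜ))
  rw [hN0, hD0] at hlim
  have hval : ∀ A B C : ℂ, A ≠ 0 → A * (B * C) / A ^ 2 = B / A * C := by
    intro A B C hA
    field_simp
  rw [hval _ _ _ hne] at hlim
  refine hlim.congr' ?_
  have hDne := (hD.eventually_ne (by rw [hD0]; exact pow_ne_zero 2 hne)).filter_mono
    (nhdsWithin_le_nhds (s := {(j.twice : ℂ)}ᶜ))
  -- Near 2j, but not at 2j, the parameter is nonresonant and the quotient of pairings is the matrix
  -- element.
  filter_upwards [eventually_nonresonant hq hq1 j.twice, hDne] with l hl hl0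
  exact (div_eq_iff hl0).2 (exchangeElement_mul hq hq1 hl hms hns rfl).symm

end Limit

end QuantumSl2

end

/-! ### The theorem: translating the spin conditions and comparing signs. -/

open QuantumSl2 in
theorem theorem10p1 (q : ℝ) (hq : 0 < q) (hq1 : q < 1) (j₁ j₂ j₃ j j₁₂ j₁₃ : Spin)
    -- `V^j` occurs in `V^{j₁} ⊗ V^{j₂} ⊗ V^{j₃}`
    (h7 : (∃ k : ℕ, (j₁ : ℝ) + j₂ + j₃ - j = k) ∧ (∃ k : ℕ, (j₁ : ℝ) + j₂ - j₃ + j = k) ∧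
      (∃ k : ℕ, (j₁ : ℝ) - j₂ + j₃ + j = k) ∧ (∃ k : ℕ, -(j₁ : ℝ) + j₂ + j₃ + j = k))
    -- range of `j₁₂`
    (h8 : max |(j : ℝ) - j₃| |(j₁ : ℝ) - j₂| ≤ j₁₂ ∧ (j₁₂ : ℝ) ≤ min ((j : ℝ) + j₃) ((j₁ : ℝ) + j₂))
    -- range of `j₁₃`
    (h19 : max |(j : ℝ) - j₂| |(j₃ : ℝ) - j₁| ≤ j₁₃ ∧
      (j₁₃ : ℝ) ≤ min ((j : ℝ) + j₂) ((j₃ : ℝ) + j₁))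
    -- the indices of the exchange matrix; in particular these numbers are integers
    (s m n : ℕ) (hs : (s : ℝ) = j₁ + j₂ + j₃ - j) (hm : (m : ℝ) = j₁ + j₂ - j₁₂)
    (hn : (n : ℝ) = j₂ + j₁₃ - j) :
    -- `R` is the value at `l = 2j`, by continuity, of the matrix element `R_{q,2j₂,2j₃,s;m,n}(l)`,
    -- which is defined for generic `l`
    ∃ R : ℂ, Filter.Tendsto
        (fun l : ℂ => exchangeElement hq (j₂.twice : ℂ) (j₃.twice : ℂ) s m n l)
        (𝓝[≠] (j.twice : ℂ)) (𝓝 R) ∧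
      -- `m - n = j + j₁ - j₁₂ - j₁₃`
      (-1 : ℂ) ^ ((m : ℤ) - (n : ℤ)) *
          ((q ^ ((casimir j + casimir j₁ - casimir j₁₂ - casimir j₁₃) / 2) : ℝ) : ℂ) *
          qRacah hq j₃ j₁ j₂ j j₁₃ j₁₂ =
        ((phiNorm hq j₁ j₂ j₁₂ * phiNorm hq j₁₂ j₃ j /
            (phiNorm hq j₁ j₃ j₁₃ * phiNorm hq j₁₃ j₂ j) : ℝ) : ℂ) * R := by
  have c8 := h8.1
  have d8 := h8.2
  have c19 := h19.1
  have d19 := h19.2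
  rw [max_le_iff, abs_le, abs_le] at c8 c19
  rw [le_min_iff] at d8 d19
  have hms : m ≤ s := by
    have : (m : ℝ) ≤ s := by linarith [c8.1.1, c8.1.2]
    exact_mod_cast this
  have hns : n ≤ s := by
    have : (n : ℝ) ≤ s := by linarith
    exact_mod_cast this
  have h12 : Occurs j₁ j₂ j₁₂ := ⟨abs_le.2 c8.2, d8.2, m, hm.symm⟩
  -- The triangle inequalities are symmetric in the three spins; s - m is the corresponding defect.
  have h : Occurs j₁₂ j₃ j := by
    refine ⟨abs_le.2 ⟨by linarith, by linarith⟩, by linarith, s - m, ?_⟩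
    rw [Nat.cast_sub hms]; linarith
  have h13 : Occurs j₁ j₃ j₁₃ := by
    refine ⟨abs_le.2 ⟨by linarith, by linarith⟩, by linarith, s - n, ?_⟩
    rw [Nat.cast_sub hns]; linarith
  have h' : Occurs j₁₃ j₂ j := by
    refine ⟨abs_le.2 ⟨by linarith, by linarith⟩, by linarith, n, by linarith⟩
  have es : 2 * s + j.twice = j₁.twice + j₂.twice + j₃.twice := by
    have : 2 * (s : ℝ) + j.twice = j₁.twice + j₂.twice + j₃.twice := by rw [hs]; ring
    exact_mod_cast this
  have em : 2 * m + j₁₂.twice = j₁.twice + j₂.twice := by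
    have : 2 * (m : ℝ) + j₁₂.twice = j₁.twice + j₂.twice := by rw [hm]; ring
    exact_mod_cast this
  have en : 2 * n + j.twice = j₂.twice + j₁₃.twice := by
    have : 2 * (n : ℝ) + j.twice = j₂.twice + j₁₃.twice := by rw [hn]; ring
    exact_mod_cast this
  have e1 := h12.add_eq
  have e2 := h.add_eq
  have e3 := h13.add_eq
  have e4 := h'.add_eq
  refine ⟨_, tendsto_exchangeElement hq hq1 h12 h h13 h' (by omega) (by omega) (by omega)
    (by omega) hms hns, ?_⟩
  have p1 : (phiNorm hq j₁ j₂ j₁₂ : ℂ) ≠ 0 := by exact_mod_cast (phiNorm_pos hq hq1 h12).ne'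
  have p2 : (phiNorm hq j₁₂ j₃ j : ℂ) ≠ 0 := by exact_mod_cast (phiNorm_pos hq hq1 h).ne'
  have p3 : (phiNorm hq j₁ j₃ j₁₃ : ℂ) ≠ 0 := by exact_mod_cast (phiNorm_pos hq hq1 h13).ne'
  have p4 : (phiNorm hq j₁₃ j₂ j : ℂ) ≠ 0 := by exact_mod_cast (phiNorm_pos hq hq1 h').ne'
  -- The defects are s - m and s - n, whose sum differs from m - n by the even number 2(s - m).
  have hsign : (-1 : ℂ) ^ ((m : ℤ) - (n : ℤ)) = (-1) ^ (defect j₁₂ j₃ j + defect j₁ j₃ j₁₃) := by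
    have hd : ((defect j₁₂ j₃ j + defect j₁ j₃ j₁₃ : ℕ) : ℤ) = (m : ℤ) - n + 2 * (s - m) := by
      push_cast; omega
    rw [← zpow_natCast, hd, zpow_add₀ (by norm_num), zpow_mul]
    norm_num
  rw [hsign]
  push_cast
  field_simp
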